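/- Let $G_{\mathcal S}$ be the class-two nilpotent group $$G_{\mathcal S}=\langle x_1,x_2,x_3,x_4,y_1,y_2,y_3,y_4 : [x_1,x_3]=y_1,\ [x_1,x_4]=y_2,\ [x_2,x_3]=y_3,\ [x_2,x_4]=y_4\rangle,$$ where all other commutators of generators are trivial (in particular the $y_k$ are central). Its matrix of relations $([x_i,x_j])_{i,j}$, written additively as linear forms in $y_1,\dots,y_4$, has determinant $(y_1y_4-y_2y_3)^2$, so its Pfaffian hypersurface is the Segre quadric $y_1y_4-y_2y_3=0$ in $\mathbb P^3$. For a finitely generated group $G$ and a prime $p$ let $a^{\triangleleft}_{p^k}(G)$ be the number of normal subgroups of index $p^k$ in $G$ and $\zeta^{\triangleleft}_{G,p}(s)=\sum_{k\ge 0}a^{\triangleleft}_{p^k}(G)\,p^{-ks}$. Put $\zeta_p(s)=1/(1-p^{-s})$ and $\zeta_{\mathbb Z^4,p}(s)=\zeta^{\triangleleft}_{\mathbb Z^4,p}(s)$. For variables $U_1,\dots,U_n$ let $$I_n(U_1,\dots,U_n)=\sum_{I\subseteq\{1,\dots,n\}}b_I(p^{-1})\prod_{i\in I}\frac{U_i}{1-U_i},$$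 where, for $I=\{i_1<\dots<i_l\}$, $b_I(q)=\binom{n+1}{i_l}_q\binom{i_l}{i_{l-1}}_q\cdots\binom{i_2}{i_1}_q$ is the polynomial (a product of Gaussian binomial coefficients) whose value at $q=p$ is the number of flags of type $I$ in $\mathbb F_p^{\,n+1}$. Put $$X_i=p^{i(8-i)-(4+i)s}\ (i=1,2,3),\qquad Y_1=p^{6-3s},\qquad Y_2=p^{9-5s},$$ $$E_1(X_1,Y_1)=\frac{p^{-2}Y_1-p^{-3}X_1}{(1-X_1)(1-Y_1)},\qquad E_2(X_2,Y_2)=\frac{p^{-1}Y_2-p^{-4}X_2}{(1-X_2)(1-Y_2)},$$ $$W_0=I_3(X_1,X_2,X_3),\qquad W_1=I_2(X_2,X_3)\,E_1(X_1,Y_1),\qquad W_2=I_1(X_3)\,E_2(X_2,Y_2)\,I_1(Y_1).$$ **Theorem.** For almost all primes $p$ (all but finitely many) and all $s\in\mathbb C$ with $\Re(s)>3$, the series defining $\zeta_{\mathbb Z^4,p}(s)$ and $\zeta^{\triangleleft}_{G_{\mathcal S},p}(s)$ have finite coefficients and converge absolutely, $\zeta_{\mathbb Z^4,p}(s)=\zeta_p(s)\zeta_p(s-1)\zeta_p(s-2)\zeta_p(s-3)$,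 and $$\zeta^{\triangleleft}_{G_{\mathcal S},p}(s)=\zeta_{\mathbb Z^4,p}(s)\,\zeta_p(8s-16)\,\bigl(W_0+(p+1)^2W_1+2(p+1)W_2\bigr).$$ Moreover, $$\zeta^{\triangleleft}_{G_{\mathcal S},p}(s)=\zeta_{\mathbb Z^4,p}(s)\,\zeta_p(8s-16)\,\zeta_p(5s-7)\,\zeta_p(6s-12)\,\zeta_p(7s-15)\,\zeta_p(3s-6)\,\zeta_p(5s-9)\,W(p,p^{-s}),$$ where $$\begin{aligned}W(p,T)=\ &1 \\ &\quad +p^{4}T^{3}+2p^{5}T^{3} \\ &\quad -p^{5}T^{5}+2p^{8}T^{5}+p^{9}T^{5} \\ &\quad -p^{8}T^{6}-p^{9}T^{6}+2p^{10}T^{6}+p^{11}T^{6} \\ &\quad +p^{12}T^{7}+p^{13}T^{7}+p^{14}T^{7} \\ &\quad -p^{10}T^{8}-p^{11}T^{8}-p^{12}T^{8}+p^{13}T^{8} \\ &\quad -2p^{13}T^{9}-2p^{14}T^{9}+2p^{15}T^{9}+p^{16}T^{9} \\ &\quad +p^{14}T^{10}-2p^{15}T^{10}-2p^{16}T^{10}+p^{17}T^{10}+2p^{18}T^{10}+2p^{19}T^{10}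 \\ &\quad -2p^{17}T^{11}-p^{18}T^{11}-2p^{19}T^{11}-p^{20}T^{11} \\ &\quad -p^{18}T^{12}-2p^{19}T^{12}-p^{21}T^{12}+p^{22}T^{12}+p^{23}T^{12} \\ &\quad +p^{19}T^{13}-p^{20}T^{13}-p^{21}T^{13}-p^{22}T^{13}-p^{23}T^{13}+p^{24}T^{13} \\ &\quad +p^{20}T^{14}+p^{21}T^{14}-p^{22}T^{14}-2p^{24}T^{14}-p^{25}T^{14} \\ &\quad -p^{23}T^{15}-2p^{24}T^{15}-p^{25}T^{15}-2p^{26}T^{15} \\ &\quad +2p^{24}T^{16}+2p^{25}T^{16}+p^{26}T^{16}-2p^{27}T^{16}-2p^{28}T^{16}+p^{29}T^{16} \\ &\quad +p^{27}T^{17}+2p^{28}T^{17}-2p^{29}T^{17}-2p^{30}T^{17} \\ &\quad +p^{30}T^{18}-p^{31}T^{18}-p^{32}T^{18}-p^{33}T^{18} \\ &\quad +p^{29}T^{19}+p^{30}T^{19}+p^{31}T^{19} \\ &\quad +p^{32}T^{20}+2p^{33}T^{20}-p^{34}T^{20}-p^{35}T^{20} \\ &\quad +p^{34}T^{21}+2p^{35}T^{21}-p^{38}T^{21}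 \\ &\quad +2p^{38}T^{23}+p^{39}T^{23} \\ &\quad +p^{43}T^{26}.\end{aligned}$$ -/

import Mathlib

open scoped commutatorElement

/-! ### Normal zeta functions of groups -/

/-- The normal subgroups of index `n` of `G`. -/
def normalSubgroupsOfIndex (G : Type*) [Group G] (n : ℕ) : Set (Subgroup G) :=
  {H | H.Normal ∧ H.index = n}

/-- The number of normal subgroups of index `n` of `G`. -/
noncomputable def normalSubgroupCount (G : Type*) [Group G] (n : ℕ) : ℕ :=
  (normalSubgroupsOfIndex G n).ncard

/-- The `k`-th term of the local normal zeta function of `G` at `p`: the number of normal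
subgroups of index `p ^ k`, times `p ^ (-k s)`. -/
noncomputable def localNormalZetaTerm (G : Type*) [Group G] (p : ℕ) (s : ℂ) (k : ℕ) : ℂ :=
  (normalSubgroupCount G (p ^ k) : ℂ) * (p : ℂ) ^ (-(k * s))

/-- All the coefficients of the local normal zeta function of `G` at `p` are genuine (finite)
cardinalities and the series converges absolutely at `s`. -/
def LocalNormalZetaConverges (G : Type*) [Group G] (p : ℕ) (s : ℂ) : Prop :=
  (∀ k : ℕ, (normalSubgroupsOfIndex G (p ^ k)).Finite) ∧ Summable (localNormalZetaTerm G p s)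

/-- The local normal zeta function of `G` at `p`. -/
noncomputable def localNormalZeta (G : Type*) [Group G] (p : ℕ) (s : ℂ) : ℂ :=
  ∑' k : ℕ, localNormalZetaTerm G p s k

/-- The local factor `1 / (1 - p ^ (-s))` of the Riemann zeta function. -/
noncomputable def localRiemannZeta (p : ℕ) (s : ℂ) : ℂ :=
  1 / (1 - (p : ℂ) ^ (-s))

/-! ### Class two groups presented by a matrix of relations -/

/-- Relations of the class two group on `x_1, …, x_d, y_1, …, y_{d'}`: every `[x_i, x_j]` is
the product of the `y_k ^ (M i j k)`, and the `y_k` are central. The vector `M i j` holds the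
coefficients of the linear form in the `(i, j)` entry of the matrix of relations. -/
def classTwoRelations {d d' : ℕ} (M : Matrix (Fin d) (Fin d) (Fin d' → ℤ)) :
    Set (FreeGroup (Fin d ⊕ Fin d')) :=
  {g | ∃ i j : Fin d,
      g = ⁅(FreeGroup.of (Sum.inl i) : FreeGroup (Fin d ⊕ Fin d')), FreeGroup.of (Sum.inl j)⁆ *
        ((List.ofFn fun k : Fin d' =>
          (FreeGroup.of (Sum.inr k) : FreeGroup (Fin d ⊕ Fin d')) ^ M i j k).prod)⁻¹} ∪
  {g | ∃ (k : Fin d') (a : Fin d ⊕ Fin d'),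
      g =
        ⁅(FreeGroup.of (Sum.inr k) : FreeGroup (Fin d ⊕ Fin d')), FreeGroup.of a⁆}

/-- The class two group with matrix of relations `M`. -/
abbrev ClassTwoGroup {d d' : ℕ} (M : Matrix (Fin d) (Fin d) (Fin d' → ℤ)) : Type :=
  PresentedGroup (classTwoRelations M)

/-- The matrix of relations, with entries written as linear forms in `y_1, …, y_{d'}`. -/
noncomputable def relationMatrix {d d' : ℕ} (M : Matrix (Fin d) (Fin d) (Fin d' → ℤ)) :
    Matrix (Fin d) (Fin d) (MvPolynomial (Fin d') ℤ) :=
  Matrix.of fun i j => ∑ k, MvPolynomial.C (M i j k) * MvPolynomial.X k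

/-- The linear form `y_{k+1}`, as a coefficient vector. -/
def yForm (k : Fin 4) : Fin 4 → ℤ := Pi.single k 1

/-- The relations `[x_1, x_3] = y_1`, `[x_1, x_4] = y_2`, `[x_2, x_3] = y_3`,
`[x_2, x_4] = y_4`, all other commutators of the generators being trivial. -/
def segreMatrix : Matrix (Fin 4) (Fin 4) (Fin 4 → ℤ) :=
  !![0, 0, yForm 0, yForm 1;
     0, 0, yForm 2, yForm 3;
     -yForm 0, -yForm 2, 0, 0;
     -yForm 1, -yForm 3, 0, 0]

/-- The group `G_S`. -/
abbrev SegreGroup : Type := ClassTwoGroup segreMatrix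

/-- The Pfaffian of `G_S` is the quadric `y_1 y_4 - y_2 y_3`. -/
theorem det_relationMatrix_segreMatrix :
    (relationMatrix segreMatrix).det =
      (MvPolynomial.X 0 * MvPolynomial.X 3 - MvPolynomial.X 1 * MvPolynomial.X 2) ^ 2 := by
  simp [relationMatrix, segreMatrix, yForm, Matrix.det_succ_row_zero, Fin.sum_univ_succ,
    Fin.succAbove, Pi.single_apply]
  ring

/-! ### Igusa factors and exceptional factors -/

/-- The Gaussian binomial coefficient `(n choose k)_q`, a polynomial in `q`, evaluated at `q`. -/
def gaussBinom {K : Type*} [Field K] (q : K) : ℕ → ℕ → K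
  | _, 0 => 1
  | 0, _ + 1 => 0
  | n + 1, k + 1 => gaussBinom q n k + q ^ (k + 1) * gaussBinom q n (k + 1)

/-- For a decreasing list `i_l > … > i_1` the product
`(N choose i_l)_q (i_l choose i_{l-1})_q ⋯ (i_2 choose i_1)_q`. For a prime power `q` this is the
number of flags in `𝔽_q ^ N` with members of dimensions `i_1 < … < i_l`. -/
def flagPoly {K : Type*} [Field K] (q : K) : ℕ → List ℕ → K
  | _, [] => 1
  | N, i :: l => gaussBinom q N i * flagPoly q i l

/-- The Igusa factor `I_n(U_1, …, U_n) = ∑_{I ⊆ {1, …, n}} b_I(p⁻¹) ∏_{i ∈ I} U_i / (1 - U_i)`,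
where `b_I(p)` is the number of flags of type `I` in `𝔽_p ^ (n + 1)`. The index `i : Fin n`
stands for `i + 1 ∈ {1, …, n}`. -/
def igusaFactor {K : Type*} [Field K] (p : K) {n : ℕ} (U : Fin n → K) : K :=
  ∑ I : Finset (Fin n),
    flagPoly p⁻¹ (n + 1) ((I.sort (· ≥ ·)).map fun i => (i : ℕ) + 1) *
      ∏ i ∈ I, U i / (1 - U i)

/-- The exceptional factor `E(X, Y)` with numerical data `n` and `d`. -/
def exceptionalFactor {K : Type*} [Field K] (p : K) (n d : ℕ) (X Y : K) : K :=
  (p⁻¹ ^ d * Y - p⁻¹ ^ n * X) / ((1 - X) * (1 - Y))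

/-! ### The data of `G_S` -/

/-- `X_i = p ^ (i (8 - i) - (4 + i) s)`. -/
noncomputable def segreX (p : ℕ) (s : ℂ) (i : ℕ) : ℂ :=
  (p : ℂ) ^ ((i : ℂ) * (8 - i) - (4 + i) * s)

/-- `Y_1 = p ^ (6 - 3 s)`. -/
noncomputable def segreY₁ (p : ℕ) (s : ℂ) : ℂ := (p : ℂ) ^ (6 - 3 * s)

/-- `Y_2 = p ^ (9 - 5 s)`. -/
noncomputable def segreY₂ (p : ℕ) (s : ℂ) : ℂ := (p : ℂ) ^ (9 - 5 * s)

/-- `W_0 = I_3(X_1, X_2, X_3)`. -/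
noncomputable def segreW₀ (p : ℕ) (s : ℂ) : ℂ :=
  igusaFactor (p : ℂ) ![segreX p s 1, segreX p s 2, segreX p s 3]

/-- `W_1 = I_2(X_2, X_3) E_1(X_1, Y_1)`, with numerical data `n_1 = 3`, the dimension of `ℙ³`,
and `d_1 = 2`, the dimension of the Segre surface. -/
noncomputable def segreW₁ (p : ℕ) (s : ℂ) : ℂ :=
  igusaFactor (p : ℂ) ![segreX p s 2, segreX p s 3] *
    exceptionalFactor (p : ℂ) 3 2 (segreX p s 1) (segreY₁ p s)

/-- `W_2 = I_1(X_3) E_2(X_2, Y_2) I_1(Y_1)`, with numerical data `n_2 = 4`, the dimension of the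
Grassmannian of lines in `ℙ³`, and `d_2 = 1`, the dimension of the variety of lines on the Segre
surface. -/
noncomputable def segreW₂ (p : ℕ) (s : ℂ) : ℂ :=
  igusaFactor (p : ℂ) ![segreX p s 3] *
    exceptionalFactor (p : ℂ) 4 1 (segreX p s 2) (segreY₂ p s) *
    igusaFactor (p : ℂ) ![segreY₁ p s]

/-- The numerator `W(p, T)` of the closed expression. -/
def segreNumerator {K : Type*} [Field K] (p T : K) : K :=
    1
    + p ^ 4 * T ^ 3 + 2 * p ^ 5 * T ^ 3
    - p ^ 5 * T ^ 5 + 2 * p ^ 8 * T ^ 5 + p ^ 9 * T ^ 5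
    - p ^ 8 * T ^ 6 - p ^ 9 * T ^ 6 + 2 * p ^ 10 * T ^ 6 + p ^ 11 * T ^ 6
    + p ^ 12 * T ^ 7 + p ^ 13 * T ^ 7 + p ^ 14 * T ^ 7
    - p ^ 10 * T ^ 8 - p ^ 11 * T ^ 8 - p ^ 12 * T ^ 8 + p ^ 13 * T ^ 8
    - 2 * p ^ 13 * T ^ 9 - 2 * p ^ 14 * T ^ 9 + 2 * p ^ 15 * T ^ 9 + p ^ 16 * T ^ 9
    + p ^ 14 * T ^ 10 - 2 * p ^ 15 * T ^ 10 - 2 * p ^ 16 * T ^ 10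
    + p ^ 17 * T ^ 10 + 2 * p ^ 18 * T ^ 10 + 2 * p ^ 19 * T ^ 10
    - 2 * p ^ 17 * T ^ 11 - p ^ 18 * T ^ 11 - 2 * p ^ 19 * T ^ 11 - p ^ 20 * T ^ 11
    - p ^ 18 * T ^ 12 - 2 * p ^ 19 * T ^ 12 - p ^ 21 * T ^ 12 + p ^ 22 * T ^ 12 + p ^ 23 * T ^ 12
    + p ^ 19 * T ^ 13 - p ^ 20 * T ^ 13 - p ^ 21 * T ^ 13 - p ^ 22 * T ^ 13 - p ^ 23 * T ^ 13 + p ^ 24 * T ^ 13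
    + p ^ 20 * T ^ 14 + p ^ 21 * T ^ 14 - p ^ 22 * T ^ 14 - 2 * p ^ 24 * T ^ 14 - p ^ 25 * T ^ 14
    - p ^ 23 * T ^ 15 - 2 * p ^ 24 * T ^ 15 - p ^ 25 * T ^ 15 - 2 * p ^ 26 * T ^ 15
    + 2 * p ^ 24 * T ^ 16 + 2 * p ^ 25 * T ^ 16 + p ^ 26 * T ^ 16
    - 2 * p ^ 27 * T ^ 16 - 2 * p ^ 28 * T ^ 16 + p ^ 29 * T ^ 16
    + p ^ 27 * T ^ 17 + 2 * p ^ 28 * T ^ 17 - 2 * p ^ 29 * T ^ 17 - 2 * p ^ 30 * T ^ 17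
    + p ^ 30 * T ^ 18 - p ^ 31 * T ^ 18 - p ^ 32 * T ^ 18 - p ^ 33 * T ^ 18
    + p ^ 29 * T ^ 19 + p ^ 30 * T ^ 19 + p ^ 31 * T ^ 19
    + p ^ 32 * T ^ 20 + 2 * p ^ 33 * T ^ 20 - p ^ 34 * T ^ 20 - p ^ 35 * T ^ 20
    + p ^ 34 * T ^ 21 + 2 * p ^ 35 * T ^ 21 - p ^ 38 * T ^ 21
    + 2 * p ^ 38 * T ^ 23 + p ^ 39 * T ^ 23
    + p ^ 43 * T ^ 26

/-! Let Y = ℤ² ⊗ ℤ² be the group of integral two by two matrices. `SegreGroup` is the group of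
triples (a, b, y) whose product adds the term a ⊗ b' in Y (`segreEquiv`). Its commutators are a ⊗ b'
- a' ⊗ b, so a normal subgroup has the same elements, and the same index, as an additive subgroup K
of ℤ⁴ × Y. Put M = K ∩ Y, let L be the projection of K to ℤ⁴, and let A and B be the kernels of ℤ² ×
ℤ² → Y / M on the left and on the right. The condition on K is L ≤ A × B. At finite index, M and L
are completed to K by any homomorphism L → Y / M, which leaves |Y / M|⁴ choices. Summing over L ≤ A
× B ≅ ℤ⁴ splits off the zeta function of ℤ⁴ (`normalZeta_tensorHeisenberg`). What remains is the sum
over M of u ^ v(M) t ^ (v(A) + v(B)), where u = p⁴ T, t = T = p ^ (-s) and p ^ v is the index.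

This sum is cut into layers by the exponent p ^ n of Y / M. The parent {y : p y ∈ M} lies one layer
lower, its kernels are the parents of A and B, and every index drops by p to the rank of the
quotient. The number of M of given rank over a given parent depends on the two ranks only
(`tsum_fibre`): it counts the subspaces of 𝔽_p⁴ that meet a given subspace trivially. For proper M
the ranks of ℤ² / A and ℤ² / B are both two unless a kernel contains a primitive vector. In that
case M is the preimage of the other kernel under a surjection Y → ℤ², and such M correspond to pairs
(A, B) of equal exponent (`tsum_leftKer_cyclic`), which are counted directly. In exponent p they
give the (p + 1)² points and the 2 (p + 1) lines of the Segre surface.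

Summed over n, the recursions become a triangular linear system for six totals with diagonal
coefficients Y₁, Y₂, X₁, X₂, X₃ and p¹⁶ T⁸ (`exists_totals`); solving it gives the factor W₀ + (p +
1)² W₁ + 2 (p + 1) W₂ (`solve_totals`). This is done in [0, ∞] for real T < p⁻³. Finiteness there
yields finite coefficients and absolute convergence on the disc, and the identity theorem carries
the formula to complex T (`hasSum_normalSubgroupCount`). No prime is exceptional. -/

open scoped ENNReal

/-! ### Weights of p-power indices -/

/-- The weight `x ^ k` of an index `p ^ k`; indices that are not powers of `p` have weight `0`. -/
noncomputable def ppWeight (p : ℕ) (x : ℝ≥0∞) (n : ℕ) : ℝ≥0∞ :=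
  if n = p ^ padicValNat p n then x ^ padicValNat p n else 0

section ppWeight

variable {p : ℕ} [hp : Fact p.Prime]

theorem ppWeight_pow (x : ℝ≥0∞) (k : ℕ) : ppWeight p x (p ^ k) = x ^ k := by
  simp [ppWeight]

theorem ppWeight_one (x : ℝ≥0∞) : ppWeight p x 1 = 1 := by
  simpa using ppWeight_pow (p := p) x 0

omit hp in
theorem ppWeight_of_not {n : ℕ} (h : ¬ ∃ k, n = p ^ k) (x : ℝ≥0∞) : ppWeight p x n = 0 :=
  if_neg fun h' => h ⟨_, h'⟩

/-- Infinite index is recorded as index 0, so subgroups of infinite index drop out of every weighted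
sum. -/
theorem ppWeight_zero (x : ℝ≥0∞) : ppWeight p x 0 = 0 :=
  ppWeight_of_not (fun ⟨k, hk⟩ => (pow_ne_zero k hp.out.ne_zero) hk.symm) x

/-- Divisors of powers of p are powers of p, so a product has nonzero weight only if both factors
are such powers. -/
theorem ppWeight_mul (x : ℝ≥0∞) (m n : ℕ) :
    ppWeight p x (m * n) = ppWeight p x m * ppWeight p x n := by
  by_cases hm : ∃ k, m = p ^ k
  · by_cases hn : ∃ k, n = p ^ k
    · obtain ⟨a, rfl⟩ := hm
      obtain ⟨b, rfl⟩ := hn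
      rw [← pow_add, ppWeight_pow, ppWeight_pow, ppWeight_pow, pow_add]
    · rw [ppWeight_of_not hn, mul_zero]
      refine ppWeight_of_not (fun ⟨k, hk⟩ => hn ?_) x
      obtain ⟨j, -, hj⟩ := (Nat.dvd_prime_pow hp.out).1 ⟨m, by rw [← hk, mul_comm]⟩
      exact ⟨j, hj⟩
  · rw [ppWeight_of_not hm, zero_mul]
    refine ppWeight_of_not (fun ⟨k, hk⟩ => hm ?_) x
    obtain ⟨j, -, hj⟩ := (Nat.dvd_prime_pow hp.out).1 ⟨n, hk.symm⟩
    exact ⟨j, hj⟩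

omit hp in
theorem ppWeight_mul_ppWeight (x y : ℝ≥0∞) (n : ℕ) :
    ppWeight p x n * ppWeight p y n = ppWeight p (x * y) n := by
  unfold ppWeight
  split_ifs <;> simp [mul_pow]

/-- A factor (index) ^ k, such as a number of homomorphisms, is absorbed by the shift of x to p ^ k
x. -/
theorem natCast_pow_mul_ppWeight (x : ℝ≥0∞) (k n : ℕ) :
    (n : ℝ≥0∞) ^ k * ppWeight p x n = ppWeight p ((p : ℝ≥0∞) ^ k * x) n := by
  by_cases hn : ∃ k, n = p ^ k
  · obtain ⟨a, rfl⟩ := hn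
    rw [ppWeight_pow, ppWeight_pow, mul_pow]
    push_cast
    ring
  · rw [ppWeight_of_not hn, ppWeight_of_not hn, mul_zero]

end ppWeight

/-! ### Subgroups of a product -/

section products

variable {X Y : Type*} [AddCommGroup X] [AddCommGroup Y]

/-- The subgroup of pairs `(x, y)` with `x ∈ L` and `y` in the coset `h x` of `M`. -/
def graphSubgroup (L : AddSubgroup X) (M : AddSubgroup Y) (h : L →+ Y ⧸ M) :
    AddSubgroup (X × Y) where
  carrier := {z | ∃ hz : z.1 ∈ L, h ⟨z.1, hz⟩ = (z.2 : Y ⧸ M)}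
  zero_mem' := ⟨L.zero_mem, map_zero h⟩
  add_mem' := by
    rintro ⟨x, y⟩ ⟨x', y'⟩ ⟨hx, hy⟩ ⟨hx', hy'⟩
    refine ⟨L.add_mem hx hx', ?_⟩
    have := map_add h ⟨x, hx⟩ ⟨x', hx'⟩
    simp only at hy hy'
    rw [hy, hy'] at this
    exact this
  neg_mem' := by
    rintro ⟨x, y⟩ ⟨hx, hy⟩
    refine ⟨L.neg_mem hx, ?_⟩
    have := map_neg h ⟨x, hx⟩
    simp only at hy
    rw [hy] at this
    exact this

theorem mem_graphSubgroup {L : AddSubgroup X} {M : AddSubgroup Y} {h : L →+ Y ⧸ M} {z : X × Y} :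
    z ∈ graphSubgroup L M h ↔ ∃ hz : z.1 ∈ L, h ⟨z.1, hz⟩ = (z.2 : Y ⧸ M) := Iff.rfl

theorem map_fst_graphSubgroup (L : AddSubgroup X) (M : AddSubgroup Y) (h : L →+ Y ⧸ M) :
    (graphSubgroup L M h).map (AddMonoidHom.fst X Y) = L := by
  ext x
  constructor
  · rintro ⟨z, ⟨hz, -⟩, rfl⟩
    exact hz
  · intro hx
    obtain ⟨y, hy⟩ := QuotientAddGroup.mk_surjective (h ⟨x, hx⟩)
    exact ⟨(x, y), ⟨hx, hy.symm⟩, rfl⟩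

theorem comap_inr_graphSubgroup (L : AddSubgroup X) (M : AddSubgroup Y) (h : L →+ Y ⧸ M) :
    (graphSubgroup L M h).comap (AddMonoidHom.inr X Y) = M := by
  ext y
  have h0 : h ⟨0, L.zero_mem⟩ = 0 := map_zero h
  simp only [AddSubgroup.mem_comap, mem_graphSubgroup, AddMonoidHom.inr_apply, L.zero_mem, h0,
    exists_true_left]
  rw [eq_comm, QuotientAddGroup.eq_zero_iff]

/-- Goursat: K is recovered from its projection L, its slice M over 0, and the map that sends x ∈ L
to the slice over x, a coset of M. -/
theorem graphSubgroup_bijective :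
    Function.Bijective fun i : (Σ q : AddSubgroup X × AddSubgroup Y, (q.1 →+ Y ⧸ q.2)) =>
      graphSubgroup i.1.1 i.1.2 i.2 := by
  constructor
  · rintro ⟨⟨L, M⟩, h⟩ ⟨⟨L', M'⟩, h'⟩ heq
    simp only at heq h h'
    obtain rfl : L = L' := by
      rw [← map_fst_graphSubgroup L M h, heq, map_fst_graphSubgroup]
    obtain rfl : M = M' := by
      rw [← comap_inr_graphSubgroup L M h, heq, comap_inr_graphSubgroup]
    congr 1
    ext ⟨x, hx⟩
    obtain ⟨y, hy⟩ := QuotientAddGroup.mk_surjective (h ⟨x, hx⟩)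
    have : (x, y) ∈ graphSubgroup L M h' := heq ▸ ⟨hx, hy.symm⟩
    obtain ⟨_, h2⟩ := this
    rw [h2, hy]
  · intro K
    set M := K.comap (AddMonoidHom.inr X Y) with hM
    have key : ∀ x : K.map (AddMonoidHom.fst X Y), ∃ y : Y, (x.1, y) ∈ K := by
      rintro ⟨_, ⟨x, y⟩, hz, rfl⟩
      exact ⟨y, hz⟩
    choose f hf using key
    have huniq : ∀ x y y', (x, y) ∈ K → (x, y') ∈ K → (y : Y ⧸ M) = y' := by
      intro x y y' h h'
      rw [QuotientAddGroup.eq]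
      have := K.add_mem (K.neg_mem h) h'
      simpa [hM] using this
    refine ⟨⟨(K.map (AddMonoidHom.fst X Y), M), AddMonoidHom.mk' (fun x => (f x : Y ⧸ M)) ?_⟩, ?_⟩
    · intro a b
      exact huniq _ _ _ (hf (a + b)) (K.add_mem (hf a) (hf b))
    · ext ⟨x, y⟩
      constructor
      · rintro ⟨hx, hy⟩
        have h2 : ((f ⟨x, hx⟩ : Y) : Y ⧸ M) = y := hy
        rw [QuotientAddGroup.eq] at h2
        have := K.add_mem (hf ⟨x, hx⟩) (AddSubgroup.mem_comap.1 h2)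
        simpa using this
      · intro h
        exact ⟨⟨(x, y), h, rfl⟩, huniq x _ _ (hf ⟨x, (x, y), h, rfl⟩) h⟩

/-- Pass through K + Y: its index is that of the projection of K, and K has in it the index of the
slice K ∩ Y in Y. -/
theorem index_eq_index_map_fst_mul (K : AddSubgroup (X × Y)) :
    K.index = (K.map (AddMonoidHom.fst X Y)).index * (K.comap (AddMonoidHom.inr X Y)).index := by
  have hL : ((K.map (AddMonoidHom.fst X Y)).comap (AddMonoidHom.fst X Y))
      = K ⊔ (AddMonoidHom.inr X Y).range := by
    rw [AddSubgroup.comap_map_eq]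
    congr 1
    ext ⟨x, y⟩
    simp [AddSubgroup.mem_prod, eq_comm]
  rw [← AddSubgroup.relIndex_mul_index (le_sup_left : K ≤ K ⊔ (AddMonoidHom.inr X Y).range),
    ← hL, AddSubgroup.index_comap_of_surjective _ Prod.fst_surjective, hL,
    AddSubgroup.relIndex_sup_left, AddSubgroup.index_comap, mul_comm]

theorem index_graphSubgroup (L : AddSubgroup X) (M : AddSubgroup Y) (h : L →+ Y ⧸ M) :
    (graphSubgroup L M h).index = L.index * M.index := by
  rw [index_eq_index_map_fst_mul, map_fst_graphSubgroup, comap_inr_graphSubgroup]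

theorem tsum_addSubgroup_prod (g : AddSubgroup (X × Y) → ℝ≥0∞) :
    ∑' K, g K = ∑' M : AddSubgroup Y, ∑' L : AddSubgroup X, ∑' h : L →+ Y ⧸ M,
      g (graphSubgroup L M h) := by
  rw [← (Equiv.ofBijective _ (graphSubgroup_bijective (X := X) (Y := Y))).tsum_eq,
    ENNReal.tsum_sigma', ENNReal.tsum_prod', ENNReal.tsum_comm]
  rfl

end products

/-! ### Finite-index subgroups and homomorphisms of lattices -/

section lattices

variable {X : Type*} [AddCommGroup X] {k : ℕ}

theorem nonempty_addEquiv_of_index_ne_zero (e : X ≃+ (Fin k → ℤ)) (L : AddSubgroup X)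
    (hL : L.index ≠ 0) : Nonempty (L ≃+ (Fin k → ℤ)) := by
  have e' : X ≃ₗ[ℤ] (Fin k → ℤ) := e.toIntLinearEquiv
  have : Module.Finite ℤ X := Module.Finite.equiv e'.symm
  have : Module.Free ℤ X := Module.Free.of_equiv e'.symm
  have : L.FiniteIndex := ⟨hL⟩
  have h1 := AddSubgroup.finrank_eq_of_finiteIndex (M := X) L
  have h2 : Module.finrank ℤ X = k := by rw [e'.finrank_eq]; simp
  have : Module.Free ℤ L := inferInstanceAs (Module.Free ℤ (AddSubgroup.toIntSubmodule L))
  have : Module.Finite ℤ L := inferInstanceAs (Module.Finite ℤ (AddSubgroup.toIntSubmodule L))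
  have h3 : Module.finrank ℤ L = k := h1.trans h2
  exact ⟨(LinearEquiv.ofFinrankEq (R := ℤ) L (Fin k → ℤ) (by simp [h3])).toAddEquiv⟩

theorem card_addMonoidHom (e : X ≃+ (Fin k → ℤ)) (Q : Type*) [AddCommGroup Q] [Finite Q] :
    Nat.card (X →+ Q) = Nat.card Q ^ k := by
  have h1 : (X →+ Q) ≃ ((Fin k → ℤ) →+ Q) :=
    { toFun := fun f => f.comp e.symm.toAddMonoidHom
      invFun := fun f => f.comp e.toAddMonoidHom
      left_inv := fun f => by ext; simp
      right_inv := fun f => by ext; simp }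
  have h2 : ((Fin k → ℤ) →+ Q) ≃ (Fin k → Q) :=
    (addMonoidHomLequivInt ℤ).toEquiv.trans ((Pi.basisFun ℤ (Fin k)).constr ℤ).symm.toEquiv
  rw [Nat.card_congr (h1.trans h2), Nat.card_fun]
  simp

theorem tsum_one_eq_natCard (α : Type*) [Finite α] : ∑' _ : α, (1 : ℝ≥0∞) = (Nat.card α : ℝ≥0∞) := by
  have := Fintype.ofFinite α
  rw [tsum_fintype]
  simp

end lattices

/-! ### The zeta function of ℤⁿ -/

section zeta

variable {p : ℕ} [hp : Fact p.Prime]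

/-- At finite index L is again free of rank k, so there are |Y / M| ^ k homomorphisms; at infinite
index both sides vanish. -/
theorem tsum_hom_mul_ppWeight {X Y : Type*} [AddCommGroup X] [AddCommGroup Y] {k : ℕ}
    (e : X ≃+ (Fin k → ℤ)) (L : AddSubgroup X) (M : AddSubgroup Y) (x y : ℝ≥0∞) :
    ∑' _ : L →+ Y ⧸ M, ppWeight p x L.index * ppWeight p y M.index =
      ppWeight p x L.index * ppWeight p ((p : ℝ≥0∞) ^ k * y) M.index := by
  by_cases hL : L.index = 0
  · simp [hL, ppWeight_zero]
  by_cases hM : M.index = 0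
  · simp [hM, ppWeight_zero]
  obtain ⟨e'⟩ := nonempty_addEquiv_of_index_ne_zero e L hL
  have : M.FiniteIndex := ⟨hM⟩
  have hc := card_addMonoidHom e' (Y ⧸ M)
  have : Finite (L →+ Y ⧸ M) :=
    Nat.finite_of_card_ne_zero (by rw [hc]; exact pow_ne_zero _ Nat.card_pos.ne')
  have h1 := tsum_one_eq_natCard (L →+ Y ⧸ M)
  rw [hc, ← AddSubgroup.index_eq_card] at h1
  push_cast at h1
  rw [← natCast_pow_mul_ppWeight, ← h1, mul_left_comm, ← ENNReal.tsum_mul_right]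
  simp [mul_comm]

/-- The local zeta function counting subgroups of finite index of an additive group. -/
noncomputable def latticeZeta (p : ℕ) (x : ℝ≥0∞) (X : Type*) [AddCommGroup X] : ℝ≥0∞ :=
  ∑' L : AddSubgroup X, ppWeight p x L.index

omit hp in
theorem latticeZeta_congr {X Y : Type*} [AddCommGroup X] [AddCommGroup Y] (e : X ≃+ Y)
    (x : ℝ≥0∞) : latticeZeta p x X = latticeZeta p x Y := by
  unfold latticeZeta
  rw [← e.mapAddSubgroup.toEquiv.tsum_eq]
  refine tsum_congr fun L => ?_
  congr 1
  exact (AddSubgroup.index_map_equiv L e).symm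

theorem latticeZeta_prod {X Y : Type*} [AddCommGroup X] [AddCommGroup Y] {k : ℕ}
    (e : X ≃+ (Fin k → ℤ)) (x : ℝ≥0∞) :
    latticeZeta p x (X × Y) = latticeZeta p x X * latticeZeta p ((p : ℝ≥0∞) ^ k * x) Y := by
  unfold latticeZeta
  rw [tsum_addSubgroup_prod, ← ENNReal.tsum_mul_left]
  refine tsum_congr fun M => ?_
  rw [← ENNReal.tsum_mul_right]
  refine tsum_congr fun L => ?_
  simp_rw [index_graphSubgroup, ppWeight_mul]
  exact tsum_hom_mul_ppWeight e L M x x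

/-- The subgroups of p-power index in ℤ are the p ^ k ℤ, whence a geometric series. -/
theorem latticeZeta_int (x : ℝ≥0∞) : latticeZeta p x ℤ = (1 - x)⁻¹ := by
  have hinj : Function.Injective fun k : ℕ => AddSubgroup.zmultiples ((p ^ k : ℕ) : ℤ) := by
    intro a b h
    have := congrArg AddSubgroup.index h
    simp only [Int.index_zmultiples, Int.natAbs_natCast] at this
    exact Nat.pow_right_injective hp.out.two_le this
  rw [← ENNReal.tsum_geometric, latticeZeta, ← hinj.tsum_eq]
  · refine tsum_congr fun k => ?_
    rw [Int.index_zmultiples, Int.natAbs_natCast, ppWeight_pow]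
  · intro L hL
    obtain ⟨a, rfl⟩ := Int.subgroup_cyclic L
    rw [← AddSubgroup.zmultiples_eq_closure] at hL ⊢
    by_contra hcon
    refine hL (ppWeight_of_not ?_ x)
    rintro ⟨k, hk⟩
    refine hcon ⟨k, ?_⟩
    rw [Int.index_zmultiples] at hk
    simp only
    rw [← hk, Int.zmultiples_natAbs]

theorem latticeZeta_zero (x : ℝ≥0∞) : latticeZeta p x (Fin 0 → ℤ) = 1 := by
  unfold latticeZeta
  rw [tsum_eq_single ⊤ fun L hL => absurd (Subsingleton.elim L ⊤) hL, AddSubgroup.index_top,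
    ppWeight_one]

theorem latticeZeta_succ (n : ℕ) (x : ℝ≥0∞) :
    latticeZeta p x (Fin (n + 1) → ℤ) = (1 - x)⁻¹ * latticeZeta p (p * x) (Fin n → ℤ) := by
  rw [← latticeZeta_int (p := p), latticeZeta_congr (Fin.consLinearEquiv ℤ fun _ => ℤ).symm.toAddEquiv,
    latticeZeta_prod (k := 1), pow_one]
  exact (AddEquiv.piUnique fun _ : Fin 1 => ℤ).symm

theorem latticeZeta_four (x : ℝ≥0∞) :
    latticeZeta p x (Fin 4 → ℤ) = (1 - x)⁻¹ * (1 - p * x)⁻¹ * (1 - p ^ 2 * x)⁻¹ *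
      (1 - p ^ 3 * x)⁻¹ := by
  rw [latticeZeta_succ, latticeZeta_succ, latticeZeta_succ, latticeZeta_succ, latticeZeta_zero]
  ring_nf

end zeta

/-! ### Subspaces that meet a given subspace trivially -/

section subspaces

variable {F V : Type*} [Field F] [Finite F] [AddCommGroup V] [Module F V] [Finite V]

/-- The number of `d`-dimensional subspaces meeting `K` trivially. -/
noncomputable def disjointSubspaceCount (K : Submodule F V) (d : ℕ) : ℕ :=
  Nat.card {U : Submodule F V // Module.finrank F U = d ∧ Disjoint U K}

theorem natCard_linearIndependent (d : ℕ) :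
    Nat.card {s : Fin d → V // LinearIndependent F s} =
      ∏ i : Fin d, (Nat.card F ^ Module.finrank F V - Nat.card F ^ (i : ℕ)) := by
  have := Fintype.ofFinite F
  by_cases hd : d ≤ Module.finrank F V
  · rw [card_linearIndependent hd, Nat.card_eq_fintype_card]
  · have : IsEmpty {s : Fin d → V // LinearIndependent F s} :=
      ⟨fun s => hd (by simpa using s.2.fintype_card_le_finrank)⟩
    rw [Nat.card_of_isEmpty, eq_comm]
    -- With more vectors than the dimension, the factor with index dim V is zero.
    exact Finset.prod_eq_zero (Finset.mem_univ ⟨Module.finrank F V, not_le.1 hd⟩) (by simp)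

omit [Finite F] [Finite V] in
-- As a set V is (V ⧸ K) × K; independence modulo K constrains the first components only.
theorem natCard_linearIndependent_mkQ (K : Submodule F V) (d : ℕ) :
    Nat.card {s : Fin d → V // LinearIndependent F (K.mkQ ∘ s)} =
      Nat.card K ^ d * Nat.card {s : Fin d → V ⧸ K // LinearIndependent F s} := by
  let e : V ≃ (V ⧸ K) × K := AddSubgroup.addGroupEquivQuotientProdAddSubgroup (s := K.toAddSubgroup)
  have he : ∀ v, (e v).1 = K.mkQ v := fun v => rfl
  let e2 : (Fin d → V) ≃ (Fin d → V ⧸ K) × (Fin d → K) :=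
    (Equiv.arrowCongr (Equiv.refl _) e).trans (Equiv.arrowProdEquivProdArrow _ _ _)
  have h1 : {s : Fin d → V // LinearIndependent F (K.mkQ ∘ s)} ≃
      {s : (Fin d → V ⧸ K) × (Fin d → K) // LinearIndependent F s.1} :=
    e2.subtypeEquiv fun s => Iff.rfl
  have h2 : {s : (Fin d → V ⧸ K) × (Fin d → K) // LinearIndependent F s.1} ≃
      {s : Fin d → V ⧸ K // LinearIndependent F s} × (Fin d → K) :=
    { toFun := fun s => (⟨s.1.1, s.2⟩, s.1.2)
      invFun := fun s => ⟨(s.1.1, s.2), s.1.2⟩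
      left_inv := fun s => rfl
      right_inv := fun s => rfl }
  rw [Nat.card_congr (h1.trans h2), Nat.card_prod, mul_comm, Nat.card_fun, Nat.card_fin]

/-- A tuple independent modulo K is a basis of its span, which meets K trivially; conversely every
basis of such a subspace is independent modulo K. Sort the tuples by their spans. -/
theorem natCard_linearIndependent_mkQ_eq_sum (K : Submodule F V) (d : ℕ) :
    Nat.card {s : Fin d → V // LinearIndependent F (K.mkQ ∘ s)} =
      disjointSubspaceCount K d * ∏ i : Fin d, (Nat.card F ^ d - Nat.card F ^ (i : ℕ)) := by
  let f : (Σ U : {U : Submodule F V // Module.finrank F U = d ∧ Disjoint U K},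
      {s : Fin d → U.1 // LinearIndependent F s}) →
      {s : Fin d → V // LinearIndependent F (K.mkQ ∘ s)} := fun x =>
    ⟨x.1.1.subtype ∘ x.2.1, by
      have h1 : LinearIndependent F (x.1.1.subtype ∘ x.2.1) :=
        x.2.2.map' _ (Submodule.ker_subtype _)
      refine (LinearMap.linearIndependent_iff_of_disjoint K.mkQ ?_).2 h1
      rw [Submodule.ker_mkQ]
      refine x.1.2.2.mono_left (Submodule.span_le.2 ?_)
      rintro _ ⟨i, rfl⟩
      exact (x.2.1 i).2⟩
  have hspan : ∀ x, Submodule.span F (Set.range (f x).1) = x.1.1 := by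
    rintro ⟨⟨U, hU, hUK⟩, s, hs⟩
    refine Submodule.eq_of_le_of_finrank_eq ?_ ?_
    · refine Submodule.span_le.2 ?_
      rintro _ ⟨i, rfl⟩
      exact (s i).2
    · have h1 : LinearIndependent F (U.subtype ∘ s) := hs.map' _ (Submodule.ker_subtype _)
      exact (finrank_span_eq_card h1).trans (by simp [hU])
  have hf : Function.Bijective f := by
    constructor
    · intro x y hxy
      have h1 : x.1 = y.1 := Subtype.ext (by rw [← hspan x, hxy, hspan])
      obtain ⟨U, s⟩ := x
      obtain ⟨U', s'⟩ := y
      simp only at h1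
      subst h1
      congr 1
      ext i
      exact congrFun (congrArg Subtype.val hxy) i
    · rintro ⟨s, hs⟩
      have hs' : LinearIndependent F s := hs.of_comp
      refine ⟨⟨⟨Submodule.span F (Set.range s), ?_, ?_⟩,
        fun i => ⟨s i, Submodule.subset_span ⟨i, rfl⟩⟩, ?_⟩, rfl⟩
      · exact (finrank_span_eq_card hs').trans (by simp)
      · have := Submodule.range_ker_disjoint hs
        rwa [Submodule.ker_mkQ] at this
      · exact LinearIndependent.of_comp (Submodule.subtype _) hs'
  have := Fintype.ofFinite {U : Submodule F V // Module.finrank F U = d ∧ Disjoint U K}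
  rw [← Nat.card_congr (Equiv.ofBijective f hf), Nat.card_sigma]
  have : ∀ U : {U : Submodule F V // Module.finrank F U = d ∧ Disjoint U K},
      Nat.card {s : Fin d → U.1 // LinearIndependent F s} =
        ∏ i : Fin d, (Nat.card F ^ d - Nat.card F ^ (i : ℕ)) := fun U => by
    rw [natCard_linearIndependent, U.2.1]
  simp_rw [this, Finset.sum_const, disjointSubspaceCount, smul_eq_mul]
  simp

/-- The two counts of tuples independent modulo K are compared. Truncated subtraction is harmless:
if d exceeds the codimension of K, a factor on the right is zero. -/
theorem disjointSubspaceCount_mul (K : Submodule F V) (d : ℕ) :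
    disjointSubspaceCount K d * ∏ l ∈ Finset.range d, (Nat.card F ^ d - Nat.card F ^ l) =
      Nat.card F ^ (Module.finrank F K * d) * ∏ l ∈ Finset.range d,
        (Nat.card F ^ (Module.finrank F V - Module.finrank F K) - Nat.card F ^ l) := by
  have h := natCard_linearIndependent_mkQ_eq_sum K d
  have : Finite (V ⧸ K) := Quotient.finite _
  rw [natCard_linearIndependent_mkQ, natCard_linearIndependent] at h
  rw [Finset.prod_range, Finset.prod_range, ← h, pow_mul,
    ← Module.natCard_eq_pow_finrank (K := F) (V := K), ← K.finrank_quotient_add_finrank,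
    Nat.add_sub_cancel]

end subspaces

/-! ### The parent of a subgroup -/

section parent

variable {Y : Type*} [AddCommGroup Y] (p : ℕ)

/-- The subgroup of all `y` with `p y ∈ M`. -/
def pDivision (M : AddSubgroup Y) : AddSubgroup Y := M.comap (nsmulAddMonoidHom p)

/-- The order of `Y / (M + p Y)`. -/
noncomputable def pCorank (M : AddSubgroup Y) : ℕ :=
  (M ⊔ (nsmulAddMonoidHom (α := Y) p).range).index

variable {p}

theorem mem_pDivision {M : AddSubgroup Y} {y : Y} : y ∈ pDivision p M ↔ p • y ∈ M := Iff.rfl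

theorem le_pDivision (M : AddSubgroup Y) : M ≤ pDivision p M := fun _ hy => M.nsmul_mem hy p

/-- Multiplication by p identifies the quotient by the parent with (M + p Y) / M, and `pCorank` is
the order of the remaining quotient Y / (M + p Y). -/
theorem index_eq_index_pDivision_mul (M : AddSubgroup Y) :
    M.index = (pDivision p M).index * pCorank p M := by
  rw [pDivision, AddSubgroup.index_comap, pCorank, ← AddSubgroup.relIndex_sup_left,
    AddSubgroup.relIndex_mul_index le_sup_left]

end parent

/-! ### Subgroups with a given parent -/

section fibre

variable {Y : Type*} [AddCommGroup Y] {p k : ℕ} [hp : Fact p.Prime]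

theorem exists_reduction (e : Y ≃+ (Fin k → ℤ)) :
    ∃ q : Y →+ (Fin k → ZMod p), Function.Surjective q ∧
      q.ker = (nsmulAddMonoidHom (α := Y) p).range := by
  let r : (Fin k → ℤ) →+ (Fin k → ZMod p) := (Int.castAddHom (ZMod p)).compLeft (Fin k)
  refine ⟨r.comp e.toAddMonoidHom, ?_, ?_⟩
  · have : Function.Surjective r := fun v =>
      ⟨fun i => (v i).cast, by ext i; simp [r]⟩
    exact this.comp e.surjective
  · ext y
    constructor
    · intro hy
      have h1 : ∀ i, ∃ c, e y i = p * c := fun i =>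
        (ZMod.intCast_zmod_eq_zero_iff_dvd _ _).1 (congrFun hy i)
      choose c hc using h1
      refine ⟨e.symm c, ?_⟩
      apply e.injective
      ext i
      simp [hc i]
    · rintro ⟨z, rfl⟩
      ext i
      simp [r]

theorem index_range_nsmul_of_equiv (e : Y ≃+ (Fin k → ℤ)) :
    (nsmulAddMonoidHom (α := Y) p).range.index = p ^ k := by
  obtain ⟨q, hq, hk⟩ := exists_reduction (p := p) e
  rw [← hk, AddSubgroup.index_ker, AddMonoidHom.range_eq_top.2 hq]
  simp

theorem pCorank_dvd (e : Y ≃+ (Fin k → ℤ)) (M : AddSubgroup Y) : pCorank p M ∣ p ^ k := by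
  rw [← index_range_nsmul_of_equiv e]
  exact AddSubgroup.index_dvd_of_le le_sup_right

theorem exists_pCorank_eq (e : Y ≃+ (Fin k → ℤ)) (M : AddSubgroup Y) :
    ∃ i ≤ k, pCorank p M = p ^ i :=
  (Nat.dvd_prime_pow hp.out).1 (pCorank_dvd e M)

/-- The subgroups `M` with `pDivision p M = M'` correspond to the subgroups of `M' / p M'`
that meet the image of `M' ∩ p Y` trivially. -/
theorem exists_fibre_param (e : Y ≃+ (Fin k → ℤ)) (M' : AddSubgroup Y) (hM' : M'.index ≠ 0) :
    ∃ (K : AddSubgroup (Fin k → ZMod p)) (f : AddSubgroup (Fin k → ZMod p) → AddSubgroup Y),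
      Nat.card K = pCorank p M' ∧ Function.Injective f ∧
      (∀ M, pDivision p M = M' → M ∈ Set.range f) ∧
      (∀ U, pDivision p (f U) = M' ↔ Disjoint U K) ∧
      ∀ U, Disjoint U K → pCorank p (f U) = U.index := by
  obtain ⟨e'⟩ := nonempty_addEquiv_of_index_ne_zero e M' hM'
  obtain ⟨q, hq, hk⟩ := exists_reduction (p := p) e'
  set R := (nsmulAddMonoidHom (α := Y) p).range with hR
  -- Y has no p-torsion.
  have hinj : ∀ y z : Y, p • y = p • z → y = z := fun y z h => by
    apply e.injective
    have h2 := congrArg e h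
    ext i
    have h3 := congrFun h2 i
    simp only [map_nsmul, Pi.smul_apply, nsmul_eq_mul] at h3
    exact mul_left_cancel₀ (by exact_mod_cast hp.out.ne_zero) h3
  have hker : ∀ m : M', q m = 0 ↔ ∃ m' : M', m = p • m' := fun m => by
    rw [← AddMonoidHom.mem_ker, hk]
    exact ⟨fun ⟨x, hx⟩ => ⟨x, hx.symm⟩, fun ⟨x, hx⟩ => ⟨x, hx.symm⟩⟩
  -- `q` is reduction M' → M' / p M'. `K` is the image of M' ∩ p Y, and `f` takes preimages under
  -- `q`.
  let K := (R.addSubgroupOf M').map q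
  let f : AddSubgroup (Fin k → ZMod p) → AddSubgroup Y := fun U => (U.comap q).map M'.subtype
  have hmem : ∀ U y, y ∈ f U ↔ ∃ hy : y ∈ M', q ⟨y, hy⟩ ∈ U := by
    intro U y
    constructor
    · rintro ⟨m, hm, rfl⟩
      exact ⟨m.2, hm⟩
    · rintro ⟨hy, h⟩
      exact ⟨⟨y, hy⟩, h, rfl⟩
  have hfib : ∀ U, pDivision p (f U) = M' ↔ Disjoint U K := by
    intro U
    rw [AddSubgroup.disjoint_def]
    constructor
    · rintro h _ hU ⟨m, hm, rfl⟩
      obtain ⟨z, hz⟩ : ∃ z, p • z = m.1 := hm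
      have : z ∈ pDivision p (f U) := by
        rw [mem_pDivision, hz, hmem]
        exact ⟨m.2, hU⟩
      rw [h] at this
      exact (hker m).2 ⟨⟨z, this⟩, Subtype.ext hz.symm⟩
    · intro h
      ext y
      rw [mem_pDivision, hmem]
      constructor
      · rintro ⟨hy, hyU⟩
        obtain ⟨m', hm'⟩ := (hker _).1 (h hyU ⟨⟨p • y, hy⟩, ⟨y, rfl⟩, rfl⟩)
        have := hinj y m'.1 (congrArg Subtype.val hm')
        rw [this]
        exact m'.2
      · intro hy
        refine ⟨M'.nsmul_mem hy p, ?_⟩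
        have h0 : q ⟨p • y, M'.nsmul_mem hy p⟩ = 0 := (hker _).2 ⟨⟨y, hy⟩, rfl⟩
        rw [h0]
        exact U.zero_mem
  refine ⟨K, f, ?_, ?_, ?_, hfib, ?_⟩
  · have h1 : q.ker.relIndex (R.addSubgroupOf M') * (R.addSubgroupOf M').index = q.ker.index := by
      refine AddSubgroup.relIndex_mul_index fun m hm => ?_
      obtain ⟨m', rfl⟩ := (hker m).1 hm
      exact ⟨m'.1, rfl⟩
    have h2 : q.ker.index = p ^ k := by
      rw [AddSubgroup.index_ker, AddMonoidHom.range_eq_top.2 hq]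
      simp
    have h3 : R.relIndex M' * (M' ⊔ R).index = R.index := by
      rw [← AddSubgroup.relIndex_sup_right, AddSubgroup.relIndex_mul_index le_sup_right]
    rw [AddSubgroup.relIndex_ker, h2, ← index_range_nsmul_of_equiv (p := p) e, ← hR, ← h3,
      mul_comm] at h1
    refine mul_left_cancel₀ (fun h0 => ?_) h1
    have h0' : R.relIndex M' = 0 := h0
    rw [h0', zero_mul, hR, index_range_nsmul_of_equiv e] at h3
    exact pow_ne_zero k hp.out.ne_zero h3.symm
  · intro U U' h
    exact AddSubgroup.comap_injective hq (AddSubgroup.map_injective M'.subtype_injective h)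
  -- M contains p M', so it is the full preimage of its image under `q`.
  · rintro M rfl
    refine ⟨(M.addSubgroupOf (pDivision p M)).map q, ?_⟩
    ext y
    rw [hmem]
    constructor
    · rintro ⟨hy, m, hm, hmq⟩
      obtain ⟨m', hm'⟩ := (hker (⟨y, hy⟩ - m)).1 (by rw [map_sub, hmq, sub_self])
      have h1 : y - m.1 = p • m'.1 := congrArg Subtype.val hm'
      rw [← sub_add_cancel y m.1, h1]
      exact M.add_mem m'.2 hm
    · intro hy
      exact ⟨le_pDivision M hy, ⟨y, le_pDivision M hy⟩, hy, rfl⟩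
  · intro U hU
    -- The index of `f U` is [Y : M'] times `pCorank`, and also [Y : M'] times the index of U.
    have h1 := index_eq_index_pDivision_mul (p := p) (f U)
    rw [(hfib U).2 hU] at h1
    have h2 : (f U).index = M'.index * U.index := by
      have h3 : f U ≤ M' := fun y hy => ((hmem U y).1 hy).1
      have h4 : (f U).relIndex M' = U.index := by
        have : (f U).addSubgroupOf M' = U.comap q := by
          ext m
          rw [AddSubgroup.mem_addSubgroupOf, hmem]
          exact ⟨fun ⟨_, h⟩ => h, fun h => ⟨m.2, h⟩⟩
        rw [AddSubgroup.relIndex, this, AddSubgroup.index_comap_of_surjective _ hq]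
      rw [← AddSubgroup.relIndex_mul_index h3, h4, mul_comm]
    rw [h2] at h1
    exact (mul_left_cancel₀ hM' h1).symm

open Classical in
/-- Summation over the subgroups with prescribed `pDivision` and `pCorank`. -/
theorem exists_tsum_fibre (e : Y ≃+ (Fin k → ℤ)) (M' : AddSubgroup Y) (hM' : M'.index ≠ 0)
    {i j : ℕ} (hi : pCorank p M' = p ^ i) (hj : j ≤ k) :
    ∃ N : ℕ, N * ∏ l ∈ Finset.range (k - j), (p ^ (k - j) - p ^ l) =
        p ^ (i * (k - j)) * ∏ l ∈ Finset.range (k - j), (p ^ (k - i) - p ^ l) ∧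
      ∑' M : AddSubgroup Y, (if pDivision p M = M' ∧ pCorank p M = p ^ j then 1 else 0 : ℝ≥0∞)
        = N := by
  obtain ⟨K, f, hK, hf, hrange, hfib, hco⟩ := exists_fibre_param (p := p) e M' hM'
  let K' := AddSubgroup.toZModSubmodule p K
  have hKi : Module.finrank (ZMod p) K' = i := by
    have h1 : Nat.card K' = p ^ i := hK.trans hi
    rw [Module.natCard_eq_pow_finrank (K := ZMod p), Nat.card_zmod] at h1
    exact Nat.pow_right_injective hp.out.two_le h1
  -- Rank j of the quotient means index p ^ j of U in 𝔽_p ^ k, that is, dimension k - j.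
  refine ⟨disjointSubspaceCount K' (k - j), ?_, ?_⟩
  · have := disjointSubspaceCount_mul K' (k - j)
    rwa [hKi, Module.finrank_fin_fun, Nat.card_zmod] at this
  · rw [← hf.tsum_eq]
    · rw [← (AddSubgroup.toZModSubmodule (M := Fin k → ZMod p) p).symm.toEquiv.tsum_eq]
      have hsub := tsum_subtype {U : Submodule (ZMod p) (Fin k → ZMod p) |
          Module.finrank (ZMod p) U = k - j ∧ Disjoint U K'} (fun _ => (1 : ℝ≥0∞))
      rw [disjointSubspaceCount, ← tsum_one_eq_natCard]
      refine Eq.trans ?_ hsub.symm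
      refine tsum_congr fun U => ?_
      rw [Set.indicator_apply]
      refine if_congr ?_ rfl rfl
      have hdis : Disjoint U.toAddSubgroup K ↔ Disjoint U K' := by
        rw [AddSubgroup.disjoint_def, Submodule.disjoint_def]
        rfl
      have hidx : U.toAddSubgroup.index = p ^ (k - Module.finrank (ZMod p) U) := by
        have h1 := U.toAddSubgroup.index_mul_card
        have h2 : Nat.card U.toAddSubgroup = p ^ Module.finrank (ZMod p) U := by
          have h4 := Module.natCard_eq_pow_finrank (K := ZMod p) (V := U)
          rwa [Nat.card_zmod] at h4
        have h3 : Module.finrank (ZMod p) U ≤ k := by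
          simpa using U.finrank_le
        rw [h2, Nat.card_fun, Nat.card_zmod, Nat.card_fin] at h1
        refine mul_right_cancel₀ (pow_ne_zero (Module.finrank (ZMod p) U) hp.out.ne_zero) ?_
        rw [h1, ← pow_add, Nat.sub_add_cancel h3]
      change (pDivision p (f U.toAddSubgroup) = M' ∧ pCorank p (f U.toAddSubgroup) = p ^ j) ↔ _
      rw [hfib, hdis]
      constructor
      · rintro ⟨h1, h2⟩
        refine ⟨?_, h1⟩
        rw [hco _ (hdis.2 h1), hidx] at h2
        have := Nat.pow_right_injective hp.out.two_le h2
        have h3 : Module.finrank (ZMod p) U ≤ k := by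
          simpa using U.finrank_le
        omega
      · rintro ⟨h1, h2⟩
        refine ⟨h2, ?_⟩
        rw [hco _ (hdis.2 h2), hidx, h1]
        congr 1
        omega
    · intro M hM
      rw [Function.mem_support, ne_eq, ite_eq_right_iff, not_forall] at hM
      exact hrange M hM.1.1

end fibre

/-! ### The exponent of a quotient -/

section exponent

variable {Y : Type*} [AddCommGroup Y]

/-- The exponent of `Y / M` is `p ^ n`. -/
def HasPExponent (p : ℕ) (M : AddSubgroup Y) (n : ℕ) : Prop :=
  ∀ m, (∀ y, p ^ m • y ∈ M) ↔ n ≤ m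

variable {p k : ℕ}

theorem HasPExponent.unique {M : AddSubgroup Y} {m n : ℕ} (hm : HasPExponent p M m)
    (hn : HasPExponent p M n) : m = n :=
  le_antisymm ((hm n).1 ((hn n).2 le_rfl)) ((hn m).1 ((hm m).2 le_rfl))

theorem exists_hasPExponent {M : AddSubgroup Y} {a : ℕ} (h : M.index = p ^ a) :
    ∃ n, HasPExponent p M n := by
  classical
  have hex : ∃ n, ∀ y, p ^ n • y ∈ M := ⟨a, fun y => h ▸ M.nsmul_index_mem y⟩
  refine ⟨Nat.find hex, fun m => ⟨fun hm => Nat.find_min' hex hm, fun hm y => ?_⟩⟩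
  obtain ⟨c, rfl⟩ := Nat.exists_eq_add_of_le hm
  rw [pow_add, mul_comm, mul_smul]
  exact M.nsmul_mem (Nat.find_spec hex y) _

theorem hasPExponent_zero {M : AddSubgroup Y} : HasPExponent p M 0 ↔ M = ⊤ := by
  constructor
  · intro h
    refine (AddSubgroup.eq_top_iff' M).2 fun y => ?_
    simpa using (h 0).2 le_rfl y
  · rintro rfl m
    simp

theorem HasPExponent.pDivision {M : AddSubgroup Y} {n : ℕ} (h : HasPExponent p M (n + 1)) :
    HasPExponent p (pDivision p M) n := fun m => by
  simp_rw [mem_pDivision, ← mul_smul, ← pow_succ']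
  rw [h (m + 1), Nat.add_le_add_iff_right]

/-- The corank condition excludes only M = Y, which is its own parent. If M + p Y = Y, then p ^ n Y
lies in M + p ^ (n + 1) Y, so p ^ (n + 1) Y ≤ M would already force p ^ n Y ≤ M. -/
theorem hasPExponent_succ_iff {M : AddSubgroup Y} {n : ℕ} :
    HasPExponent p M (n + 1) ↔ HasPExponent p (pDivision p M) n ∧ pCorank p M ≠ 1 := by
  constructor
  · refine fun h => ⟨h.pDivision, fun h1 => ?_⟩
    rw [pCorank, AddSubgroup.index_eq_one] at h1
    have : n + 1 ≤ n := (h n).1 fun y => by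
      have hy : y ∈ M ⊔ (nsmulAddMonoidHom (α := Y) p).range := h1 ▸ AddSubgroup.mem_top y
      obtain ⟨m, hm, _, ⟨z, rfl⟩, rfl⟩ := AddSubgroup.mem_sup.1 hy
      rw [smul_add]
      refine M.add_mem (M.nsmul_mem hm _) ?_
      have := (h (n + 1)).2 le_rfl z
      rwa [pow_succ, mul_smul] at this
    omega
  · rintro ⟨h, h1⟩ m
    cases m with
    | zero =>
      refine ⟨fun h0 => absurd ?_ h1, fun h0 => absurd h0 (by omega)⟩
      have : M = ⊤ := (AddSubgroup.eq_top_iff' M).2 fun y => by simpa using h0 y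
      rw [this, pCorank, top_sup_eq, AddSubgroup.index_top]
    | succ m =>
      have := h m
      simp_rw [mem_pDivision, ← mul_smul, ← pow_succ'] at this
      rw [this, Nat.add_le_add_iff_right]

variable [hp : Fact p.Prime]

theorem HasPExponent.exists_index_eq (e : Y ≃+ (Fin k → ℤ)) {M : AddSubgroup Y} {n : ℕ}
    (h : HasPExponent p M n) : ∃ a, M.index = p ^ a := by
  induction n generalizing M with
  | zero => exact ⟨0, by rw [hasPExponent_zero.1 h, AddSubgroup.index_top, pow_zero]⟩
  | succ n ih =>
    obtain ⟨a, ha⟩ := ih h.pDivision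
    obtain ⟨b, -, hb⟩ := exists_pCorank_eq (p := p) e M
    exact ⟨a + b, by rw [index_eq_index_pDivision_mul (p := p), ha, hb, pow_add]⟩

theorem HasPExponent.index_ne_zero (e : Y ≃+ (Fin k → ℤ)) {M : AddSubgroup Y} {n : ℕ}
    (h : HasPExponent p M n) : M.index ≠ 0 := by
  obtain ⟨a, ha⟩ := h.exists_index_eq e
  rw [ha]
  exact pow_ne_zero a hp.out.ne_zero

end exponent

/-! ### Layers and the recursion between them -/

section layers

variable {Y : Type*} [AddCommGroup Y] {p k : ℕ} [hp : Fact p.Prime]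

open Classical in
/-- The sum of `w` over the subgroups with quotient of exponent `p ^ n` and rank `j`. -/
noncomputable def layerSum (p : ℕ) (w : AddSubgroup Y → ℝ≥0∞) (n j : ℕ) : ℝ≥0∞ :=
  ∑' M : AddSubgroup Y, if HasPExponent p M n ∧ pCorank p M = p ^ j then w M else 0

/-- The number of `(k - j)`-dimensional subspaces of `𝔽_p ^ k` meeting a given subspace of
dimension `i` trivially. -/
def liftCount (p k i j : ℕ) : ℕ :=
  p ^ (i * (k - j)) * (∏ l ∈ Finset.range (k - j), (p ^ (k - i) - p ^ l)) /
    ∏ l ∈ Finset.range (k - j), (p ^ (k - j) - p ^ l)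

theorem prod_pow_sub_pow_pos (d : ℕ) : 0 < ∏ l ∈ Finset.range d, (p ^ d - p ^ l) :=
  Finset.prod_pos fun _ hl =>
    Nat.sub_pos_of_lt (Nat.pow_lt_pow_right hp.out.one_lt (Finset.mem_range.1 hl))

open Classical in
theorem tsum_fibre (e : Y ≃+ (Fin k → ℤ)) (M' : AddSubgroup Y) (hM' : M'.index ≠ 0)
    {i j : ℕ} (hi : pCorank p M' = p ^ i) (hj : j ≤ k) :
    ∑' M : AddSubgroup Y, (if pDivision p M = M' ∧ pCorank p M = p ^ j then 1 else 0 : ℝ≥0∞)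
      = liftCount p k i j := by
  obtain ⟨N, hN, h⟩ := exists_tsum_fibre e M' hM' hi hj
  rw [h, liftCount, ← hN, Nat.mul_div_cancel _ (prod_pow_sub_pow_pos _)]

open Classical in
-- Group the M by parent. The fibre size depends on the parent only through its rank i, so the sum
-- is a combination of the layer sums one level down. Rank j ≠ 0 keeps M = Y out.
theorem tsum_pDivision_eq (e : Y ≃+ (Fin k → ℤ)) (w : AddSubgroup Y → ℝ≥0∞) (n : ℕ) {j : ℕ}
    (hj0 : j ≠ 0) (hj : j ≤ k) :
    ∑' M : AddSubgroup Y,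
      (if HasPExponent p M (n + 1) ∧ pCorank p M = p ^ j then w (pDivision p M) else 0) =
    ∑ i ∈ Finset.range (k + 1), liftCount p k i j * layerSum p w n i := by
  have hpj : p ^ j ≠ 1 := (Nat.one_lt_pow hj0 hp.out.one_lt).ne'
  have h1 : ∀ M : AddSubgroup Y,
      (if HasPExponent p M (n + 1) ∧ pCorank p M = p ^ j then w (pDivision p M) else 0) =
      ∑' M' : AddSubgroup Y, (if HasPExponent p M' n then w M' else 0) *
        (if pDivision p M = M' ∧ pCorank p M = p ^ j then 1 else 0) := by
    intro M
    rw [tsum_eq_single (pDivision p M)]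
    · by_cases h : pCorank p M = p ^ j
      · have : pCorank p M ≠ 1 := h ▸ hpj
        simp [hasPExponent_succ_iff, h, hj0, hp.out.ne_one]
      · simp [h]
    · intro M' hM'
      simp [hM'.symm]
  have h2 : ∀ M' : AddSubgroup Y, (if HasPExponent p M' n then w M' else 0) *
      ∑' M : AddSubgroup Y, (if pDivision p M = M' ∧ pCorank p M = p ^ j then 1 else 0 : ℝ≥0∞) =
      ∑ i ∈ Finset.range (k + 1),
        liftCount p k i j * (if HasPExponent p M' n ∧ pCorank p M' = p ^ i then w M' else 0) := by
    intro M'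
    by_cases hE : HasPExponent p M' n
    · obtain ⟨i, hi, hM'⟩ := exists_pCorank_eq (p := p) e M'
      rw [tsum_fibre e M' (hE.index_ne_zero e) hM' hj, if_pos hE, Finset.sum_eq_single i]
      · rw [if_pos ⟨hE, hM'⟩, mul_comm]
      · intro i' _ hi'
        rw [if_neg, mul_zero]
        rintro ⟨-, h⟩
        exact hi' (Nat.pow_right_injective hp.out.two_le (h.symm.trans hM'))
      · intro h
        exact absurd (Finset.mem_range.2 (Nat.lt_succ_of_le hi)) h
    · simp [hE]
  simp_rw [h1]
  rw [ENNReal.tsum_comm]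
  simp_rw [ENNReal.tsum_mul_left, h2]
  rw [Summable.tsum_finsetSum fun _ _ => ENNReal.summable]
  simp_rw [ENNReal.tsum_mul_left]
  rfl

omit hp in
theorem layerSum_zero_zero (w : AddSubgroup Y → ℝ≥0∞) : layerSum p w 0 0 = w ⊤ := by
  rw [layerSum, tsum_eq_single ⊤]
  · rw [if_pos]
    exact ⟨hasPExponent_zero.2 rfl, by simp [pCorank]⟩
  · intro M hM
    rw [if_neg fun h => hM (hasPExponent_zero.1 h.1)]

theorem layerSum_zero_of_ne (w : AddSubgroup Y → ℝ≥0∞) {j : ℕ} (hj : j ≠ 0) :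
    layerSum p w 0 j = 0 := by
  refine ENNReal.tsum_eq_zero.2 fun M => if_neg ?_
  rintro ⟨h1, h2⟩
  rw [hasPExponent_zero.1 h1, pCorank, top_sup_eq, AddSubgroup.index_top] at h2
  exact (Nat.one_lt_pow hj hp.out.one_lt).ne h2

omit hp in
theorem layerSum_succ_zero (w : AddSubgroup Y → ℝ≥0∞) (n : ℕ) : layerSum p w (n + 1) 0 = 0 := by
  refine ENNReal.tsum_eq_zero.2 fun M => if_neg ?_
  rintro ⟨h1, h2⟩
  exact (hasPExponent_succ_iff.1 h1).2 (by simpa using h2)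

/-- A sum over all subgroups of `p`-power index, split into layers. -/
theorem tsum_eq_tsum_layerSum (e : Y ≃+ (Fin k → ℤ)) (w : AddSubgroup Y → ℝ≥0∞)
    (hw : ∀ M, w M ≠ 0 → ∃ a, M.index = p ^ a) :
    ∑' M, w M = ∑' n, ∑ j ∈ Finset.range (k + 1), layerSum p w n j := by
  classical
  have h : ∀ M, w M = ∑' n, ∑ j ∈ Finset.range (k + 1),
      if HasPExponent p M n ∧ pCorank p M = p ^ j then w M else 0 := by
    intro M
    by_cases h0 : w M = 0
    · simp [h0]
    obtain ⟨a, ha⟩ := hw M h0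
    obtain ⟨n, hn⟩ := exists_hasPExponent ha
    obtain ⟨i, hi, hM⟩ := exists_pCorank_eq (p := p) e M
    rw [tsum_eq_single n, Finset.sum_eq_single i]
    · rw [if_pos ⟨hn, hM⟩]
    · intro i' _ hi'
      rw [if_neg]
      rintro ⟨-, h⟩
      exact hi' (Nat.pow_right_injective hp.out.two_le (h.symm.trans hM))
    · intro h
      exact absurd (Finset.mem_range.2 (Nat.lt_succ_of_le hi)) h
    · intro n' hn'
      refine Finset.sum_eq_zero fun j _ => if_neg fun h => hn' (h.1.unique hn)
  simp_rw [layerSum]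
  rw [tsum_congr h, ENNReal.tsum_comm]
  refine tsum_congr fun n => ?_
  rw [Summable.tsum_finsetSum fun _ _ => ENNReal.summable]

/-- The recursion between successive layers for a weight depending on the index only. -/
theorem layerSum_ppWeight_succ (e : Y ≃+ (Fin k → ℤ)) (x : ℝ≥0∞) (n : ℕ) {j : ℕ}
    (hj0 : j ≠ 0) (hj : j ≤ k) :
    layerSum p (fun M : AddSubgroup Y => ppWeight p x M.index) (n + 1) j =
      x ^ j * ∑ i ∈ Finset.range (k + 1), liftCount p k i j *
        layerSum p (fun M : AddSubgroup Y => ppWeight p x M.index) n i := by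
  classical
  rw [← tsum_pDivision_eq e _ n hj0 hj, ← ENNReal.tsum_mul_left, layerSum]
  refine tsum_congr fun M => ?_
  rw [mul_ite, mul_zero]
  refine ite_congr rfl (fun h => ?_) fun _ => rfl
  rw [index_eq_index_pDivision_mul (p := p), h.2, ppWeight_mul, ppWeight_pow, mul_comm]

end layers

/-! ### The two kernels of a subgroup of matrices -/

section kernels

open Matrix

/-- The vectors `a` with `a ⊗ b ∈ M` for all `b`. -/
def leftKer (M : AddSubgroup (Matrix (Fin 2) (Fin 2) ℤ)) : AddSubgroup (Fin 2 → ℤ) where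
  carrier := {a | ∀ b, vecMulVec a b ∈ M}
  zero_mem' b := by simp
  add_mem' {a a'} ha ha' b := by
    rw [add_vecMulVec]
    exact M.add_mem (ha b) (ha' b)
  neg_mem' {a} ha b := by
    rw [neg_vecMulVec]
    exact M.neg_mem (ha b)

/-- The vectors `b` with `a ⊗ b ∈ M` for all `a`. -/
def rightKer (M : AddSubgroup (Matrix (Fin 2) (Fin 2) ℤ)) : AddSubgroup (Fin 2 → ℤ) :=
  leftKer ((transposeAddEquiv (Fin 2) (Fin 2) ℤ).mapAddSubgroup M)

variable {M : AddSubgroup (Matrix (Fin 2) (Fin 2) ℤ)} {p n : ℕ}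

theorem mem_leftKer {a : Fin 2 → ℤ} : a ∈ leftKer M ↔ ∀ b, vecMulVec a b ∈ M := Iff.rfl

theorem mem_mapAddSubgroup_transpose {Z : Matrix (Fin 2) (Fin 2) ℤ} :
    Z ∈ (transposeAddEquiv (Fin 2) (Fin 2) ℤ).mapAddSubgroup M ↔ Zᵀ ∈ M := by
  constructor
  · rintro ⟨W, hW, rfl⟩
    exact hW
  · intro h
    exact ⟨Zᵀ, h, rfl⟩

theorem mem_rightKer {b : Fin 2 → ℤ} : b ∈ rightKer M ↔ ∀ a, vecMulVec a b ∈ M := by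
  simp only [rightKer, mem_leftKer, mem_mapAddSubgroup_transpose, transpose_vecMulVec]

theorem rightKer_mapAddSubgroup_transpose :
    rightKer ((transposeAddEquiv (Fin 2) (Fin 2) ℤ).mapAddSubgroup M) = leftKer M := by
  ext a
  simp only [mem_rightKer, mem_leftKer, mem_mapAddSubgroup_transpose, transpose_vecMulVec]

theorem eq_vecMulVec_add (Z : Matrix (Fin 2) (Fin 2) ℤ) :
    Z = vecMulVec ![1, 0] (Z 0) + vecMulVec ![0, 1] (Z 1) := by
  ext i j
  fin_cases i <;> simp only [Fin.zero_eta, Fin.mk_one, Matrix.add_apply, vecMulVec_apply,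
    Matrix.cons_val_zero, Matrix.cons_val_one] <;> ring

/-- Every matrix is a sum of two tensors e_i ⊗ (row i), so p ^ m kills Y / M as soon as it kills all
classes of pure tensors. Thus Y / M and the quotients by both kernels share one exponent. -/
theorem hasPExponent_leftKer : HasPExponent p (leftKer M) n ↔ HasPExponent p M n := by
  refine forall_congr' fun m => iff_congr ⟨fun h Z => ?_, fun h a b => ?_⟩ Iff.rfl
  · rw [eq_vecMulVec_add Z, smul_add, ← smul_vecMulVec, ← smul_vecMulVec]
    exact M.add_mem (h _ _) (h _ _)
  · rw [smul_vecMulVec]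
    exact h _

theorem hasPExponent_mapAddSubgroup_transpose :
    HasPExponent p ((transposeAddEquiv (Fin 2) (Fin 2) ℤ).mapAddSubgroup M) n ↔
      HasPExponent p M n := by
  refine forall_congr' fun m => iff_congr ?_ Iff.rfl
  simp_rw [mem_mapAddSubgroup_transpose]
  refine ⟨fun h Z => ?_, fun h Z => ?_⟩
  · have := h Zᵀ
    rwa [transpose_smul, transpose_transpose] at this
  · rw [transpose_smul]
    exact h Zᵀ

theorem hasPExponent_rightKer : HasPExponent p (rightKer M) n ↔ HasPExponent p M n := by
  rw [rightKer, hasPExponent_leftKer, hasPExponent_mapAddSubgroup_transpose]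

/-- This lets one recursion, from M to its parent, govern the indices of both kernels as well. -/
theorem leftKer_pDivision : leftKer (pDivision p M) = pDivision p (leftKer M) := by
  ext a
  simp only [mem_leftKer, mem_pDivision, smul_vecMulVec]

theorem rightKer_pDivision : rightKer (pDivision p M) = pDivision p (rightKer M) := by
  ext b
  simp only [mem_rightKer, mem_pDivision, vecMulVec_smul]

/-- The quotients X / f⁻¹(B) and Y / B are isomorphic, hence so are their reductions modulo p. -/
theorem pCorank_map {X Y : Type*} [AddCommGroup X] [AddCommGroup Y] (f : X →+ Y)
    (hf : Function.Surjective f) (B : AddSubgroup Y) : pCorank p (B.comap f) = pCorank p B := by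
  have : B.comap f ⊔ (nsmulAddMonoidHom (α := X) p).range =
      (B ⊔ (nsmulAddMonoidHom (α := Y) p).range).comap f := by
    refine le_antisymm (sup_le (AddSubgroup.comap_mono le_sup_left) ?_) ?_
    · rintro _ ⟨x, rfl⟩
      exact AddSubgroup.mem_sup_right ⟨f x, by simp⟩
    · intro x hx
      obtain ⟨b, hb, _, ⟨y, rfl⟩, hy⟩ := AddSubgroup.mem_sup.1 (AddSubgroup.mem_comap.1 hx)
      obtain ⟨z, rfl⟩ := hf y
      refine AddSubgroup.mem_sup.2 ⟨x - p • z, ?_, p • z, ⟨z, rfl⟩, sub_add_cancel _ _⟩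
      rw [AddSubgroup.mem_comap, map_sub, ← hy]
      simpa using hb
  rw [pCorank, this, AddSubgroup.index_comap_of_surjective _ hf, pCorank]

theorem pCorank_mapAddSubgroup {X Y : Type*} [AddCommGroup X] [AddCommGroup Y] (e : X ≃+ Y)
    (B : AddSubgroup X) : pCorank p (e.mapAddSubgroup B) = pCorank p B := by
  rw [← pCorank_map e.toAddMonoidHom e.surjective]
  congr 1
  exact AddSubgroup.comap_map_eq_self_of_injective e.injective B

end kernels

/-! ### Subgroups whose left kernel contains a primitive vector -/

section primitive

open Matrix

/-- The functional `v ↦ det (a, v)`. -/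
def wedge (a : Fin 2 → ℤ) : (Fin 2 → ℤ) →+ ℤ where
  toFun v := a 0 * v 1 - a 1 * v 0
  map_zero' := by simp
  map_add' v w := by simp only [Pi.add_apply]; ring

/-- The functional `wedge a` applied to the columns of a matrix. -/
def matrixWedge (a : Fin 2 → ℤ) : Matrix (Fin 2) (Fin 2) ℤ →+ (Fin 2 → ℤ) where
  toFun Z j := a 0 * Z 1 j - a 1 * Z 0 j
  map_zero' := by ext; simp
  map_add' v w := by ext; simp only [Pi.add_apply, Matrix.add_apply]; ring

theorem wedge_apply (a v : Fin 2 → ℤ) : wedge a v = a 0 * v 1 - a 1 * v 0 := rfl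

theorem matrixWedge_apply (a : Fin 2 → ℤ) (Z : Matrix (Fin 2) (Fin 2) ℤ) (j : Fin 2) :
    matrixWedge a Z j = a 0 * Z 1 j - a 1 * Z 0 j := rfl

theorem matrixWedge_vecMulVec (a v r : Fin 2 → ℤ) :
    matrixWedge a (vecMulVec v r) = wedge a v • r := by
  ext j
  simp only [matrixWedge_apply, wedge_apply, vecMulVec_apply, Pi.smul_apply, smul_eq_mul]
  ring

variable {p n : ℕ} {a : Fin 2 → ℤ} {x y : ℤ}

/-- The Bézout relation makes a and (-y, x) a basis of ℤ² of determinant 1, and the coefficients are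
the coordinates of v in it. -/
theorem eq_smul_add_wedge_smul (h : a 0 * x + a 1 * y = 1) (v : Fin 2 → ℤ) :
    v = (x * v 0 + y * v 1) • a + wedge a v • ![-y, x] := by
  ext j
  fin_cases j <;>
    simp only [wedge_apply, Fin.zero_eta, Fin.mk_one, Pi.add_apply, Pi.smul_apply, smul_eq_mul,
      Matrix.cons_val_zero, Matrix.cons_val_one]
  · linear_combination (-v 0) * h
  · linear_combination (-v 1) * h

theorem eq_vecMulVec_add_matrixWedge (h : a 0 * x + a 1 * y = 1)
    (Z : Matrix (Fin 2) (Fin 2) ℤ) :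
    Z = vecMulVec a (x • Z 0 + y • Z 1) + vecMulVec ![-y, x] (matrixWedge a Z) := by
  ext i j
  fin_cases i <;>
    simp only [matrixWedge_apply, Fin.zero_eta, Fin.mk_one, Matrix.add_apply, vecMulVec_apply,
      Pi.add_apply, Pi.smul_apply, smul_eq_mul, Matrix.cons_val_zero, Matrix.cons_val_one]
  · linear_combination (-Z 0 j) * h
  · linear_combination (-Z 1 j) * h

theorem wedge_complement (h : a 0 * x + a 1 * y = 1) : wedge a ![-y, x] = 1 := by
  rw [wedge_apply]
  simpa using h

theorem matrixWedge_surjective (h : a 0 * x + a 1 * y = 1) :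
    Function.Surjective (matrixWedge a) := fun r =>
  ⟨vecMulVec ![-y, x] r, by rw [matrixWedge_vecMulVec, wedge_complement h, one_smul]⟩

/-- Let w = (-y, x). Modulo a ⊗ ℤ² ≤ M a matrix Z equals w ⊗ r with r = `matrixWedge a Z`. As a and
w span ℤ² and a ⊗ r ∈ M, it lies in M exactly when r is in the right kernel. -/
theorem eq_comap_matrixWedge {M : AddSubgroup (Matrix (Fin 2) (Fin 2) ℤ)}
    (h : a 0 * x + a 1 * y = 1) (ha : a ∈ leftKer M) : M = (rightKer M).comap (matrixWedge a) := by
  ext Z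
  rw [AddSubgroup.mem_comap, mem_rightKer]
  constructor
  · intro hZ v
    have h1 : vecMulVec ![-y, x] (matrixWedge a Z) ∈ M := by
      have h2 := M.sub_mem hZ (ha (x • Z 0 + y • Z 1))
      rwa [sub_eq_of_eq_add' (eq_vecMulVec_add_matrixWedge h Z)] at h2
    rw [eq_smul_add_wedge_smul h v, add_vecMulVec, smul_vecMulVec, smul_vecMulVec]
    exact M.add_mem (M.zsmul_mem (ha _) _) (M.zsmul_mem h1 _)
  · intro hZ
    rw [eq_vecMulVec_add_matrixWedge h Z]
    exact M.add_mem (ha _) (hZ _)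

variable [hp : Fact p.Prime]

theorem forall_zsmul_mem_iff {B : AddSubgroup (Fin 2 → ℤ)} (hB : HasPExponent p B n) (m : ℤ) :
    (∀ r, m • r ∈ B) ↔ (p : ℤ) ^ n ∣ m := by
  have hn : ∀ r, (p : ℤ) ^ n • r ∈ B := fun r => by
    have := (hB n).2 le_rfl r
    rwa [← Nat.cast_smul_eq_nsmul ℤ, Nat.cast_pow] at this
  constructor
  -- By Bézout gcd(m, p ^ n) kills the quotient too; it is a power p ^ j, and the exponent forces n
  -- ≤ j.
  · intro h
    obtain ⟨j, -, hj⟩ := (Nat.dvd_prime_pow hp.out).1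
      (show Int.gcd m ((p : ℤ) ^ n) ∣ p ^ n from by
        have := Int.gcd_dvd_right m ((p : ℤ) ^ n)
        exact_mod_cast this)
    have hnj : n ≤ j := (hB j).1 fun r => by
      rw [← Nat.cast_smul_eq_nsmul ℤ, ← hj, Int.gcd_eq_gcd_ab, add_smul, mul_comm m, mul_smul,
        mul_comm ((p : ℤ) ^ n), mul_smul]
      exact B.add_mem (B.zsmul_mem (h r) _) (B.zsmul_mem (hn r) _)
    have h1 : (p : ℤ) ^ j ∣ m := by
      have := Int.gcd_dvd_left m ((p : ℤ) ^ n)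
      rw [hj] at this
      exact_mod_cast this
    exact (pow_dvd_pow _ hnj).trans h1
  · rintro ⟨c, rfl⟩ r
    rw [mul_comm, mul_smul]
    exact B.zsmul_mem (hn r) c

/-- ℤ² / A is cyclic, generated by the class of (-y, x), and its order is its exponent p ^ n. -/
theorem mem_iff_dvd_wedge {A : AddSubgroup (Fin 2 → ℤ)} (h : a 0 * x + a 1 * y = 1) (ha : a ∈ A)
    (hA : HasPExponent p A n) (v : Fin 2 → ℤ) : v ∈ A ↔ (p : ℤ) ^ n ∣ wedge a v := by
  rw [← forall_zsmul_mem_iff hA]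
  constructor
  · intro hv
    have h1 : wedge a v • ![-y, x] ∈ A := by
      have h2 := A.sub_mem hv (A.zsmul_mem ha (x * v 0 + y * v 1))
      rwa [sub_eq_of_eq_add' (eq_smul_add_wedge_smul h v)] at h2
    intro r
    rw [eq_smul_add_wedge_smul h r, smul_add, smul_smul, smul_comm]
    exact A.add_mem (A.zsmul_mem ha _) (A.zsmul_mem h1 _)
  · intro hv
    rw [eq_smul_add_wedge_smul h v]
    exact A.add_mem (A.zsmul_mem ha _) (hv _)

/-- v is in the left kernel iff the integer `wedge a v` kills ℤ² / B. Equality of the exponents of A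
and B turns this into membership in A. -/
theorem leftKer_comap_matrixWedge {A B : AddSubgroup (Fin 2 → ℤ)} (h : a 0 * x + a 1 * y = 1)
    (ha : a ∈ A) (hA : HasPExponent p A n) (hB : HasPExponent p B n) :
    leftKer (B.comap (matrixWedge a)) = A := by
  ext v
  rw [mem_iff_dvd_wedge h ha hA, ← forall_zsmul_mem_iff hB, mem_leftKer]
  simp_rw [AddSubgroup.mem_comap, matrixWedge_vecMulVec]

theorem rightKer_comap_matrixWedge {B : AddSubgroup (Fin 2 → ℤ)} (h : a 0 * x + a 1 * y = 1) :
    rightKer (B.comap (matrixWedge a)) = B := by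
  ext r
  rw [mem_rightKer]
  simp_rw [AddSubgroup.mem_comap, matrixWedge_vecMulVec]
  constructor
  · intro hr
    simpa [wedge_complement h] using hr ![-y, x]
  · intro hr v
    exact B.zsmul_mem hr _

/-- If A were inside p ℤ², the corank would be p². So some a ∈ A is not divisible by p, and its
content g is prime to p. -/
theorem exists_primitive_mem {A : AddSubgroup (Fin 2 → ℤ)} (hA : HasPExponent p A n)
    (hr : pCorank p A = p) : ∃ a ∈ A, ∃ x y : ℤ, a 0 * x + a 1 * y = 1 := by
  have hnot : ¬ A ≤ (nsmulAddMonoidHom (α := Fin 2 → ℤ) p).range := by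
    intro hle
    rw [pCorank, sup_eq_right.2 hle, index_range_nsmul_of_equiv (AddEquiv.refl _)] at hr
    have h1 := hp.out.one_lt
    nlinarith
  obtain ⟨a, ha, hap⟩ := SetLike.not_le_iff_exists.1 hnot
  set g := Int.gcd (a 0) (a 1) with hg
  obtain ⟨c, hc⟩ : (g : ℤ) ∣ a 0 := Int.gcd_dvd_left _ _
  obtain ⟨d, hd⟩ : (g : ℤ) ∣ a 1 := Int.gcd_dvd_right _ _
  have hgp : ¬ p ∣ g := by
    rintro ⟨m, hm⟩
    refine hap ⟨![m * c, m * d], ?_⟩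
    ext j
    fin_cases j
    · simp [hc, hm, mul_assoc]
    · simp [hd, hm, mul_assoc]
  have hg0 : (g : ℤ) ≠ 0 := fun h0 => hgp (by simp [Int.natCast_eq_zero.1 h0])
  have hag : a = (g : ℤ) • ![c, d] := by
    ext j
    fin_cases j
    · simpa using hc
    · simpa using hd
  have hcop : IsCoprime (g : ℤ) ((p ^ n : ℕ) : ℤ) :=
    Nat.isCoprime_iff_coprime.2 (((Nat.Prime.coprime_iff_not_dvd hp.out).2 hgp).symm.pow_right n)
  obtain ⟨r, s, hrs⟩ := hcop
  refine ⟨![c, d], ?_, ?_⟩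
  -- With r g + s p ^ n = 1, the primitive vector a / g is r a + s p ^ n (a / g), and both terms lie
  -- in A.
  · have h1 := A.add_mem (A.zsmul_mem ha r) (A.zsmul_mem ((hA n).2 le_rfl ![c, d]) s)
    rwa [hag, ← Nat.cast_smul_eq_nsmul ℤ, smul_smul, smul_smul, ← add_smul, hrs, one_smul] at h1
  · refine ⟨Int.gcdA (a 0) (a 1), Int.gcdB (a 0) (a 1), ?_⟩
    have h1 := Int.gcd_eq_gcd_ab (a 0) (a 1)
    rw [← hg] at h1
    refine mul_left_cancel₀ hg0 ?_
    simp only [Matrix.cons_val_zero, Matrix.cons_val_one]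
    rw [mul_one, mul_add, ← mul_assoc, ← mul_assoc, ← hc, ← hd]
    exact h1.symm

theorem index_eq_index_rightKer {M : AddSubgroup (Matrix (Fin 2) (Fin 2) ℤ)}
    (hM : HasPExponent p M n) (hr : pCorank p (leftKer M) = p) :
    M.index = (rightKer M).index := by
  obtain ⟨a, ha, x, y, h⟩ := exists_primitive_mem (hasPExponent_leftKer.2 hM) hr
  conv_lhs => rw [eq_comap_matrixWedge h ha]
  exact AddSubgroup.index_comap_of_surjective _ (matrixWedge_surjective h)

theorem pCorank_eq_pCorank_rightKer {M : AddSubgroup (Matrix (Fin 2) (Fin 2) ℤ)}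
    (hM : HasPExponent p M n) (hr : pCorank p (leftKer M) = p) :
    pCorank p M = pCorank p (rightKer M) := by
  obtain ⟨a, ha, x, y, h⟩ := exists_primitive_mem (hasPExponent_leftKer.2 hM) hr
  conv_lhs => rw [eq_comap_matrixWedge h ha]
  exact pCorank_map _ (matrixWedge_surjective h) _

theorem pCorank_eq_pCorank_leftKer {M : AddSubgroup (Matrix (Fin 2) (Fin 2) ℤ)}
    (hM : HasPExponent p M n) (hr : pCorank p (rightKer M) = p) :
    pCorank p M = pCorank p (leftKer M) := by
  rw [← rightKer_mapAddSubgroup_transpose, ← pCorank_eq_pCorank_rightKer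
    (hasPExponent_mapAddSubgroup_transpose.2 hM) hr, pCorank_mapAddSubgroup]

open Classical in
/-- The subgroups `M` whose left kernel has cyclic quotient correspond to pairs `(A, B)` with
quotients of the same exponent, the first of them cyclic. -/
theorem tsum_leftKer_cyclic (G : AddSubgroup (Fin 2 → ℤ) → AddSubgroup (Fin 2 → ℤ) → ℝ≥0∞)
    (n : ℕ) :
    ∑' M, (if HasPExponent p M n ∧ pCorank p (leftKer M) = p then G (leftKer M) (rightKer M)
      else 0) =
    ∑' A, ∑' B, if (HasPExponent p A n ∧ pCorank p A = p) ∧ HasPExponent p B n then G A B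
      else 0 := by
  rw [← ENNReal.tsum_prod (f := fun A B =>
    if (HasPExponent p A n ∧ pCorank p A = p) ∧ HasPExponent p B n then G A B else 0)]
  refine (tsum_eq_tsum_of_ne_zero_bij (fun M => (leftKer M.1, rightKer M.1)) ?_ ?_ ?_).symm
  -- A primitive vector of the common left kernel recovers both subgroups from the common right
  -- kernel.
  · rintro ⟨M, hM⟩ ⟨M', hM'⟩ heq
    rw [Function.mem_support, ne_eq, ite_eq_right_iff, not_forall] at hM hM'
    obtain ⟨⟨h1, h2⟩, -⟩ := hM
    obtain ⟨h3, h4⟩ := Prod.mk.inj heq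
    simp only at h3 h4
    obtain ⟨a, ha, x, y, h⟩ := exists_primitive_mem (hasPExponent_leftKer.2 h1) h2
    refine Subtype.ext ?_
    change M = M'
    rw [eq_comap_matrixWedge h ha, h4, ← eq_comap_matrixWedge h (h3 ▸ ha)]
  · rintro ⟨A, B⟩ hAB
    have hAB' := hAB
    rw [Function.mem_support, ne_eq, ite_eq_right_iff, not_forall] at hAB'
    obtain ⟨⟨⟨h1, h2⟩, h3⟩, h4⟩ := hAB'
    obtain ⟨a, ha, x, y, h⟩ := exists_primitive_mem h1 h2
    have hl := leftKer_comap_matrixWedge h ha h1 h3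
    have hr := rightKer_comap_matrixWedge (B := B) h
    refine ⟨⟨B.comap (matrixWedge a), ?_⟩, Prod.ext hl hr⟩
    rw [Function.mem_support, hl, hr, if_pos ⟨hasPExponent_leftKer.1 (hl.symm ▸ h1), h2⟩]
    exact h4
  · rintro ⟨M, hM⟩
    simp only [hasPExponent_leftKer, hasPExponent_rightKer]
    refine if_congr ?_ rfl rfl
    tauto

end primitive

/-! ### Classes of subgroups by the ranks of the kernels -/

section classes

variable {p : ℕ} [hp : Fact p.Prime]

/-- The weight `u ^ v(Y : M) * t ^ (v(A) + v(B))` of `M`, with `A` and `B` the kernels of `M`. -/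
noncomputable def segreWeight (p : ℕ) (u t : ℝ≥0∞) (M : AddSubgroup (Matrix (Fin 2) (Fin 2) ℤ)) :
    ℝ≥0∞ :=
  ppWeight p u M.index * (ppWeight p t (leftKer M).index * ppWeight p t (rightKer M).index)

open Classical in
/-- The sum of `W` over all `M` with quotient of exponent `p ^ n` and rank `j` both of whose
kernels have quotients of rank two. -/
noncomputable def fullSum (p : ℕ) (W : AddSubgroup (Matrix (Fin 2) (Fin 2) ℤ) → ℝ≥0∞) (n j : ℕ) :
    ℝ≥0∞ :=
  ∑' M, if HasPExponent p M n ∧ pCorank p M = p ^ j ∧ pCorank p (leftKer M) = p ^ 2 ∧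
    pCorank p (rightKer M) = p ^ 2 then W M else 0

open Classical in
/-- The sum of `W` over all `M` with quotient of exponent `p ^ n` whose kernels have quotients of
ranks `i` and `j`. -/
noncomputable def kernelSum (p : ℕ) (W : AddSubgroup (Matrix (Fin 2) (Fin 2) ℤ) → ℝ≥0∞)
    (n i j : ℕ) : ℝ≥0∞ :=
  ∑' M, if HasPExponent p M n ∧ pCorank p (leftKer M) = p ^ i ∧ pCorank p (rightKer M) = p ^ j
    then W M else 0

theorem HasPExponent.pCorank_eq_or {A : AddSubgroup (Fin 2 → ℤ)} {n : ℕ}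
    (h : HasPExponent p A (n + 1)) : pCorank p A = p ^ 1 ∨ pCorank p A = p ^ 2 := by
  obtain ⟨i, hi, hA⟩ := exists_pCorank_eq (p := p) (AddEquiv.refl (Fin 2 → ℤ)) A
  have h1 := (hasPExponent_succ_iff.1 h).2
  interval_cases i
  · exact absurd hA (by simpa using h1)
  · exact Or.inl hA
  · exact Or.inr hA

/-- If one kernel has cyclic quotient, Y / M is isomorphic to the quotient by the other kernel, so
its rank is forced; only in the last case is it free. -/
theorem HasPExponent.pCorank_cases {M : AddSubgroup (Matrix (Fin 2) (Fin 2) ℤ)} {n : ℕ}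
    (h : HasPExponent p M (n + 1)) :
    (pCorank p (leftKer M) = p ^ 1 ∧ pCorank p (rightKer M) = p ^ 1 ∧ pCorank p M = p ^ 1) ∨
    (pCorank p (leftKer M) = p ^ 1 ∧ pCorank p (rightKer M) = p ^ 2 ∧ pCorank p M = p ^ 2) ∨
    (pCorank p (leftKer M) = p ^ 2 ∧ pCorank p (rightKer M) = p ^ 1 ∧ pCorank p M = p ^ 2) ∨
    (pCorank p (leftKer M) = p ^ 2 ∧ pCorank p (rightKer M) = p ^ 2) := by
  have hA := (hasPExponent_leftKer.2 h).pCorank_eq_or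
  have hB := (hasPExponent_rightKer.2 h).pCorank_eq_or
  have h1 : pCorank p (leftKer M) = p ^ 1 → pCorank p M = pCorank p (rightKer M) := fun h' =>
    pCorank_eq_pCorank_rightKer h (by simpa using h')
  have h2 : pCorank p (rightKer M) = p ^ 1 → pCorank p M = pCorank p (leftKer M) := fun h' =>
    pCorank_eq_pCorank_leftKer h (by simpa using h')
  rcases hA with hA | hA <;> rcases hB with hB | hB
  · exact Or.inl ⟨hA, hB, (h1 hA).trans hB⟩
  · exact Or.inr (Or.inl ⟨hA, hB, (h1 hA).trans hB⟩)
  · exact Or.inr (Or.inr (Or.inl ⟨hA, hB, (h2 hB).trans hA⟩))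
  · exact Or.inr (Or.inr (Or.inr ⟨hA, hB⟩))

open Classical in
theorem tsum_eq_fullSum_add (W : AddSubgroup (Matrix (Fin 2) (Fin 2) ℤ) → ℝ≥0∞) (n j : ℕ) :
    ∑' M, (if HasPExponent p M (n + 1) ∧ pCorank p M = p ^ j then W M else 0) =
      fullSum p W (n + 1) j + (if j = 1 then kernelSum p W (n + 1) 1 1 else 0) +
        (if j = 2 then kernelSum p W (n + 1) 1 2 + kernelSum p W (n + 1) 2 1 else 0) := by
  have hinj : ∀ a b : ℕ, p ^ a = p ^ b ↔ a = b := fun a b =>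
    (Nat.pow_right_injective hp.out.two_le).eq_iff
  have hl : ∀ b : ℕ, p = p ^ b ↔ 1 = b := fun b => by simpa using hinj 1 b
  have hr : ∀ a : ℕ, p ^ a = p ↔ a = 1 := fun a => by simpa using hinj a 1
  have h0 : ∀ (q : Prop) [Decidable q] (f : AddSubgroup (Matrix (Fin 2) (Fin 2) ℤ) → ℝ≥0∞),
      (if q then ∑' M, f M else 0) = ∑' M, if q then f M else 0 := by
    intro q _ f
    split_ifs <;> simp
  simp only [fullSum, kernelSum]
  rw [← ENNReal.tsum_add, h0, h0, ← ENNReal.tsum_add, ← ENNReal.tsum_add]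
  refine tsum_congr fun M => ?_
  by_cases hM : HasPExponent p M (n + 1)
  · rcases hM.pCorank_cases with ⟨h1, h2, h3⟩ | ⟨h1, h2, h3⟩ | ⟨h1, h2, h3⟩ | ⟨h1, h2⟩
    · simp [hM, h1, h2, h3, hl, eq_comm (a := j)]
    · simp [hM, h1, h2, h3, hl, hr, hinj, eq_comm (a := j)]
    · simp [hM, h1, h2, h3, hl, hr, hinj, eq_comm (a := j)]
    · simp [hM, h1, h2, hr]
  · simp [hM]

theorem segreWeight_eq (u t : ℝ≥0∞) {M : AddSubgroup (Matrix (Fin 2) (Fin 2) ℤ)} {a b c : ℕ}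
    (ha : pCorank p M = p ^ a) (hb : pCorank p (leftKer M) = p ^ b)
    (hc : pCorank p (rightKer M) = p ^ c) :
    segreWeight p u t M = u ^ a * t ^ b * t ^ c * segreWeight p u t (pDivision p M) := by
  rw [segreWeight, segreWeight, index_eq_index_pDivision_mul (p := p) M,
    index_eq_index_pDivision_mul (p := p) (leftKer M),
    index_eq_index_pDivision_mul (p := p) (rightKer M), ha, hb, hc, ppWeight_mul, ppWeight_mul,
    ppWeight_mul, ppWeight_pow, ppWeight_pow, ppWeight_pow, leftKer_pDivision, rightKer_pDivision]
  ring

omit hp in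
theorem segreWeight_transpose (u t : ℝ≥0∞) (M : AddSubgroup (Matrix (Fin 2) (Fin 2) ℤ)) :
    segreWeight p u t ((Matrix.transposeAddEquiv (Fin 2) (Fin 2) ℤ).mapAddSubgroup M) =
      segreWeight p u t M := by
  rw [segreWeight, segreWeight, rightKer_mapAddSubgroup_transpose, ← rightKer]
  have : ((Matrix.transposeAddEquiv (Fin 2) (Fin 2) ℤ).mapAddSubgroup M).index = M.index :=
    AddSubgroup.index_map_equiv M _
  rw [this]
  ring

omit hp in
-- Transposition exchanges the two kernels and preserves the weight.
theorem kernelSum_comm (u t : ℝ≥0∞) (n i j : ℕ) :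
    kernelSum p (segreWeight p u t) n i j = kernelSum p (segreWeight p u t) n j i := by
  classical
  rw [kernelSum, ← (Matrix.transposeAddEquiv (Fin 2) (Fin 2) ℤ).mapAddSubgroup.toEquiv.tsum_eq,
    kernelSum]
  refine tsum_congr fun M => ?_
  change (if HasPExponent p ((Matrix.transposeAddEquiv (Fin 2) (Fin 2) ℤ).mapAddSubgroup M) n ∧
    pCorank p (rightKer M) = p ^ i ∧ pCorank p (rightKer
      ((Matrix.transposeAddEquiv (Fin 2) (Fin 2) ℤ).mapAddSubgroup M)) = p ^ j then
    segreWeight p u t ((Matrix.transposeAddEquiv (Fin 2) (Fin 2) ℤ).mapAddSubgroup M) else 0) = _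
  rw [segreWeight_transpose, rightKer_mapAddSubgroup_transpose,
    hasPExponent_mapAddSubgroup_transpose]
  refine if_congr ?_ rfl rfl
  tauto

/-- Here M and its right kernel B have equal index, so the weight is t ^ v(A) (u t) ^ v(B) and the
sum over pairs (A, B) of exponent p ^ n factors. -/
theorem kernelSum_one_eq (u t : ℝ≥0∞) (n j : ℕ) :
    kernelSum p (segreWeight p u t) n 1 j =
      layerSum p (fun A : AddSubgroup (Fin 2 → ℤ) => ppWeight p t A.index) n 1 *
      layerSum p (fun B : AddSubgroup (Fin 2 → ℤ) => ppWeight p (u * t) B.index) n j := by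
  classical
  have h := tsum_leftKer_cyclic (p := p) (fun A B => if pCorank p B = p ^ j then
    ppWeight p t A.index * ppWeight p (u * t) B.index else 0) n
  have h1 : kernelSum p (segreWeight p u t) n 1 j = ∑' M,
      (if HasPExponent p M n ∧ pCorank p (leftKer M) = p then
        (if pCorank p (rightKer M) = p ^ j then
          ppWeight p t (leftKer M).index * ppWeight p (u * t) (rightKer M).index else 0)
      else 0) := by
    refine tsum_congr fun M => ?_
    simp only [← ite_and, pow_one, and_assoc]
    refine ite_congr rfl (fun hM => ?_) fun _ => rfl
    rw [segreWeight, index_eq_index_rightKer hM.1 hM.2.1, ← ppWeight_mul_ppWeight]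
    ring
  rw [h1, h, layerSum, layerSum, ← ENNReal.tsum_mul_right]
  refine tsum_congr fun A => ?_
  rw [← ENNReal.tsum_mul_left]
  refine tsum_congr fun B => ?_
  rw [pow_one, ite_zero_mul_ite_zero, ← ite_and]
  refine if_congr ?_ rfl rfl
  tauto

/-- The entries of a two by two matrix. -/
def matrixTwoEquiv : Matrix (Fin 2) (Fin 2) ℤ ≃+ (Fin 4 → ℤ) where
  toFun Z := ![Z 0 0, Z 0 1, Z 1 0, Z 1 1]
  invFun v := !![v 0, v 1; v 2, v 3]
  left_inv Z := by ext i j; fin_cases i <;> fin_cases j <;> rfl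
  right_inv v := by ext i; fin_cases i <;> rfl
  map_add' Z W := by ext i; fin_cases i <;> rfl

/-- Splitting a layer into classes according to the ranks of the kernels. -/
theorem layerSum_segreWeight_succ (u t : ℝ≥0∞) (n j : ℕ) :
    layerSum p (segreWeight p u t) (n + 1) j =
      fullSum p (segreWeight p u t) (n + 1) j +
        (if j = 1 then kernelSum p (segreWeight p u t) (n + 1) 1 1 else 0) +
        (if j = 2 then 2 * kernelSum p (segreWeight p u t) (n + 1) 1 2 else 0) := by
  rw [layerSum, tsum_eq_fullSum_add, kernelSum_comm u t (n + 1) 2 1, two_mul]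

/-- The recursion between successive layers. -/
theorem fullSum_segreWeight_succ (u t : ℝ≥0∞) (n : ℕ) {j : ℕ} (hj0 : j ≠ 0) (hj : j ≤ 4) :
    fullSum p (segreWeight p u t) (n + 1) j +
        (if j = 1 then t ^ 2 * kernelSum p (segreWeight p u t) (n + 1) 1 1 else 0) +
        (if j = 2 then 2 * (t * kernelSum p (segreWeight p u t) (n + 1) 1 2) else 0) =
      u ^ j * t ^ 4 * ∑ i ∈ Finset.range 5, liftCount p 4 i j *
        layerSum p (segreWeight p u t) n i := by
  classical
  have h := tsum_pDivision_eq (p := p) matrixTwoEquiv (segreWeight p u t) n hj0 hj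
  rw [← h, ← ENNReal.tsum_mul_left]
  simp_rw [mul_ite, mul_zero]
  -- The factor u ^ j t⁴ is the true ratio of the weights of M and its parent when both kernels have
  -- rank two. For ranks (1, 1) the ratio is u t² and for (1, 2) it is u² t³, so surplus factors t²
  -- and t appear.
  rw [tsum_eq_fullSum_add (p := p)
    (fun M => u ^ j * t ^ 4 * segreWeight p u t (pDivision p M)) n j]
  have hinj : ∀ a b : ℕ, p ^ a = p ^ b ↔ a = b := fun a b =>
    (Nat.pow_right_injective hp.out.two_le).eq_iff
  congr 1
  · congr 1
    · refine tsum_congr fun M => ite_congr rfl (fun hM => ?_) fun _ => rfl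
      rw [segreWeight_eq u t hM.2.1 hM.2.2.1 hM.2.2.2]
      ring
    · refine ite_congr rfl (fun hj1 => ?_) fun _ => rfl
      subst hj1
      rw [kernelSum, ← ENNReal.tsum_mul_left]
      refine tsum_congr fun M => ?_
      rw [mul_ite, mul_zero]
      refine ite_congr rfl (fun hM => ?_) fun _ => rfl
      have h3 : pCorank p M = p ^ 1 := by
        rw [pCorank_eq_pCorank_rightKer hM.1 (by simpa using hM.2.1), hM.2.2]
      rw [segreWeight_eq u t h3 hM.2.1 hM.2.2]
      ring
  · refine ite_congr rfl (fun hj1 => ?_) fun _ => rfl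
    subst hj1
    rw [two_mul]
    congr 1
    · rw [kernelSum, ← ENNReal.tsum_mul_left]
      refine tsum_congr fun M => ?_
      rw [mul_ite, mul_zero]
      refine ite_congr rfl (fun hM => ?_) fun _ => rfl
      have h3 : pCorank p M = p ^ 2 := by
        rw [pCorank_eq_pCorank_rightKer hM.1 (by simpa using hM.2.1), hM.2.2]
      rw [segreWeight_eq u t h3 hM.2.1 hM.2.2]
      ring
    · rw [kernelSum_comm, kernelSum, ← ENNReal.tsum_mul_left]
      refine tsum_congr fun M => ?_
      rw [mul_ite, mul_zero]
      refine ite_congr rfl (fun hM => ?_) fun _ => rfl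
      have h3 : pCorank p M = p ^ 2 := by
        rw [pCorank_eq_pCorank_leftKer hM.1 (by simpa using hM.2.2), hM.2.1]
      rw [segreWeight_eq u t h3 hM.2.1 hM.2.2]
      ring

end classes

/-! ### Values of the fibre sizes -/

section liftCount

variable {p : ℕ} [hp : Fact p.Prime]

theorem liftCount_eq {k i j c : ℕ}
    (h : p ^ (i * (k - j)) * (∏ l ∈ Finset.range (k - j), (p ^ (k - i) - p ^ l)) =
      c * ∏ l ∈ Finset.range (k - j), (p ^ (k - j) - p ^ l)) : liftCount p k i j = c :=
  Nat.div_eq_of_eq_mul_left (prod_pow_sub_pow_pos _) h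

theorem liftCount_self (k i : ℕ) : liftCount p k i k = 1 := liftCount_eq (by simp)

/-- A parent never has larger rank: a subspace of dimension k - j > k - i meets every subspace of
dimension i. -/
theorem liftCount_eq_zero {k i j : ℕ} (hij : j < i) (hi : i ≤ k) : liftCount p k i j = 0 := by
  refine liftCount_eq ?_
  have h : ∏ l ∈ Finset.range (k - j), (p ^ (k - i) - p ^ l) = 0 :=
    Finset.prod_eq_zero (Finset.mem_range.2 (show k - i < k - j by omega)) (Nat.sub_self _)
  rw [h, zero_mul, mul_zero]

/-- These are the lines of 𝔽_p ^ (k + 1) outside a subspace of dimension i, p ^ i + ⋯ + p ^ k in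
number. -/
theorem liftCount_corank_one (k i : ℕ) :
    liftCount p (k + 1) i k = p ^ i * ∑ l ∈ Finset.range (k + 1 - i), p ^ l := by
  refine liftCount_eq ?_
  have h := Nat.geomSum_eq hp.out.two_le (k + 1 - i)
  have h1 : p - 1 ∣ p ^ (k + 1 - i) - 1 := Nat.sub_one_dvd_pow_sub_one ..
  have h2 : 0 < p - 1 := Nat.sub_pos_of_lt hp.out.one_lt
  rw [h]
  simp [mul_assoc, Nat.div_mul_cancel h1]

theorem liftCount_four_zero_one : liftCount p 4 0 1 = p ^ 3 + p ^ 2 + p + 1 := by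
  have h1 := hp.out.one_lt.le
  refine liftCount_eq ?_
  -- The inequalities make the truncated differences genuine, leaving a polynomial identity over ℤ.
  have e1 : p ≤ p ^ 3 := Nat.le_self_pow (by norm_num) p
  have e2 : p ≤ p ^ 4 := Nat.le_self_pow (by norm_num) p
  have e3 : p ^ 2 ≤ p ^ 3 := Nat.pow_le_pow_right h1 (by norm_num)
  have e4 : p ^ 2 ≤ p ^ 4 := Nat.pow_le_pow_right h1 (by norm_num)
  have e5 : 1 ≤ p ^ 3 := Nat.one_le_pow _ _ h1
  have e6 : 1 ≤ p ^ 4 := Nat.one_le_pow _ _ h1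
  simp only [Finset.prod_range_succ, Finset.prod_range_zero, Nat.reduceSub, Nat.reduceMul,
    pow_zero, pow_one, one_mul]
  zify [e1, e2, e3, e4, e5, e6]
  ring

theorem liftCount_four_one_one : liftCount p 4 1 1 = p ^ 3 := liftCount_eq rfl

theorem liftCount_four_zero_two :
    liftCount p 4 0 2 = (p ^ 2 + 1) * (p ^ 2 + p + 1) := by
  have h1 := hp.out.one_lt.le
  refine liftCount_eq ?_
  have e1 : p ≤ p ^ 2 := Nat.le_self_pow (by norm_num) p
  have e2 : p ≤ p ^ 4 := Nat.le_self_pow (by norm_num) p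
  have e5 : 1 ≤ p ^ 2 := Nat.one_le_pow _ _ h1
  have e6 : 1 ≤ p ^ 4 := Nat.one_le_pow _ _ h1
  simp only [Finset.prod_range_succ, Finset.prod_range_zero, Nat.reduceSub, Nat.reduceMul,
    pow_zero, pow_one, one_mul]
  zify [e1, e2, e5, e6]
  ring

theorem liftCount_four_one_two : liftCount p 4 1 2 = p ^ 2 * (p ^ 2 + p + 1) := by
  have h1 := hp.out.one_lt.le
  refine liftCount_eq ?_
  have e1 : p ≤ p ^ 2 := Nat.le_self_pow (by norm_num) p
  have e2 : p ≤ p ^ 3 := Nat.le_self_pow (by norm_num) p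
  have e5 : 1 ≤ p ^ 2 := Nat.one_le_pow _ _ h1
  have e6 : 1 ≤ p ^ 3 := Nat.one_le_pow _ _ h1
  simp only [Finset.prod_range_succ, Finset.prod_range_zero, Nat.reduceSub, 
    pow_zero, pow_one, one_mul]
  zify [e1, e2, e5, e6]
  ring

theorem liftCount_four_two_two : liftCount p 4 2 2 = p ^ 4 := liftCount_eq rfl

end liftCount

/-! ### Summing affine recursions in [0, ∞] -/

section recursions

theorem tsum_eq_of_succ_eq {a r : ℕ → ℝ≥0∞} {x : ℝ≥0∞} (h0 : a 0 = 0)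
    (h : ∀ n, a (n + 1) = x * a n + r n) : ∑' n, a n = x * ∑' n, a n + ∑' n, r n := by
  conv_lhs => rw [tsum_eq_zero_add' ENNReal.summable, h0, zero_add]
  simp_rw [h]
  rw [ENNReal.tsum_add, ENNReal.tsum_mul_left]

/-- The equation S = x S + r does not exclude S = ∞, so finiteness needs its own argument: the
partial sums stay below the finite fixed point B = r / (1 - x). -/
theorem tsum_ne_top_of_succ_le {a r : ℕ → ℝ≥0∞} {x : ℝ≥0∞} (h0 : a 0 = 0)
    (h : ∀ n, a (n + 1) ≤ x * a n + r n) (hx : x < 1) (hr : ∑' n, r n ≠ ⊤) :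
    ∑' n, a n ≠ ⊤ := by
  have hx0 : 1 - x ≠ 0 := (tsub_pos_of_lt hx).ne'
  set B := (∑' n, r n) / (1 - x) with hB
  have hBtop : B ≠ ⊤ := ENNReal.div_ne_top hr hx0
  have hBeq : x * B + ∑' n, r n = B := by
    have h1 : (1 - x) * B = ∑' n, r n :=
      ENNReal.mul_div_cancel hx0 (ne_top_of_le_ne_top ENNReal.one_ne_top tsub_le_self)
    rw [← h1, ← add_mul, add_tsub_cancel_of_le hx.le, one_mul]
  have hle : ∀ N, ∑ n ∈ Finset.range N, a n ≤ B := by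
    intro N
    induction N with
    | zero => simp
    | succ N ih =>
      rw [Finset.sum_range_succ', h0, add_zero]
      calc ∑ n ∈ Finset.range N, a (n + 1) ≤ ∑ n ∈ Finset.range N, (x * a n + r n) :=
            Finset.sum_le_sum fun n _ => h n
        _ = x * ∑ n ∈ Finset.range N, a n + ∑ n ∈ Finset.range N, r n := by
            rw [Finset.sum_add_distrib, Finset.mul_sum]
        _ ≤ x * B + ∑' n, r n := add_le_add (by gcongr) (ENNReal.sum_le_tsum _)
        _ = B := hBeq
  refine ne_top_of_le_ne_top hBtop ?_
  rw [ENNReal.tsum_eq_iSup_nat]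
  exact iSup_le hle

end recursions

/-! ### Recursions for the individual classes -/

section totals

variable {p : ℕ} [hp : Fact p.Prime]

theorem sum_range_three {R : Type*} [AddCommMonoid R] (f : ℕ → R) :
    ∑ i ∈ Finset.range 3, f i = f 0 + f 1 + f 2 := by
  rw [Finset.sum_range_succ, Finset.sum_range_succ, Finset.sum_range_one]

/-- The rank 0 term is the indicator of n = 0, since only the whole group has rank 0. The whole
group lies below p + 1 subgroups of rank one, a rank one subgroup below p. -/
theorem layerSum_two_one_succ (x : ℝ≥0∞) (n : ℕ) :
    layerSum p (fun A : AddSubgroup (Fin 2 → ℤ) => ppWeight p x A.index) (n + 1) 1 =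
      x * ((p + 1) * (if n = 0 then 1 else 0) +
        p * layerSum p (fun A : AddSubgroup (Fin 2 → ℤ) => ppWeight p x A.index) n 1) := by
  rw [layerSum_ppWeight_succ (AddEquiv.refl _) x n one_ne_zero one_le_two]
  have h2 : liftCount p 2 2 1 = 0 := liftCount_eq_zero (by norm_num) le_rfl
  have h1 : liftCount p 2 1 1 = p := by
    rw [liftCount_corank_one]; simp
  have h0 : liftCount p 2 0 1 = p + 1 := by
    rw [liftCount_corank_one]; simp [Finset.sum_range_succ, add_comm]
  rw [sum_range_three, h0, h1, h2]
  cases n with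
  | zero => simp [layerSum_zero_zero, layerSum_zero_of_ne, ppWeight_one]
  | succ n => simp [layerSum_succ_zero]

theorem layerSum_two_two_succ (x : ℝ≥0∞) (n : ℕ) :
    layerSum p (fun A : AddSubgroup (Fin 2 → ℤ) => ppWeight p x A.index) (n + 1) 2 =
      x ^ 2 * ((if n = 0 then 1 else 0) +
        layerSum p (fun A : AddSubgroup (Fin 2 → ℤ) => ppWeight p x A.index) n 1 +
        layerSum p (fun A : AddSubgroup (Fin 2 → ℤ) => ppWeight p x A.index) n 2) := by
  rw [layerSum_ppWeight_succ (AddEquiv.refl _) x n two_ne_zero le_rfl]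
  rw [sum_range_three]
  simp only [liftCount_self]
  cases n with
  | zero => simp [layerSum_zero_zero, layerSum_zero_of_ne, ppWeight_one]
  | succ n => simp [layerSum_succ_zero]

variable (u t : ℝ≥0∞)

theorem kernelSum_one_one_zero : kernelSum p (segreWeight p u t) 0 1 1 = 0 := by
  rw [kernelSum_one_eq, layerSum_zero_of_ne _ one_ne_zero, zero_mul]

theorem kernelSum_one_two_zero : kernelSum p (segreWeight p u t) 0 1 2 = 0 := by
  rw [kernelSum_one_eq, layerSum_zero_of_ne _ one_ne_zero, zero_mul]

/-- Product of the rank one recursions with x = t and x = u t. Mixed terms vanish: the source lives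
at n = 0, where the rank one layers are empty. -/
theorem kernelSum_one_one_succ (n : ℕ) :
    kernelSum p (segreWeight p u t) (n + 1) 1 1 =
      (p ^ 2 * u * t ^ 2) * kernelSum p (segreWeight p u t) n 1 1 +
        (if n = 0 then (p + 1) ^ 2 * u * t ^ 2 else 0) := by
  rw [kernelSum_one_eq, kernelSum_one_eq, layerSum_two_one_succ, layerSum_two_one_succ]
  cases n with
  | zero =>
    simp only [layerSum_zero_of_ne _ one_ne_zero, if_true]
    ring
  | succ n =>
    simp only [Nat.add_eq_zero_iff, one_ne_zero, and_false, if_false]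
    ring

theorem kernelSum_one_two_succ (n : ℕ) :
    kernelSum p (segreWeight p u t) (n + 1) 1 2 =
      (p * u ^ 2 * t ^ 3) * kernelSum p (segreWeight p u t) n 1 2 +
        ((p * u ^ 2 * t ^ 3) * kernelSum p (segreWeight p u t) n 1 1 +
          (if n = 0 then (p + 1) * u ^ 2 * t ^ 3 else 0)) := by
  rw [kernelSum_one_eq, kernelSum_one_eq, kernelSum_one_eq, layerSum_two_one_succ,
    layerSum_two_two_succ]
  cases n with
  | zero =>
    simp only [layerSum_zero_of_ne _ one_ne_zero, layerSum_zero_of_ne _ two_ne_zero, if_true]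
    ring
  | succ n =>
    simp only [Nat.add_eq_zero_iff, one_ne_zero, and_false, if_false]
    ring

theorem fullSum_zero {j : ℕ} (hj : j ≠ 0) : fullSum p (segreWeight p u t) 0 j = 0 := by
  classical
  refine le_antisymm ?_ bot_le
  rw [← layerSum_zero_of_ne (p := p) (segreWeight p u t) hj]
  refine ENNReal.tsum_le_tsum fun M => ?_
  split_ifs with h1 h2
  · exact le_rfl
  · exact absurd ⟨h1.1, h1.2.1⟩ h2
  all_goals exact bot_le

theorem layerSum_segreWeight (n : ℕ) {j : ℕ} (hj : j ≠ 0) :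
    layerSum p (segreWeight p u t) n j =
      fullSum p (segreWeight p u t) n j +
        (if j = 1 then kernelSum p (segreWeight p u t) n 1 1 else 0) +
        (if j = 2 then 2 * kernelSum p (segreWeight p u t) n 1 2 else 0) := by
  cases n with
  | zero => simp [layerSum_zero_of_ne _ hj, fullSum_zero u t hj, kernelSum_one_one_zero,
      kernelSum_one_two_zero]
  | succ n => exact layerSum_segreWeight_succ u t n j

theorem tsum_layerSum_zero :
    ∑' n, layerSum p (segreWeight p u t) n 0 = 1 := by
  rw [tsum_eq_single 0]
  · have hl : leftKer (⊤ : AddSubgroup (Matrix (Fin 2) (Fin 2) ℤ)) = ⊤ :=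
      (AddSubgroup.eq_top_iff' _).2 fun a => mem_leftKer.2 fun b => AddSubgroup.mem_top _
    have hr : rightKer (⊤ : AddSubgroup (Matrix (Fin 2) (Fin 2) ℤ)) = ⊤ :=
      (AddSubgroup.eq_top_iff' _).2 fun a => mem_rightKer.2 fun b => AddSubgroup.mem_top _
    rw [layerSum_zero_zero, segreWeight, hl, hr]
    simp [ppWeight_one]
  · intro n hn
    obtain ⟨m, rfl⟩ := Nat.exists_eq_succ_of_ne_zero hn
    exact layerSum_succ_zero _ m

end totals

/-! ### The linear system for the totals -/

section equations

variable {p : ℕ} [hp : Fact p.Prime] (u t : ℝ≥0∞)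

theorem fullSum_recursion_one (n : ℕ) :
    fullSum p (segreWeight p u t) (n + 1) 1 + t ^ 2 * kernelSum p (segreWeight p u t) (n + 1) 1 1 =
      p ^ 3 * u * t ^ 4 * fullSum p (segreWeight p u t) n 1 +
      u * t ^ 4 * ((p ^ 3 + p ^ 2 + p + 1) * layerSum p (segreWeight p u t) n 0 +
        p ^ 3 * kernelSum p (segreWeight p u t) n 1 1) := by
  have h := fullSum_segreWeight_succ (p := p) u t n one_ne_zero (by norm_num)
  rw [Finset.sum_range_succ, Finset.sum_range_succ, sum_range_three,
    layerSum_segreWeight u t n one_ne_zero, liftCount_four_zero_one, liftCount_four_one_one,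
    liftCount_eq_zero (p := p) (show 1 < 2 by norm_num) (show 2 ≤ 4 by norm_num),
    liftCount_eq_zero (p := p) (show 1 < 3 by norm_num) (show 3 ≤ 4 by norm_num),
    liftCount_eq_zero (p := p) (show 1 < 4 by norm_num) (show 4 ≤ 4 by norm_num)] at h
  norm_num at h
  rw [h]
  ring

theorem fullSum_recursion_two (n : ℕ) :
    fullSum p (segreWeight p u t) (n + 1) 2 +
        2 * (t * kernelSum p (segreWeight p u t) (n + 1) 1 2) =
      p ^ 4 * u ^ 2 * t ^ 4 * fullSum p (segreWeight p u t) n 2 +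
      u ^ 2 * t ^ 4 * ((p ^ 2 + 1) * (p ^ 2 + p + 1) * layerSum p (segreWeight p u t) n 0 +
        p ^ 2 * (p ^ 2 + p + 1) * layerSum p (segreWeight p u t) n 1 +
        p ^ 4 * (2 * kernelSum p (segreWeight p u t) n 1 2)) := by
  have h := fullSum_segreWeight_succ (p := p) u t n two_ne_zero (by norm_num)
  rw [Finset.sum_range_succ, Finset.sum_range_succ, sum_range_three,
    layerSum_segreWeight u t n two_ne_zero,
    liftCount_four_zero_two, liftCount_four_one_two, liftCount_four_two_two,
    liftCount_eq_zero (p := p) (show 2 < 3 by norm_num) (show 3 ≤ 4 by norm_num),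
    liftCount_eq_zero (p := p) (show 2 < 4 by norm_num) (show 4 ≤ 4 by norm_num)] at h
  norm_num at h
  rw [h]
  ring

theorem fullSum_recursion_three (n : ℕ) :
    fullSum p (segreWeight p u t) (n + 1) 3 =
      p ^ 3 * u ^ 3 * t ^ 4 * fullSum p (segreWeight p u t) n 3 +
      u ^ 3 * t ^ 4 * ((p ^ 3 + p ^ 2 + p + 1) * layerSum p (segreWeight p u t) n 0 +
        p * (p ^ 2 + p + 1) * layerSum p (segreWeight p u t) n 1 +
        p ^ 2 * (p + 1) * layerSum p (segreWeight p u t) n 2) := by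
  have h := fullSum_segreWeight_succ (p := p) u t n three_ne_zero (by norm_num)
  rw [Finset.sum_range_succ, Finset.sum_range_succ, sum_range_three,
    layerSum_segreWeight u t n three_ne_zero,
    liftCount_corank_one, liftCount_corank_one, liftCount_corank_one, liftCount_corank_one,
    liftCount_eq_zero (p := p) (show 3 < 4 by norm_num) (show 4 ≤ 4 by norm_num)] at h
  norm_num [Finset.sum_range_succ] at h
  rw [h]
  ring

theorem fullSum_recursion_four (n : ℕ) :
    fullSum p (segreWeight p u t) (n + 1) 4 =
      u ^ 4 * t ^ 4 * fullSum p (segreWeight p u t) n 4 +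
      u ^ 4 * t ^ 4 * (layerSum p (segreWeight p u t) n 0 + layerSum p (segreWeight p u t) n 1 +
        layerSum p (segreWeight p u t) n 2 + layerSum p (segreWeight p u t) n 3) := by
  have h := fullSum_segreWeight_succ (p := p) u t n four_ne_zero le_rfl
  rw [Finset.sum_range_succ, Finset.sum_range_succ, sum_range_three,
    layerSum_segreWeight u t n four_ne_zero] at h
  norm_num [liftCount_self] at h
  rw [h]
  ring

theorem tsum_succ_of_zero {a : ℕ → ℝ≥0∞} (h0 : a 0 = 0) : ∑' n, a (n + 1) = ∑' n, a n := by
  conv_rhs => rw [tsum_eq_zero_add' ENNReal.summable, h0, zero_add]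

/-- The total weights of the classes of subgroups are finite and satisfy a linear system. -/
theorem exists_totals (hY₁ : p ^ 2 * u * t ^ 2 < 1) (hY₂ : p * u ^ 2 * t ^ 3 < 1)
    (hX₁ : p ^ 3 * u * t ^ 4 < 1) (hX₂ : p ^ 4 * u ^ 2 * t ^ 4 < 1)
    (hX₃ : p ^ 3 * u ^ 3 * t ^ 4 < 1) (hX₄ : u ^ 4 * t ^ 4 < 1) (hu : u ≠ ⊤) (ht : t ≠ ⊤) :
    ∃ L R F₁ F₂ F₃ F₄ : ℝ≥0∞,
      (L ≠ ⊤ ∧ R ≠ ⊤ ∧ F₁ ≠ ⊤ ∧ F₂ ≠ ⊤ ∧ F₃ ≠ ⊤ ∧ F₄ ≠ ⊤) ∧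
      L = p ^ 2 * u * t ^ 2 * L + (p + 1) ^ 2 * u * t ^ 2 ∧
      R = p * u ^ 2 * t ^ 3 * R + (p * u ^ 2 * t ^ 3 * L + (p + 1) * u ^ 2 * t ^ 3) ∧
      F₁ + t ^ 2 * L = p ^ 3 * u * t ^ 4 * F₁ +
        u * t ^ 4 * (p ^ 3 + p ^ 2 + p + 1 + p ^ 3 * L) ∧
      F₂ + 2 * (t * R) = p ^ 4 * u ^ 2 * t ^ 4 * F₂ +
        u ^ 2 * t ^ 4 * ((p ^ 2 + 1) * (p ^ 2 + p + 1) + p ^ 2 * (p ^ 2 + p + 1) * (F₁ + L) +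
          p ^ 4 * (2 * R)) ∧
      F₃ = p ^ 3 * u ^ 3 * t ^ 4 * F₃ + u ^ 3 * t ^ 4 * (p ^ 3 + p ^ 2 + p + 1 +
        p * (p ^ 2 + p + 1) * (F₁ + L) + p ^ 2 * (p + 1) * (F₂ + 2 * R)) ∧
      F₄ = u ^ 4 * t ^ 4 * F₄ + u ^ 4 * t ^ 4 * (1 + (F₁ + L) + (F₂ + 2 * R) + F₃) ∧
      ∑' M, segreWeight p u t M = 1 + (F₁ + L) + (F₂ + 2 * R) + F₃ + F₄ := by
  set a := fun n => kernelSum p (segreWeight p u t) n 1 1 with ha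
  set b := fun n => kernelSum p (segreWeight p u t) n 1 2 with hb
  set f := fun j n => fullSum p (segreWeight p u t) n j with hf
  set l := fun j n => layerSum p (segreWeight p u t) n j with hl
  have ha0 : a 0 = 0 := kernelSum_one_one_zero u t
  have hb0 : b 0 = 0 := kernelSum_one_two_zero u t
  have hf0 : ∀ j, j ≠ 0 → f j 0 = 0 := fun j hj => fullSum_zero u t hj
  have hl0 : ∑' n, l 0 n = 1 := tsum_layerSum_zero u t
  have hl1 : ∀ n, l 1 n = f 1 n + a n := fun n => by
    have := layerSum_segreWeight (p := p) u t n one_ne_zero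
    norm_num at this
    exact this
  have hl2 : ∀ n, l 2 n = f 2 n + 2 * b n := fun n => by
    have := layerSum_segreWeight (p := p) u t n two_ne_zero
    norm_num at this
    exact this
  have hl3 : ∀ n, l 3 n = f 3 n := fun n => by
    have := layerSum_segreWeight (p := p) u t n three_ne_zero
    norm_num at this
    exact this
  have hl4 : ∀ n, l 4 n = f 4 n := fun n => by
    have := layerSum_segreWeight (p := p) u t n four_ne_zero
    norm_num at this
    exact this
  have sl1 : ∑' n, l 1 n = ∑' n, f 1 n + ∑' n, a n := by
    rw [← ENNReal.tsum_add]; exact tsum_congr hl1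
  have sl2 : ∑' n, l 2 n = ∑' n, f 2 n + 2 * ∑' n, b n := by
    rw [← ENNReal.tsum_mul_left, ← ENNReal.tsum_add]; exact tsum_congr hl2
  have sl3 : ∑' n, l 3 n = ∑' n, f 3 n := tsum_congr hl3
  have sl4 : ∑' n, l 4 n = ∑' n, f 4 n := tsum_congr hl4
  have hpt : (p : ℝ≥0∞) ≠ ⊤ := ENNReal.natCast_ne_top p
  have sa : ∑' n, (if n = 0 then ((p : ℝ≥0∞) + 1) ^ 2 * u * t ^ 2 else 0) =
      (p + 1) ^ 2 * u * t ^ 2 := tsum_ite_eq 0 _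
  have sb : ∑' n, (p * u ^ 2 * t ^ 3 * a n +
      (if n = 0 then ((p : ℝ≥0∞) + 1) * u ^ 2 * t ^ 3 else 0)) =
      p * u ^ 2 * t ^ 3 * ∑' n, a n + (p + 1) * u ^ 2 * t ^ 3 := by
    rw [ENNReal.tsum_add, ENNReal.tsum_mul_left]
    congr 1
    exact tsum_ite_eq 0 _
  have s1 : ∑' n, u * t ^ 4 * ((p ^ 3 + p ^ 2 + p + 1) * l 0 n + p ^ 3 * a n) =
      u * t ^ 4 * (p ^ 3 + p ^ 2 + p + 1 + p ^ 3 * ∑' n, a n) := by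
    rw [ENNReal.tsum_mul_left, ENNReal.tsum_add, ENNReal.tsum_mul_left, ENNReal.tsum_mul_left,
      hl0, mul_one]
  have s2 : ∑' n, u ^ 2 * t ^ 4 * ((p ^ 2 + 1) * (p ^ 2 + p + 1) * l 0 n +
      p ^ 2 * (p ^ 2 + p + 1) * l 1 n + p ^ 4 * (2 * b n)) =
      u ^ 2 * t ^ 4 * ((p ^ 2 + 1) * (p ^ 2 + p + 1) +
        p ^ 2 * (p ^ 2 + p + 1) * (∑' n, f 1 n + ∑' n, a n) + p ^ 4 * (2 * ∑' n, b n)) := by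
    simp_rw [ENNReal.tsum_mul_left, ENNReal.tsum_add, ENNReal.tsum_mul_left, hl0, sl1, mul_one]
  have s3 : ∑' n, u ^ 3 * t ^ 4 * ((p ^ 3 + p ^ 2 + p + 1) * l 0 n +
        p * (p ^ 2 + p + 1) * l 1 n + p ^ 2 * (p + 1) * l 2 n) =
      u ^ 3 * t ^ 4 * (p ^ 3 + p ^ 2 + p + 1 +
        p * (p ^ 2 + p + 1) * (∑' n, f 1 n + ∑' n, a n) +
        p ^ 2 * (p + 1) * (∑' n, f 2 n + 2 * ∑' n, b n)) := by
    simp_rw [ENNReal.tsum_mul_left, ENNReal.tsum_add, ENNReal.tsum_mul_left, hl0, sl1, sl2,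
      mul_one]
  have s4 : ∑' n, u ^ 4 * t ^ 4 * (l 0 n + l 1 n + l 2 n + l 3 n) =
      u ^ 4 * t ^ 4 * (1 + (∑' n, f 1 n + ∑' n, a n) + (∑' n, f 2 n + 2 * ∑' n, b n) +
        ∑' n, f 3 n) := by
    simp_rw [ENNReal.tsum_mul_left, ENNReal.tsum_add, hl0, sl1, sl2, sl3]
  have ra := kernelSum_one_one_succ (p := p) u t
  have rb := kernelSum_one_two_succ (p := p) u t
  have r1 := fullSum_recursion_one (p := p) u t
  have r2 := fullSum_recursion_two (p := p) u t
  have r3 := fullSum_recursion_three (p := p) u t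
  have r4 := fullSum_recursion_four (p := p) u t
  have ta : ∑' n, a n ≠ ⊤ := by
    refine tsum_ne_top_of_succ_le ha0 (fun n => (ra n).le) hY₁ ?_
    rw [sa]
    finiteness
  have tb : ∑' n, b n ≠ ⊤ := by
    refine tsum_ne_top_of_succ_le hb0 (fun n => (rb n).le) hY₂ ?_
    rw [sb]
    finiteness
  have t1 : ∑' n, f 1 n ≠ ⊤ := by
    -- The extra summand on the left of the recursion is nonnegative and may be dropped for the
    -- bound.
    refine tsum_ne_top_of_succ_le (hf0 1 one_ne_zero)
      (fun n => le_self_add.trans (r1 n).le) hX₁ ?_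
    rw [s1]
    finiteness
  have t2 : ∑' n, f 2 n ≠ ⊤ := by
    refine tsum_ne_top_of_succ_le (hf0 2 two_ne_zero)
      (fun n => le_self_add.trans (r2 n).le) hX₂ ?_
    rw [s2]
    finiteness
  have t3 : ∑' n, f 3 n ≠ ⊤ := by
    refine tsum_ne_top_of_succ_le (hf0 3 three_ne_zero) (fun n => (r3 n).le) hX₃ ?_
    rw [s3]
    finiteness
  have t4 : ∑' n, f 4 n ≠ ⊤ := by
    refine tsum_ne_top_of_succ_le (hf0 4 four_ne_zero) (fun n => (r4 n).le) hX₄ ?_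
    rw [s4]
    finiteness
  refine ⟨∑' n, a n, ∑' n, b n, ∑' n, f 1 n, ∑' n, f 2 n, ∑' n, f 3 n, ∑' n, f 4 n,
    ⟨ta, tb, t1, t2, t3, t4⟩, ?_, ?_, ?_, ?_, ?_, ?_, ?_⟩
  · conv_lhs => rw [tsum_eq_of_succ_eq ha0 ra, sa]
  · conv_lhs => rw [tsum_eq_of_succ_eq hb0 rb, sb]
  -- Both sequences vanish at 0, so their sums can be shifted by one and the recursion summed
  -- termwise, with no subtraction in [0, ∞].
  · rw [← tsum_succ_of_zero (hf0 1 one_ne_zero), ← tsum_succ_of_zero ha0, ← ENNReal.tsum_mul_left,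
      ← ENNReal.tsum_add, tsum_congr r1, ENNReal.tsum_add, s1, ENNReal.tsum_mul_left,
      tsum_succ_of_zero (hf0 1 one_ne_zero), tsum_succ_of_zero ha0]
  · conv_lhs =>
      rw [← tsum_succ_of_zero (hf0 2 two_ne_zero), ← tsum_succ_of_zero hb0,
        ← ENNReal.tsum_mul_left, ← ENNReal.tsum_mul_left, ← ENNReal.tsum_add, tsum_congr r2,
        ENNReal.tsum_add, s2, ENNReal.tsum_mul_left]
  · conv_lhs => rw [tsum_eq_of_succ_eq (hf0 3 three_ne_zero) r3, s3]
  · conv_lhs => rw [tsum_eq_of_succ_eq (hf0 4 four_ne_zero) r4, s4]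
  · rw [tsum_eq_tsum_layerSum (p := p) matrixTwoEquiv]
    · simp_rw [Finset.sum_range_succ, Finset.sum_range_zero, zero_add, ENNReal.tsum_add]
      change ∑' n, l 0 n + ∑' n, l 1 n + ∑' n, l 2 n + ∑' n, l 3 n + ∑' n, l 4 n = _
      rw [hl0, sl1, sl2, sl3, sl4]
    · intro M hM
      by_contra h
      exact hM (by rw [segreWeight, ppWeight_of_not h, zero_mul])

end equations

/-! ### Igusa factors and the closed form -/

section igusa

variable {K : Type*} [Field K]

theorem sort_ge_eq {n : ℕ} {I : Finset (Fin n)} {l : List (Fin n)} (h : l.toFinset = I)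
    (hl : l.Pairwise (· ≥ ·)) (hn : l.Nodup) : I.sort (· ≥ ·) = l := by
  subst h
  exact (List.toFinset_sort (· ≥ ·) hn).2 hl

theorem igusaFactor_one (p U : K) : igusaFactor p ![U] = 1 + (1 + p⁻¹) * (U / (1 - U)) := by
  have hI : (Finset.univ : Finset (Finset (Fin 1))) = {∅, {0}} := by decide
  have h1 : ({0} : Finset (Fin 1)).sort (· ≥ ·) = [0] := sort_ge_eq rfl (by decide) (by decide)
  rw [igusaFactor, hI, Finset.sum_pair (by decide), Finset.sort_empty, h1]
  simp [flagPoly, gaussBinom]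

theorem igusaFactor_two (p U V : K) : igusaFactor p ![U, V] =
    1 + (1 + p⁻¹ + p⁻¹ ^ 2) * (U / (1 - U)) + (1 + p⁻¹ + p⁻¹ ^ 2) * (V / (1 - V)) +
      (1 + p⁻¹ + p⁻¹ ^ 2) * (1 + p⁻¹) * (U / (1 - U) * (V / (1 - V))) := by
  have hI : (Finset.univ : Finset (Finset (Fin 2))) = {∅, {0}, {1}, {0, 1}} := by decide
  have h1 : ({0} : Finset (Fin 2)).sort (· ≥ ·) = [0] := sort_ge_eq rfl (by decide) (by decide)
  have h2 : ({1} : Finset (Fin 2)).sort (· ≥ ·) = [1] := sort_ge_eq rfl (by decide) (by decide)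
  have h3 : ({0, 1} : Finset (Fin 2)).sort (· ≥ ·) = [1, 0] :=
    sort_ge_eq (by decide) (by decide) (by decide)
  rw [igusaFactor, hI, Finset.sum_insert (by decide), Finset.sum_insert (by decide),
    Finset.sum_pair (by decide), Finset.sort_empty, h1, h2, h3, Finset.prod_pair (by decide)]
  simp [flagPoly, gaussBinom]
  ring

theorem igusaFactor_three (p U V W : K) : igusaFactor p ![U, V, W] =
    1 + (1 + p⁻¹ + p⁻¹ ^ 2 + p⁻¹ ^ 3) * (U / (1 - U)) +
      (1 + p⁻¹ ^ 2) * (1 + p⁻¹ + p⁻¹ ^ 2) * (V / (1 - V)) +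
      (1 + p⁻¹ + p⁻¹ ^ 2 + p⁻¹ ^ 3) * (W / (1 - W)) +
      (1 + p⁻¹ ^ 2) * (1 + p⁻¹ + p⁻¹ ^ 2) * (1 + p⁻¹) * (U / (1 - U) * (V / (1 - V))) +
      (1 + p⁻¹ + p⁻¹ ^ 2 + p⁻¹ ^ 3) * (1 + p⁻¹ + p⁻¹ ^ 2) * (U / (1 - U) * (W / (1 - W))) +
      (1 + p⁻¹ + p⁻¹ ^ 2 + p⁻¹ ^ 3) * (1 + p⁻¹ + p⁻¹ ^ 2) * (V / (1 - V) * (W / (1 - W))) +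
      (1 + p⁻¹ + p⁻¹ ^ 2 + p⁻¹ ^ 3) * (1 + p⁻¹ + p⁻¹ ^ 2) * (1 + p⁻¹) *
        (U / (1 - U) * (V / (1 - V) * (W / (1 - W)))) := by
  have hI : (Finset.univ : Finset (Finset (Fin 3))) =
      {∅, {0}, {1}, {2}, {0, 1}, {0, 2}, {1, 2}, {0, 1, 2}} := by decide
  have h1 : ({0} : Finset (Fin 3)).sort (· ≥ ·) = [0] := sort_ge_eq rfl (by decide) (by decide)
  have h2 : ({1} : Finset (Fin 3)).sort (· ≥ ·) = [1] := sort_ge_eq rfl (by decide) (by decide)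
  have h3 : ({2} : Finset (Fin 3)).sort (· ≥ ·) = [2] := sort_ge_eq rfl (by decide) (by decide)
  have h4 : ({0, 1} : Finset (Fin 3)).sort (· ≥ ·) = [1, 0] :=
    sort_ge_eq (by decide) (by decide) (by decide)
  have h5 : ({0, 2} : Finset (Fin 3)).sort (· ≥ ·) = [2, 0] :=
    sort_ge_eq (by decide) (by decide) (by decide)
  have h6 : ({1, 2} : Finset (Fin 3)).sort (· ≥ ·) = [2, 1] :=
    sort_ge_eq (by decide) (by decide) (by decide)
  have h7 : ({0, 1, 2} : Finset (Fin 3)).sort (· ≥ ·) = [2, 1, 0] :=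
    sort_ge_eq (by decide) (by decide) (by decide)
  rw [igusaFactor, hI]
  iterate 6 rw [Finset.sum_insert (by decide)]
  rw [Finset.sum_pair (by decide), Finset.sort_empty, h1, h2, h3, h4, h5, h6, h7,
    Finset.prod_pair (by decide), Finset.prod_pair (by decide), Finset.prod_pair (by decide),
    Finset.prod_insert (by decide), Finset.prod_pair (by decide)]
  simp [flagPoly, gaussBinom]
  ring

/-- `W₀ + (p + 1)² W₁ + 2 (p + 1) W₂` as a rational function of `p` and `T = p ^ (-s)`. -/
def segreFactor (p T : K) : K :=
  igusaFactor p ![p ^ 7 * T ^ 5, p ^ 12 * T ^ 6, p ^ 15 * T ^ 7] +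
    (p + 1) ^ 2 * (igusaFactor p ![p ^ 12 * T ^ 6, p ^ 15 * T ^ 7] *
      exceptionalFactor p 3 2 (p ^ 7 * T ^ 5) (p ^ 6 * T ^ 3)) +
    2 * (p + 1) * (igusaFactor p ![p ^ 15 * T ^ 7] *
      exceptionalFactor p 4 1 (p ^ 12 * T ^ 6) (p ^ 9 * T ^ 5) * igusaFactor p ![p ^ 6 * T ^ 3])

theorem segreFactor_eq (p T : K) (hp : p ≠ 0) (h1 : 1 - p ^ 7 * T ^ 5 ≠ 0)
    (h2 : 1 - p ^ 12 * T ^ 6 ≠ 0) (h3 : 1 - p ^ 15 * T ^ 7 ≠ 0) (h4 : 1 - p ^ 6 * T ^ 3 ≠ 0)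
    (h5 : 1 - p ^ 9 * T ^ 5 ≠ 0) :
    segreFactor p T = segreNumerator p T / ((1 - p ^ 7 * T ^ 5) * (1 - p ^ 12 * T ^ 6) *
      (1 - p ^ 15 * T ^ 7) * (1 - p ^ 6 * T ^ 3) * (1 - p ^ 9 * T ^ 5)) := by
  rw [segreFactor, igusaFactor_one, igusaFactor_one, igusaFactor_two, igusaFactor_three,
    exceptionalFactor, exceptionalFactor, segreNumerator]
  -- The denominators stay opaque while fractions are cleared; afterwards a polynomial identity in p
  -- and T remains.
  generalize hX1 : 1 - p ^ 7 * T ^ 5 = D1 at *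
  generalize hX2 : 1 - p ^ 12 * T ^ 6 = D2 at *
  generalize hX3 : 1 - p ^ 15 * T ^ 7 = D3 at *
  generalize hX4 : 1 - p ^ 6 * T ^ 3 = D4 at *
  generalize hX5 : 1 - p ^ 9 * T ^ 5 = D5 at *
  field_simp
  subst hX1 hX2 hX3 hX4 hX5
  ring

end igusa

/-! ### Solution of the system for real T -/

section real

open scoped NNReal

theorem pow_mul_pow_lt_one {p T : ℝ} (hp : 1 ≤ p) (hT : 0 ≤ T) (h : p ^ 3 * T < 1) {a b : ℕ}
    (hab : a ≤ 3 * b) (hb : b ≠ 0) : p ^ a * T ^ b < 1 := by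
  calc p ^ a * T ^ b ≤ p ^ (3 * b) * T ^ b := by gcongr
    _ = (p ^ 3 * T) ^ b := by rw [mul_pow, pow_mul]
    _ < 1 := pow_lt_one₀ (by positivity) h hb

/-- The solution of the linear system satisfied by the total weights. -/
theorem solve_totals {p T L R F₁ F₂ F₃ F₄ : ℝ} (hp : p ≠ 0) (h1 : 1 - p ^ 7 * T ^ 5 ≠ 0)
    (h2 : 1 - p ^ 12 * T ^ 6 ≠ 0) (h3 : 1 - p ^ 15 * T ^ 7 ≠ 0) (h4 : 1 - p ^ 6 * T ^ 3 ≠ 0)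
    (h5 : 1 - p ^ 9 * T ^ 5 ≠ 0)
    (hL : L = p ^ 2 * (p ^ 4 * T) * T ^ 2 * L + (p + 1) ^ 2 * (p ^ 4 * T) * T ^ 2)
    (hR : R = p * (p ^ 4 * T) ^ 2 * T ^ 3 * R +
      (p * (p ^ 4 * T) ^ 2 * T ^ 3 * L + (p + 1) * (p ^ 4 * T) ^ 2 * T ^ 3))
    (hF₁ : F₁ + T ^ 2 * L = p ^ 3 * (p ^ 4 * T) * T ^ 4 * F₁ +
      (p ^ 4 * T) * T ^ 4 * (p ^ 3 + p ^ 2 + p + 1 + p ^ 3 * L))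
    (hF₂ : F₂ + 2 * (T * R) = p ^ 4 * (p ^ 4 * T) ^ 2 * T ^ 4 * F₂ +
      (p ^ 4 * T) ^ 2 * T ^ 4 * ((p ^ 2 + 1) * (p ^ 2 + p + 1) +
        p ^ 2 * (p ^ 2 + p + 1) * (F₁ + L) + p ^ 4 * (2 * R)))
    (hF₃ : F₃ = p ^ 3 * (p ^ 4 * T) ^ 3 * T ^ 4 * F₃ +
      (p ^ 4 * T) ^ 3 * T ^ 4 * (p ^ 3 + p ^ 2 + p + 1 + p * (p ^ 2 + p + 1) * (F₁ + L) +
        p ^ 2 * (p + 1) * (F₂ + 2 * R)))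
    (hF₄ : F₄ = (p ^ 4 * T) ^ 4 * T ^ 4 * F₄ +
      (p ^ 4 * T) ^ 4 * T ^ 4 * (1 + (F₁ + L) + (F₂ + 2 * R) + F₃)) :
    (1 + (F₁ + L) + (F₂ + 2 * R) + F₃ + F₄) * (1 - p ^ 16 * T ^ 8) = segreFactor p T := by
  -- The rank four class is p¹⁶ T⁸ times the whole total, which accounts for the factor ζ_p(8s -
  -- 16).
  have eS : (1 + (F₁ + L) + (F₂ + 2 * R) + F₃ + F₄) * (1 - p ^ 16 * T ^ 8) =
      1 + (F₁ + L) + (F₂ + 2 * R) + F₃ := by linear_combination hF₄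
  -- The system is triangular: each total is expressed through the earlier ones.
  have eL : L = (p + 1) ^ 2 * p ^ 4 * T ^ 3 / (1 - p ^ 6 * T ^ 3) := by
    rw [eq_div_iff h4]; linear_combination hL
  have eR : R = (p ^ 9 * T ^ 5 * L + (p + 1) * p ^ 8 * T ^ 5) / (1 - p ^ 9 * T ^ 5) := by
    rw [eq_div_iff h5]; linear_combination hR
  have e1 : F₁ = (p ^ 4 * T ^ 5 * (p ^ 3 + p ^ 2 + p + 1 + p ^ 3 * L) - T ^ 2 * L) /
      (1 - p ^ 7 * T ^ 5) := by
    rw [eq_div_iff h1]; linear_combination hF₁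
  have e2 : F₂ = (p ^ 8 * T ^ 6 * ((p ^ 2 + 1) * (p ^ 2 + p + 1) +
      p ^ 2 * (p ^ 2 + p + 1) * (F₁ + L) + p ^ 4 * (2 * R)) - 2 * T * R) /
      (1 - p ^ 12 * T ^ 6) := by
    rw [eq_div_iff h2]; linear_combination hF₂
  have e3 : F₃ = p ^ 12 * T ^ 7 * (p ^ 3 + p ^ 2 + p + 1 + p * (p ^ 2 + p + 1) * (F₁ + L) +
      p ^ 2 * (p + 1) * (F₂ + 2 * R)) / (1 - p ^ 15 * T ^ 7) := by
    rw [eq_div_iff h3]; linear_combination hF₃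
  rw [eS, segreFactor_eq p T hp h1 h2 h3 h4 h5, segreNumerator, e3, e2, e1, eR, eL]
  generalize hX1 : 1 - p ^ 7 * T ^ 5 = D1 at *
  generalize hX2 : 1 - p ^ 12 * T ^ 6 = D2 at *
  generalize hX3 : 1 - p ^ 15 * T ^ 7 = D3 at *
  generalize hX4 : 1 - p ^ 6 * T ^ 3 = D4 at *
  generalize hX5 : 1 - p ^ 9 * T ^ 5 = D5 at *
  clear hL hR hF₁ hF₂ hF₃ hF₄ eS eL eR e1 e2 e3
  field_simp
  subst hX1 hX2 hX3 hX4 hX5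
  ring

variable {p : ℕ} [hp : Fact p.Prime]

theorem exists_tsum_segreWeight (T : ℝ≥0) (hT : (p : ℝ) ^ 3 * T < 1) :
    ∃ S : ℝ≥0, ∑' M, segreWeight p ((p : ℝ≥0∞) ^ 4 * T) T M = S ∧
      (S : ℝ) * (1 - (p : ℝ) ^ 16 * (T : ℝ) ^ 8) = segreFactor (p : ℝ) (T : ℝ) := by
  have hp1 : (1 : ℝ) ≤ p := by exact_mod_cast hp.out.one_lt.le
  have hlt : ∀ a b : ℕ, a ≤ 3 * b → b ≠ 0 → (p : ℝ) ^ a * (T : ℝ) ^ b < 1 := fun a b =>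
    pow_mul_pow_lt_one hp1 T.coe_nonneg hT
  have hlt' : ∀ (a b : ℕ) (z : ℝ≥0∞), z = (p : ℝ≥0∞) ^ a * (T : ℝ≥0∞) ^ b → a ≤ 3 * b → b ≠ 0 →
      z < 1 := by
    intro a b z hz hab hb
    have := hlt a b hab hb
    rw [hz]
    exact_mod_cast this
  have hne : ∀ a b : ℕ, a ≤ 3 * b → b ≠ 0 → 1 - (p : ℝ) ^ a * (T : ℝ) ^ b ≠ 0 := fun a b h1 h2 =>
    (sub_pos.2 (hlt a b h1 h2)).ne'
  obtain ⟨L, R, F₁, F₂, F₃, F₄, ⟨tL, tR, t1, t2, t3, t4⟩, hL, hR, h1, h2, h3, h4, hS⟩ :=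
    exists_totals (p := p) ((p : ℝ≥0∞) ^ 4 * T) T
      -- With u = p⁴ T and t = T the diagonal coefficients are Y₁, Y₂, X₁, X₂, X₃ and p¹⁶ T⁸, all of
      -- the form p ^ a T ^ b with a ≤ 3 b.
      (hlt' 6 3 _ (by ring) (by norm_num) (by norm_num))
      (hlt' 9 5 _ (by ring) (by norm_num) (by norm_num))
      (hlt' 7 5 _ (by ring) (by norm_num) (by norm_num))
      (hlt' 12 6 _ (by ring) (by norm_num) (by norm_num))
      (hlt' 15 7 _ (by ring) (by norm_num) (by norm_num))
      (hlt' 16 8 _ (by ring) (by norm_num) (by norm_num))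
      (ENNReal.mul_ne_top (ENNReal.pow_ne_top (ENNReal.natCast_ne_top p)) ENNReal.coe_ne_top)
      ENNReal.coe_ne_top
  lift L to ℝ≥0 using tL
  lift R to ℝ≥0 using tR
  lift F₁ to ℝ≥0 using t1
  lift F₂ to ℝ≥0 using t2
  lift F₃ to ℝ≥0 using t3
  lift F₄ to ℝ≥0 using t4
  refine ⟨1 + (F₁ + L) + (F₂ + 2 * R) + F₃ + F₄, by rw [hS]; push_cast; rfl, ?_⟩
  push_cast
  refine solve_totals (by positivity) (hne _ _ (by norm_num) (by norm_num))
    (hne _ _ (by norm_num) (by norm_num)) (hne _ _ (by norm_num) (by norm_num))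
    (hne _ _ (by norm_num) (by norm_num)) (hne _ _ (by norm_num) (by norm_num)) ?_ ?_ ?_ ?_ ?_ ?_
  · exact_mod_cast hL
  · exact_mod_cast hR
  · exact_mod_cast h1
  · exact_mod_cast h2
  · exact_mod_cast h3
  · exact_mod_cast h4

end real

/-! ### Normal subgroups of the group of triples -/

section heisenberg

open Matrix

/-- The group of triples `(a, b, y)` with product
`(a, b, y) (a', b', y') = (a + a', b + b', y + y' + a ⊗ b')`. -/
@[ext]
structure TensorHeisenberg where
  /-- The first coordinate. -/
  a : Fin 2 → ℤ
  /-- The second coordinate. -/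
  b : Fin 2 → ℤ
  /-- The central coordinate. -/
  y : Matrix (Fin 2) (Fin 2) ℤ

namespace TensorHeisenberg

instance : Mul TensorHeisenberg :=
  ⟨fun g h => ⟨g.a + h.a, g.b + h.b, g.y + h.y + vecMulVec g.a h.b⟩⟩

instance : One TensorHeisenberg := ⟨⟨0, 0, 0⟩⟩

instance : Inv TensorHeisenberg := ⟨fun g => ⟨-g.a, -g.b, -g.y + vecMulVec g.a g.b⟩⟩

theorem mul_def (g h : TensorHeisenberg) :
    g * h = ⟨g.a + h.a, g.b + h.b, g.y + h.y + vecMulVec g.a h.b⟩ := rfl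

theorem one_def : (1 : TensorHeisenberg) = ⟨0, 0, 0⟩ := rfl

theorem inv_def (g : TensorHeisenberg) : g⁻¹ = ⟨-g.a, -g.b, -g.y + vecMulVec g.a g.b⟩ := rfl

instance : Group TensorHeisenberg :=
  Group.ofLeftAxioms
    (fun g h k => by
      simp only [mul_def, add_assoc, add_vecMulVec, vecMulVec_add]
      congr 1
      abel)
    (fun g => by simp [mul_def, one_def])
    (fun g => by simp [mul_def, one_def, inv_def, neg_vecMulVec])

theorem commutator_def (g h : TensorHeisenberg) :
    ⁅g, h⁆ = ⟨0, 0, vecMulVec g.a h.b - vecMulVec h.a g.b⟩ := by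
  rw [commutatorElement_def]
  simp only [mul_def, inv_def, add_vecMulVec, neg_vecMulVec, vecMulVec_neg]
  ext1
  · simp
  · simp
  · dsimp only
    abel

/-- The underlying triple. -/
def toProd : TensorHeisenberg ≃
    ((Fin 2 → ℤ) × (Fin 2 → ℤ)) × Matrix (Fin 2) (Fin 2) ℤ where
  toFun g := ((g.a, g.b), g.y)
  invFun z := ⟨z.1.1, z.1.2, z.2⟩
  left_inv _ := rfl
  right_inv _ := rfl

/-- The additive subgroups whose elements are the elements of normal subgroups. -/
def IsIdeal (K : AddSubgroup (((Fin 2 → ℤ) × (Fin 2 → ℤ)) × Matrix (Fin 2) (Fin 2) ℤ)) : Prop :=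
  K.map (AddMonoidHom.fst _ _) ≤ (leftKer (K.comap (AddMonoidHom.inr _ _))).prod
    (rightKer (K.comap (AddMonoidHom.inr _ _)))

variable {K : AddSubgroup (((Fin 2 → ℤ) × (Fin 2 → ℤ)) × Matrix (Fin 2) (Fin 2) ℤ)}

theorem isIdeal_iff : IsIdeal K ↔ ∀ z ∈ K, (∀ r, ((0, vecMulVec z.1.1 r) :
      ((Fin 2 → ℤ) × (Fin 2 → ℤ)) × Matrix (Fin 2) (Fin 2) ℤ) ∈ K) ∧
    ∀ v, ((0, vecMulVec v z.1.2) :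
      ((Fin 2 → ℤ) × (Fin 2 → ℤ)) × Matrix (Fin 2) (Fin 2) ℤ) ∈ K := by
  constructor
  · intro h z hz
    have := h ⟨z, hz, rfl⟩
    rw [AddSubgroup.mem_prod] at this
    exact ⟨fun r => mem_leftKer.1 this.1 r, fun v => mem_rightKer.1 this.2 v⟩
  · rintro h _ ⟨z, hz, rfl⟩
    rw [AddSubgroup.mem_prod]
    exact ⟨mem_leftKer.2 fun r => (h z hz).1 r, mem_rightKer.2 fun v => (h z hz).2 v⟩

theorem mk_add_mem_iff (z)
    {m : Matrix (Fin 2) (Fin 2) ℤ} (hm : (0, m) ∈ K) : (z.1, z.2 + m) ∈ K ↔ z ∈ K := by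
  have h : ((z.1, z.2 + m) : ((Fin 2 → ℤ) × (Fin 2 → ℤ)) × Matrix (Fin 2) (Fin 2) ℤ) =
      z + (0, m) := by ext <;> simp
  rw [h]
  exact AddSubgroup.add_mem_cancel_right K hm

/-- Product and sum differ by the central element a ⊗ b', which lies in K because b' comes from an
element of K. -/
theorem toProd_mul_mem_iff (hK : IsIdeal K) {g h : TensorHeisenberg}
    (hh : toProd h ∈ K) : toProd (g * h) ∈ K ↔ toProd g + toProd h ∈ K :=
  mk_add_mem_iff (toProd g + toProd h) ((isIdeal_iff.1 hK _ hh).2 g.a)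

/-- The normal subgroup with the same elements as `K`. -/
def ofIdeal (hK : IsIdeal K) : Subgroup TensorHeisenberg where
  carrier := {g | toProd g ∈ K}
  one_mem' := K.zero_mem
  mul_mem' hg hh := (toProd_mul_mem_iff hK hh).2 (K.add_mem hg hh)
  inv_mem' {g} hg := (mk_add_mem_iff (-toProd g) ((isIdeal_iff.1 hK _ hg).1 g.b)).2 (K.neg_mem hg)

theorem mem_ofIdeal (hK : IsIdeal K) {g : TensorHeisenberg} : g ∈ ofIdeal hK ↔ toProd g ∈ K :=
  Iff.rfl

theorem ofIdeal_normal (hK : IsIdeal K) : (ofIdeal hK).Normal where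
  conj_mem n hn g := by
    have h1 : g * n * g⁻¹ = ⁅g, n⁆ * n := by rw [commutatorElement_def]; group
    rw [h1]
    refine Subgroup.mul_mem _ ?_ hn
    rw [mem_ofIdeal, commutator_def]
    have h2 := (isIdeal_iff.1 hK _ hn).2 g.a
    have h3 := (isIdeal_iff.1 hK _ hn).1 g.b
    have := K.sub_mem h2 h3
    rwa [Prod.mk_sub_mk, sub_zero] at this

theorem index_ofIdeal (hK : IsIdeal K) : (ofIdeal hK).index = K.index := by
  rw [Subgroup.index_eq_card, AddSubgroup.index_eq_card]
  refine Nat.card_congr (Quotient.congr toProd fun g h => ?_)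
  rw [QuotientGroup.leftRel_apply, QuotientAddGroup.leftRel_apply, mem_ofIdeal]
  -- The two differences of g and h have the same b-coordinate and differ by a tensor with it, so
  -- multiplicative and additive cosets coincide.
  have key : toProd (g⁻¹ * h) = ((-toProd g + toProd h).1, (-toProd g + toProd h).2 +
      vecMulVec (-g.a) (-g.b + h.b)) := by
    refine Prod.ext rfl ?_
    change -g.y + vecMulVec g.a g.b + h.y + vecMulVec (-g.a) h.b =
      -g.y + h.y + vecMulVec (-g.a) (-g.b + h.b)
    simp only [vecMulVec_add, neg_vecMulVec, vecMulVec_neg, neg_neg]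
    abel
  have hb : ((-toProd g + toProd h).1.2 : Fin 2 → ℤ) = -g.b + h.b := rfl
  constructor
  · intro hmem
    have h2 := (isIdeal_iff.1 hK _ hmem).2 (-g.a)
    rw [key] at hmem
    exact (mk_add_mem_iff _ h2).1 hmem
  · intro hmem
    have h2 := (isIdeal_iff.1 hK _ hmem).2 (-g.a)
    rw [key]
    exact (mk_add_mem_iff _ h2).2 hmem

theorem exists_ofIdeal_eq (H : Subgroup TensorHeisenberg) (hH : H.Normal) :
    ∃ (K : _) (hK : IsIdeal K), ofIdeal hK = H := by
  have hc : ∀ g h, (g ∈ H ∨ h ∈ H) → ⁅g, h⁆ ∈ H := by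
    rintro g h (hg | hh)
    · rw [commutatorElement_def, mul_assoc, mul_assoc, ← mul_assoc h]
      exact H.mul_mem hg (hH.conj_mem _ (H.inv_mem hg) _)
    · rw [commutatorElement_def]
      exact H.mul_mem (hH.conj_mem _ hh _) (H.inv_mem hh)
  have hl : ∀ g ∈ H, ∀ r, (⟨0, 0, vecMulVec g.a r⟩ : TensorHeisenberg) ∈ H := by
    intro g hg r
    -- Commutators with (0, r, 0) and (v, 0, 0) isolate the tensors a ⊗ r and v ⊗ b.
    have := hc g ⟨0, r, 0⟩ (Or.inl hg)
    rw [commutator_def] at this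
    simpa using this
  have hr : ∀ g ∈ H, ∀ v, (⟨0, 0, vecMulVec v g.b⟩ : TensorHeisenberg) ∈ H := by
    intro g hg v
    have := hc ⟨v, 0, 0⟩ g (Or.inr hg)
    rw [commutator_def] at this
    simpa using this
  have hy : ∀ g : TensorHeisenberg, ∀ m, (⟨0, 0, m⟩ : TensorHeisenberg) ∈ H →
      ((⟨g.a, g.b, g.y + m⟩ : TensorHeisenberg) ∈ H ↔ g ∈ H) := by
    intro g m hm
    have h1 : (⟨g.a, g.b, g.y + m⟩ : TensorHeisenberg) = g * ⟨0, 0, m⟩ := by simp [mul_def]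
    rw [h1]
    exact Subgroup.mul_mem_cancel_right H hm
  let K : AddSubgroup (((Fin 2 → ℤ) × (Fin 2 → ℤ)) × Matrix (Fin 2) (Fin 2) ℤ) :=
    { carrier := {z | toProd.symm z ∈ H}
      zero_mem' := H.one_mem
      add_mem' := fun {z w} hz hw =>
        (hy (toProd.symm (z + w)) _ (hr _ hw z.1.1)).1 (H.mul_mem hz hw)
      neg_mem' := fun {z} hz =>
        (hy (toProd.symm (-z)) _ (hl _ hz z.1.2)).1 (H.inv_mem hz) }
  have hK : IsIdeal K := isIdeal_iff.2 fun z hz => ⟨fun r => hl _ hz r, fun v => hr _ hz v⟩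
  exact ⟨K, hK, rfl⟩

open Classical in
theorem tsum_normal (w : ℕ → ℝ≥0∞) :
    ∑' H : {H : Subgroup TensorHeisenberg // H.Normal}, w H.1.index =
      ∑' K, if IsIdeal K then w K.index else 0 := by
  let f : {K // IsIdeal K} → {H : Subgroup TensorHeisenberg // H.Normal} := fun K =>
    ⟨ofIdeal K.2, ofIdeal_normal K.2⟩
  have hf : Function.Bijective f := by
    constructor
    · rintro ⟨K, hK⟩ ⟨K', hK'⟩ h
      refine Subtype.ext (AddSubgroup.ext fun z => ?_)
      have h1 : ofIdeal hK = ofIdeal hK' := congrArg Subtype.val h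
      exact SetLike.ext_iff.1 h1 (toProd.symm z)
    · rintro ⟨H, hH⟩
      obtain ⟨K, hK, rfl⟩ := exists_ofIdeal_eq H hH
      exact ⟨⟨K, hK⟩, rfl⟩
  rw [← (Equiv.ofBijective f hf).tsum_eq]
  have h1 : ∀ K : {K // IsIdeal K}, w ((Equiv.ofBijective f hf) K).1.index = w K.1.index :=
    fun K => congrArg w (index_ofIdeal K.2)
  simp_rw [h1]
  refine (tsum_subtype {K | IsIdeal K} fun K => w K.index).trans ?_
  rfl

end TensorHeisenberg

end heisenberg

/-! ### Factorisation of the normal zeta function -/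

section normalZeta

variable {p : ℕ} [hp : Fact p.Prime]

/-- The local normal zeta function of a group, as a sum over normal subgroups. -/
noncomputable def normalZeta (p : ℕ) (x : ℝ≥0∞) (G : Type*) [Group G] : ℝ≥0∞ :=
  ∑' H : {H : Subgroup G // H.Normal}, ppWeight p x H.1.index

open Classical in
theorem tsum_le_ppWeight {X : Type*} [AddCommGroup X] (N : AddSubgroup X) (x : ℝ≥0∞) :
    ∑' L : AddSubgroup X, (if L ≤ N then ppWeight p x L.index else 0) =
      ppWeight p x N.index * latticeZeta p x N := by
  rw [latticeZeta, ← ENNReal.tsum_mul_left,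
    ← (AddSubgroup.map_injective N.subtype_injective).tsum_eq]
  · refine tsum_congr fun L => ?_
    rw [if_pos (AddSubgroup.map_subtype_le L), AddSubgroup.index_map_subtype, ppWeight_mul,
      mul_comm]
  · intro L hL
    rw [Function.mem_support, ne_eq, ite_eq_right_iff, not_forall] at hL
    exact ⟨L.addSubgroupOf N, by
      rw [AddSubgroup.addSubgroupOf_map_subtype, inf_eq_left.2 hL.1]⟩

/-- For fixed M the homomorphisms L → Y / M contribute |Y / M|⁴, turning x into p⁴ x for the index
of M. The L range over the subgroups of A × B, which contribute the weights of A and B times the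
zeta function of ℤ⁴. -/
theorem normalZeta_tensorHeisenberg (x : ℝ≥0∞) :
    normalZeta p x TensorHeisenberg =
      latticeZeta p x (Fin 4 → ℤ) * ∑' M, segreWeight p ((p : ℝ≥0∞) ^ 4 * x) x M := by
  classical
  let e : ((Fin 2 → ℤ) × (Fin 2 → ℤ)) ≃+ (Fin 4 → ℤ) :=
    { toFun := fun v => ![v.1 0, v.1 1, v.2 0, v.2 1]
      invFun := fun v => (![v 0, v 1], ![v 2, v 3])
      left_inv := fun v => by ext i <;> fin_cases i <;> rfl
      right_inv := fun v => by ext i; fin_cases i <;> rfl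
      map_add' := fun v w => by ext i; fin_cases i <;> rfl }
  rw [normalZeta, TensorHeisenberg.tsum_normal, tsum_addSubgroup_prod, ← ENNReal.tsum_mul_left]
  refine tsum_congr fun M => ?_
  simp_rw [TensorHeisenberg.IsIdeal, map_fst_graphSubgroup, comap_inr_graphSubgroup,
    index_graphSubgroup, ppWeight_mul]
  have h1 : ∀ L : AddSubgroup ((Fin 2 → ℤ) × (Fin 2 → ℤ)),
      ∑' _ : L →+ Matrix (Fin 2) (Fin 2) ℤ ⧸ M, (if L ≤ (leftKer M).prod (rightKer M) then
        ppWeight p x L.index * ppWeight p x M.index else 0) =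
      (if L ≤ (leftKer M).prod (rightKer M) then ppWeight p x L.index else 0) *
        ppWeight p ((p : ℝ≥0∞) ^ 4 * x) M.index := by
    intro L
    split_ifs
    · exact tsum_hom_mul_ppWeight e L M x x
    · simp
  simp_rw [h1]
  rw [ENNReal.tsum_mul_right, tsum_le_ppWeight, AddSubgroup.index_prod, ppWeight_mul, segreWeight]
  -- If A × B has infinite index both sides vanish; otherwise A × B ≅ ℤ⁴.
  by_cases h0 : ((leftKer M).prod (rightKer M)).index = 0
  · have : ppWeight p x (leftKer M).index * ppWeight p x (rightKer M).index = 0 := by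
      rw [← ppWeight_mul, ← AddSubgroup.index_prod, h0, ppWeight_zero]
    rw [this]
    simp
  · obtain ⟨e'⟩ := nonempty_addEquiv_of_index_ne_zero e _ h0
    rw [latticeZeta_congr e']
    ring

omit hp in
theorem normalZeta_congr {G H : Type*} [Group G] [Group H] (e : G ≃* H) (x : ℝ≥0∞) :
    normalZeta p x G = normalZeta p x H := by
  let f : {N : Subgroup G // N.Normal} ≃ {N : Subgroup H // N.Normal} :=
    e.mapSubgroup.toEquiv.subtypeEquiv fun N => by
      change N.Normal ↔ (N.map e.toMonoidHom).Normal
      exact ⟨fun h => h.map _ e.surjective, fun h => by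
        have h2 := h.comap e.toMonoidHom
        rwa [Subgroup.comap_map_eq_self_of_injective e.injective] at h2⟩
  rw [normalZeta, normalZeta, ← f.tsum_eq]
  refine tsum_congr fun N => ?_
  congr 1
  exact (Subgroup.index_map_equiv N.1 e).symm

omit hp in
theorem normalZeta_multiplicative {X : Type*} [AddCommGroup X] (x : ℝ≥0∞) :
    normalZeta p x (Multiplicative X) = latticeZeta p x X := by
  let f : AddSubgroup X ≃ {N : Subgroup (Multiplicative X) // N.Normal} :=
    AddSubgroup.toSubgroup.toEquiv.trans
      (Equiv.subtypeUnivEquiv (p := fun N : Subgroup (Multiplicative X) => N.Normal)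
        fun _ => inferInstance).symm
  rw [normalZeta, latticeZeta, ← f.tsum_eq]
  rfl

end normalZeta

/-! ### The presented group is the group of triples -/

section presentation

open Matrix

/-- The images of the generators of `SegreGroup`. -/
def segreGenerator : Fin 4 ⊕ Fin 4 → TensorHeisenberg :=
  Sum.elim ![⟨![1, 0], 0, 0⟩, ⟨![0, 1], 0, 0⟩, ⟨0, ![1, 0], 0⟩, ⟨0, ![0, 1], 0⟩]
    fun k => ⟨0, 0, matrixTwoEquiv.symm (Pi.single k 1)⟩

/-- The central elements as the values of a homomorphism. -/
def centralHom : Multiplicative (Matrix (Fin 2) (Fin 2) ℤ) →* TensorHeisenberg where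
  toFun y := ⟨0, 0, y.toAdd⟩
  map_one' := rfl
  map_mul' y z := by simp [TensorHeisenberg.mul_def]

theorem segreGenerator_relation (r : FreeGroup (Fin 4 ⊕ Fin 4))
    (hr : r ∈ classTwoRelations segreMatrix) : FreeGroup.lift segreGenerator r = 1 := by
  rcases hr with ⟨i, j, rfl⟩ | ⟨k, a, rfl⟩
  -- As values of a homomorphism the central generators are multiplied additively, leaving finitely
  -- many entries to compare.
  · have hz : ∀ k : Fin 4, segreGenerator (Sum.inr k) =
        centralHom (Multiplicative.ofAdd (matrixTwoEquiv.symm (Pi.single k 1))) := fun _ => rfl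
    rw [map_mul, map_commutatorElement, map_inv, mul_inv_eq_one, map_list_prod, List.map_ofFn]
    simp only [FreeGroup.lift_apply_of, Function.comp_def, map_zpow, hz]
    simp only [List.ofFn_succ, List.ofFn_zero, List.prod_cons, List.prod_nil, mul_one,
      ← map_zpow, ← map_mul, ← ofAdd_zsmul, ← ofAdd_add]
    rw [TensorHeisenberg.commutator_def]
    refine TensorHeisenberg.ext rfl rfl ?_
    change _ = Multiplicative.toAdd (Multiplicative.ofAdd _)
    rw [toAdd_ofAdd]
    fin_cases i <;> fin_cases j <;> ext x y <;> fin_cases x <;> fin_cases y <;> decide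
  · rw [map_commutatorElement, FreeGroup.lift_apply_of, FreeGroup.lift_apply_of,
      TensorHeisenberg.commutator_def]
    simp [segreGenerator, TensorHeisenberg.one_def]

/-- The homomorphism from the presented group to the concrete one. -/
def segreHom : SegreGroup →* TensorHeisenberg := PresentedGroup.toGroup segreGenerator_relation

/-- The generators `x_i`. -/
def segreGenX (i : Fin 4) : SegreGroup := PresentedGroup.of (Sum.inl i)

/-- The generators `y_k`. -/
def segreGenY (k : Fin 4) : SegreGroup := PresentedGroup.of (Sum.inr k)

theorem segreGenY_commute (k : Fin 4) (g : SegreGroup) : Commute (segreGenY k) g := by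
  have h : ∀ a, Commute (segreGenY k) (PresentedGroup.of a) := fun a => by
    have := PresentedGroup.one_of_mem (rels := classTwoRelations segreMatrix)
      (Or.inr ⟨k, a, rfl⟩)
    rw [map_commutatorElement] at this
    exact commutatorElement_eq_one_iff_commute.1 this
  have hg : g ∈ Subgroup.closure (Set.range (PresentedGroup.of
      (rels := classTwoRelations segreMatrix))) := by
    rw [PresentedGroup.closure_range_of]
    exact Subgroup.mem_top g
  induction hg using Subgroup.closure_induction with
  | mem x hx =>
    obtain ⟨a, rfl⟩ := hx
    exact h a
  | one => exact Commute.one_right _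
  | mul x y _ _ hx hy => exact hx.mul_right hy
  | inv x _ hx => exact hx.inv_right

theorem segreGenX_commutator (i j : Fin 4) : ⁅segreGenX i, segreGenX j⁆ =
    (List.ofFn fun k => segreGenY k ^ segreMatrix i j k).prod := by
  have := PresentedGroup.one_of_mem (rels := classTwoRelations segreMatrix)
    (Or.inl ⟨i, j, rfl⟩)
  rw [map_mul, map_commutatorElement, map_inv, mul_inv_eq_one, map_list_prod, List.map_ofFn] at this
  simp only [Function.comp_def, map_zpow] at this
  exact this

/-- The central part of an element. -/
def segreCentral (y : Matrix (Fin 2) (Fin 2) ℤ) : SegreGroup :=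
  segreGenY 0 ^ y 0 0 * segreGenY 1 ^ y 0 1 * segreGenY 2 ^ y 1 0 * segreGenY 3 ^ y 1 1

/-- The part of an element in the first two generators. -/
def segreLeft (a : Fin 2 → ℤ) : SegreGroup := segreGenX 0 ^ a 0 * segreGenX 1 ^ a 1

/-- The part of an element in the last two generators. -/
def segreRight (b : Fin 2 → ℤ) : SegreGroup := segreGenX 2 ^ b 0 * segreGenX 3 ^ b 1

theorem segreCentral_commute (y : Matrix (Fin 2) (Fin 2) ℤ) (g : SegreGroup) :
    Commute (segreCentral y) g := by
  have h := fun k (n : ℤ) => (segreGenY_commute k g).zpow_left n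
  exact (((h _ _).mul_left (h _ _)).mul_left (h _ _)).mul_left (h _ _)

theorem zpow_mul_zpow_add {G : Type*} [Group G] {x y : G} (h : Commute x y) (a b c d : ℤ) :
    x ^ (a + c) * y ^ (b + d) = x ^ a * y ^ b * (x ^ c * y ^ d) := by
  rw [_root_.zpow_add, _root_.zpow_add, mul_assoc, mul_assoc, ← mul_assoc (x ^ c), ← mul_assoc (y ^ b),
    (h.zpow_zpow c b).eq]

theorem mul_zpow_mul_mul_zpow {G : Type*} [Group G] {c : G} (h : ∀ g, Commute c g) (g k : G)
    (m n : ℤ) : g * c ^ m * (k * c ^ n) = g * k * c ^ (m + n) := by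
  rw [_root_.zpow_add, mul_assoc, ← mul_assoc (c ^ m), ((h k).zpow_left m).eq]
  simp only [mul_assoc]

theorem segreCentral_add (y z : Matrix (Fin 2) (Fin 2) ℤ) :
    segreCentral (y + z) = segreCentral y * segreCentral z := by
  simp only [segreCentral]
  rw [mul_zpow_mul_mul_zpow (segreGenY_commute 3), mul_zpow_mul_mul_zpow (segreGenY_commute 2),
    mul_zpow_mul_mul_zpow (segreGenY_commute 1), ← _root_.zpow_add]
  rfl

theorem segreLeft_add (a c : Fin 2 → ℤ) : segreLeft (a + c) = segreLeft a * segreLeft c := by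
  refine zpow_mul_zpow_add (commutatorElement_eq_one_iff_commute.1 ?_) _ _ _ _
  rw [segreGenX_commutator]
  simp [segreMatrix]

theorem segreRight_add (b d : Fin 2 → ℤ) : segreRight (b + d) = segreRight b * segreRight d := by
  refine zpow_mul_zpow_add (commutatorElement_eq_one_iff_commute.1 ?_) _ _ _ _
  rw [segreGenX_commutator]
  simp [segreMatrix]

/-- A central commutator is bilinear. Conjugation by z gives linearity in m; the same argument with
z, x ^ m and c ^ (-m) gives linearity in n. -/
theorem zpow_mul_zpow_eq {G : Type*} [Group G] {x z c : G} (h : x * z = c * (z * x))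
    (hc : ∀ g, Commute c g) (m n : ℤ) : x ^ m * z ^ n = c ^ (m * n) * (z ^ n * x ^ m) := by
  have key : ∀ {x z c : G}, x * z = c * (z * x) → (∀ g, Commute c g) → ∀ m : ℤ,
      x ^ m * z = c ^ m * (z * x ^ m) := by
    intro x z c h hc m
    have h1 : z⁻¹ * x * z = c * x := by
      rw [mul_assoc, h, ← mul_assoc, ← (hc z⁻¹).eq]
      group
    have h2 : z⁻¹ * x ^ m * z = c ^ m * x ^ m := by
      have := conj_zpow (i := m) (a := z⁻¹) (b := x)
      rw [inv_inv, h1, (hc x).mul_zpow] at this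
      exact this.symm
    rw [← mul_assoc, ((hc z).zpow_left m).eq, mul_assoc, ← h2]
    group
  have h1 := key h hc m
  have h2 : z * x ^ m = c ^ (-m) * (x ^ m * z) := by
    rw [h1, ← mul_assoc, ← _root_.zpow_add, neg_add_cancel, _root_.zpow_zero, one_mul]
  have h3 := key h2 (fun g => (hc g).zpow_left _) n
  rw [h3, ← mul_assoc, ← _root_.zpow_mul, ← _root_.zpow_add]
  simp

theorem mul_mul_mul_eq_of_central {G : Type*} [Group G] {A B C D c₁ c₂ c₃ c₄ : G}
    (h₁ : A * C = c₁ * (C * A)) (h₂ : A * D = c₂ * (D * A)) (h₃ : B * C = c₃ * (C * B))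
    (h₄ : B * D = c₄ * (D * B)) (k₂ : ∀ g, Commute c₂ g)
    (k₃ : ∀ g, Commute c₃ g) (k₄ : ∀ g, Commute c₄ g) :
    A * B * (C * D) = c₁ * c₂ * c₃ * c₄ * (C * D * (A * B)) := by
  calc A * B * (C * D) = A * (B * C) * D := by simp only [mul_assoc]
    _ = A * c₃ * (C * (B * D)) := by rw [h₃]; simp only [mul_assoc]
    _ = c₃ * (A * C) * (B * D) := by rw [← (k₃ A).eq]; simp only [mul_assoc]
    _ = c₃ * (c₁ * (C * A) * c₄) * (D * B) := by rw [h₁, h₄]; simp only [mul_assoc]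
    _ = c₃ * (c₄ * (c₁ * (C * A))) * (D * B) := by rw [← (k₄ _).eq]
    _ = c₃ * c₄ * c₁ * C * (A * D) * B := by simp only [mul_assoc]
    _ = c₃ * c₄ * c₁ * (C * c₂) * (D * (A * B)) := by rw [h₂]; simp only [mul_assoc]
    _ = c₃ * (c₄ * (c₁ * c₂)) * (C * D * (A * B)) := by
      rw [← (k₂ C).eq]; simp only [mul_assoc]
    _ = c₁ * c₂ * c₃ * c₄ * (C * D * (A * B)) := by
      rw [(k₄ _).eq, (k₃ _).eq]
      simp only [mul_assoc]
      rw [← mul_assoc c₄, (k₄ c₃).eq]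
      simp only [mul_assoc]

theorem segreLeft_mul_segreRight (a b : Fin 2 → ℤ) : segreLeft a * segreRight b =
    segreCentral (vecMulVec a b) * (segreRight b * segreLeft a) := by
  have h : ∀ i j k : Fin 4, ⁅segreGenX i, segreGenX j⁆ = segreGenY k → ∀ m n : ℤ,
      segreGenX i ^ m * segreGenX j ^ n =
        segreGenY k ^ (m * n) * (segreGenX j ^ n * segreGenX i ^ m) := fun i j k hk m n => by
    refine zpow_mul_zpow_eq ?_ (segreGenY_commute k) m n
    rw [← hk, commutatorElement_def]
    group
  have hc := fun k (n : ℤ) g => (segreGenY_commute k g).zpow_left n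
  exact mul_mul_mul_eq_of_central
    (h 0 2 0 (by rw [segreGenX_commutator]; simp [segreMatrix, yForm, List.ofFn_succ]) _ _)
    (h 0 3 1 (by rw [segreGenX_commutator]; simp [segreMatrix, yForm, List.ofFn_succ]) _ _)
    (h 1 2 2 (by rw [segreGenX_commutator]; simp [segreMatrix, yForm, List.ofFn_succ]) _ _)
    (h 1 3 3 (by rw [segreGenX_commutator]; simp [segreMatrix, yForm, List.ofFn_succ]) _ _)
    (hc _ _) (hc _ _) (hc _ _)

/-- The inverse of `segreHom`. -/
def segreInv : TensorHeisenberg →* SegreGroup where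
  -- In this order the triple can be read off: (0, b, 0) (a, 0, 0) produces no tensor, unlike the
  -- opposite order.
  toFun g := segreCentral g.y * (segreRight g.b * segreLeft g.a)
  map_one' := by simp [TensorHeisenberg.one_def, segreCentral, segreRight, segreLeft]
  map_mul' g h := by
    simp only [TensorHeisenberg.mul_def, segreCentral_add, segreRight_add, segreLeft_add]
    have hc := segreCentral_commute
    have h1 := segreLeft_mul_segreRight g.a h.b
    calc segreCentral g.y * segreCentral h.y * segreCentral (vecMulVec g.a h.b) *
          (segreRight g.b * segreRight h.b * (segreLeft g.a * segreLeft h.a))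
        = segreCentral g.y * (segreCentral h.y * (segreCentral (vecMulVec g.a h.b) *
          segreRight g.b) * (segreRight h.b * segreLeft g.a)) * segreLeft h.a := by
          simp only [mul_assoc]
      _ = segreCentral g.y * (segreCentral h.y * segreRight g.b *
          (segreCentral (vecMulVec g.a h.b) * (segreRight h.b * segreLeft g.a))) *
            segreLeft h.a := by
          rw [(hc (vecMulVec g.a h.b) _).eq]; simp only [mul_assoc]
      _ = segreCentral g.y * (segreCentral h.y * (segreRight g.b * segreLeft g.a)) *
          (segreRight h.b * segreLeft h.a) := by
          rw [← h1]; simp only [mul_assoc]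
      _ = _ := by rw [(hc h.y _).eq]; simp only [mul_assoc]

theorem segreInv_segreGenerator (s : Fin 4 ⊕ Fin 4) :
    segreInv (segreGenerator s) = PresentedGroup.of s := by
  rcases s with i | k
  · change segreCentral _ * (segreRight _ * segreLeft _) = segreGenX i
    fin_cases i <;> simp [segreGenerator, segreCentral, segreRight, segreLeft]
  · change segreCentral _ * (segreRight _ * segreLeft _) = segreGenY k
    fin_cases k <;> simp [segreGenerator, segreCentral, segreRight, segreLeft, matrixTwoEquiv]

/-- The elements `(a, 0, 0)` as the values of a homomorphism. -/
def leftHom : Multiplicative (Fin 2 → ℤ) →* TensorHeisenberg where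
  toFun a := ⟨a.toAdd, 0, 0⟩
  map_one' := rfl
  map_mul' y z := by simp [TensorHeisenberg.mul_def]

/-- The elements `(0, b, 0)` as the values of a homomorphism. -/
def rightHom : Multiplicative (Fin 2 → ℤ) →* TensorHeisenberg where
  toFun b := ⟨0, b.toAdd, 0⟩
  map_one' := rfl
  map_mul' y z := by simp [TensorHeisenberg.mul_def]

theorem segreHom_segreInv (g : TensorHeisenberg) : segreHom (segreInv g) = g := by
  have hX : ∀ i, segreHom (segreGenX i) = segreGenerator (Sum.inl i) := fun i =>
    PresentedGroup.toGroup.of segreGenerator_relation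
  have hY : ∀ k, segreHom (segreGenY k) =
      centralHom (Multiplicative.ofAdd (matrixTwoEquiv.symm (Pi.single k 1))) := fun k =>
    PresentedGroup.toGroup.of segreGenerator_relation
  have h0 : segreHom (segreGenX 0) = leftHom (Multiplicative.ofAdd ![1, 0]) := hX 0
  have h1 : segreHom (segreGenX 1) = leftHom (Multiplicative.ofAdd ![0, 1]) := hX 1
  have h2 : segreHom (segreGenX 2) = rightHom (Multiplicative.ofAdd ![1, 0]) := hX 2
  have h3 : segreHom (segreGenX 3) = rightHom (Multiplicative.ofAdd ![0, 1]) := hX 3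
  have hl : segreHom (segreLeft g.a) = ⟨g.a, 0, 0⟩ := by
    rw [segreLeft, map_mul, map_zpow, map_zpow, h0, h1, ← map_zpow leftHom, ← map_zpow leftHom,
      ← map_mul leftHom, ← ofAdd_zsmul, ← ofAdd_zsmul, ← ofAdd_add]
    refine TensorHeisenberg.ext ?_ rfl rfl
    ext i
    fin_cases i <;> simp [leftHom]
  have hr : segreHom (segreRight g.b) = ⟨0, g.b, 0⟩ := by
    rw [segreRight, map_mul, map_zpow, map_zpow, h2, h3, ← map_zpow rightHom, ← map_zpow rightHom,
      ← map_mul rightHom, ← ofAdd_zsmul, ← ofAdd_zsmul, ← ofAdd_add]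
    refine TensorHeisenberg.ext rfl ?_ rfl
    ext i
    fin_cases i <;> simp [rightHom]
  have hc : segreHom (segreCentral g.y) = ⟨0, 0, g.y⟩ := by
    simp only [segreCentral, map_mul, map_zpow, hY]
    simp only [← map_zpow, ← map_mul, ← ofAdd_zsmul, ← ofAdd_add]
    refine TensorHeisenberg.ext rfl rfl ?_
    ext i j
    fin_cases i <;> fin_cases j <;> simp [centralHom, matrixTwoEquiv]
  change segreHom (segreCentral g.y * (segreRight g.b * segreLeft g.a)) = g
  rw [map_mul, map_mul, hl, hr, hc]
  simp [TensorHeisenberg.mul_def]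

/-- The group `G_S` is the group of triples `(a, b, y)`. -/
noncomputable def segreEquiv : SegreGroup ≃* TensorHeisenberg :=
  MonoidHom.toMulEquiv segreHom segreInv
    (PresentedGroup.ext fun s => by
      rw [MonoidHom.comp_apply, MonoidHom.id_apply, segreHom, PresentedGroup.toGroup.of,
        segreInv_segreGenerator])
    (MonoidHom.ext segreHom_segreInv)

end presentation

/-! ### From positive real T to the complex disc -/

section dirichlet

open scoped NNReal Topology
open Filter

variable {p : ℕ} [Fact p.Prime]

theorem ppWeight_eq_tsum (x : ℝ≥0∞) (n : ℕ) :
    ppWeight p x n = ∑' k : ℕ, if n = p ^ k then x ^ k else 0 := by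
  by_cases h : ∃ k, n = p ^ k
  · obtain ⟨k, rfl⟩ := h
    rw [ppWeight_pow, tsum_eq_single k, if_pos rfl]
    intro j hj
    rw [if_neg]
    intro h
    exact hj (Nat.pow_right_injective (Fact.out : p.Prime).two_le h).symm
  · rw [ppWeight_of_not h]
    push Not at h
    simp [h]

/-- Extended cardinalities are used because finiteness of the coefficients is only deduced later
from finiteness of this sum. -/
theorem normalZeta_eq_tsum (G : Type*) [Group G] (x : ℝ≥0∞) :
    normalZeta p x G = ∑' k : ℕ, (normalSubgroupsOfIndex G (p ^ k)).encard * x ^ k := by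
  simp only [normalZeta, ppWeight_eq_tsum]
  rw [ENNReal.tsum_comm]
  refine tsum_congr fun k => ?_
  rw [← ENNReal.tsum_set_const, tsum_subtype (normalSubgroupsOfIndex G (p ^ k)) fun _ => x ^ k]
  refine (tsum_subtype {H : Subgroup G | H.Normal}
    fun H => if H.index = p ^ k then x ^ k else 0).trans (tsum_congr fun H => ?_)
  by_cases h : H.Normal <;> by_cases h' : H.index = p ^ k <;>
    simp [Set.indicator, normalSubgroupsOfIndex, h, h']

/-- If the normal zeta function of `G` at `p` agrees for small positive real `T = p ^ (-s)` with
a function that is holomorphic on a disc, then it agrees with it on the disc. -/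
theorem hasSum_normalSubgroupCount (G : Type*) [Group G] {r : ℝ} (hr : 0 < r) {R : ℂ → ℂ}
    (hR : DifferentiableOn ℂ R (Metric.ball 0 r))
    (h : ∀ T : ℝ≥0, 0 < T → (T : ℝ) < r → ∃ S : ℝ≥0, normalZeta p T G = S ∧ (S : ℂ) = R (T : ℝ)) :
    (∀ k, (normalSubgroupsOfIndex G (p ^ k)).Finite) ∧
      ∀ z ∈ Metric.ball (0 : ℂ) r,
        HasSum (fun k => (normalSubgroupCount G (p ^ k) : ℂ) * z ^ k) (R z) := by
  have hfin : ∀ k, (normalSubgroupsOfIndex G (p ^ k)).Finite := fun k => by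
    obtain ⟨T, hT0, hTr⟩ := exists_between
      (show (0 : ℝ≥0) < ⟨r, hr.le⟩ from hr)
    have hTr : (T : ℝ) < r := hTr
    obtain ⟨S, hS, -⟩ := h T hT0 hTr
    rw [normalZeta_eq_tsum] at hS
    -- One positive T with finite total suffices: an infinite coefficient times T ^ k ≠ 0 would be
    -- infinite.
    have h1 := ENNReal.ne_top_of_tsum_ne_top (hS.trans_ne ENNReal.coe_ne_top) k
    by_contra hi
    rw [Set.encard_eq_top_iff.2 hi] at h1
    have : (T : ℝ≥0∞) ^ k ≠ 0 := pow_ne_zero _ (by exact_mod_cast hT0.ne')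
    simp [ENNReal.top_mul this] at h1
  set a : ℕ → ℕ := fun k => normalSubgroupCount G (p ^ k) with ha
  have hreal : ∀ T : ℝ≥0, 0 < T → (T : ℝ) < r → ∃ S : ℝ≥0,
      HasSum (fun k => (a k : ℝ≥0) * T ^ k) S ∧ (S : ℂ) = R (T : ℝ) := fun T hT0 hTr => by
    obtain ⟨S, hS, hSR⟩ := h T hT0 hTr
    refine ⟨S, ?_, hSR⟩
    rw [← ENNReal.hasSum_coe, ← hS, normalZeta_eq_tsum]
    convert ENNReal.summable.hasSum using 1
    refine tsum_congr fun k => ?_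
    rw [← (hfin k).cast_ncard_eq]
    simp [ha, normalSubgroupCount]
  have hsum : ∀ ρ : ℝ≥0, (ρ : ℝ) < r → Summable fun k => (a k : ℝ) * (ρ : ℝ) ^ k := fun ρ hρ => by
    obtain ⟨T, hT0, hTr⟩ := exists_between
      (show ρ < (⟨r, hr.le⟩ : ℝ≥0) from hρ)
    have hTr : (T : ℝ) < r := hTr
    obtain ⟨S, hS, -⟩ := hreal T (hT0.trans_le' zero_le) hTr
    refine Summable.of_nonneg_of_le (fun k => by positivity) (fun k => ?_)
      (NNReal.summable_coe.2 hS.summable)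
    push_cast
    have : (ρ : ℝ) ≤ T := hT0.le
    gcongr
  have hsummable : ∀ z ∈ Metric.ball (0 : ℂ) r, Summable fun k => (a k : ℂ) * z ^ k := fun z hz => by
    refine Summable.of_norm ?_
    simpa using hsum ‖z‖₊ (by simpa using hz)
  refine ⟨hfin, fun z hz => ?_⟩
  have hdiff : DifferentiableOn ℂ (fun z : ℂ => ∑' k, (a k : ℂ) * z ^ k) (Metric.ball 0 r) := by
    intro w hw
    have hw : ‖w‖ < r := by simpa using hw
    obtain ⟨ρ, hwρ, hρr⟩ := exists_between
      (show ‖w‖₊ < (⟨r, hr.le⟩ : ℝ≥0) from hw)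
    have hρr : (ρ : ℝ) < r := hρr
    have := Complex.differentiableOn_tsum_of_summable_norm (hsum ρ hρr)
      (F := fun k (z : ℂ) => (a k : ℂ) * z ^ k) (U := Metric.ball 0 ρ)
      (fun k => by fun_prop) Metric.isOpen_ball (fun k z hz => by
        have : ‖z‖ ≤ ρ := by simpa using (Metric.mem_ball.1 hz).le
        rw [norm_mul, norm_pow, Complex.norm_natCast]
        gcongr)
    exact (this.differentiableAt (Metric.isOpen_ball.mem_nhds
      (mem_ball_zero_iff.2 hwρ))).differentiableWithinAt
  have heq : Set.EqOn (fun z : ℂ => ∑' k, (a k : ℂ) * z ^ k) R (Metric.ball 0 r) := by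
    refine (hdiff.analyticOnNhd Metric.isOpen_ball).eqOn_of_preconnected_of_frequently_eq
      (hR.analyticOnNhd Metric.isOpen_ball) (convex_ball 0 r).isPreconnected
      (Metric.mem_ball_self hr) ?_
    -- Positive reals accumulate at the centre of the disc, which is all that the identity theorem
    -- needs.
    have ht : Tendsto (fun t : ℝ => (t : ℂ)) (𝓝[>] 0) (𝓝[≠] 0) := by
      refine tendsto_nhdsWithin_iff.2 ⟨?_, ?_⟩
      · exact (Complex.continuous_ofReal.tendsto' 0 0 Complex.ofReal_zero).mono_left
          nhdsWithin_le_nhds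
      · filter_upwards [self_mem_nhdsWithin] with t ht
        simpa using (Set.mem_Ioi.1 ht).ne'
    refine ht.frequently (Eventually.frequently ?_)
    filter_upwards [Ioo_mem_nhdsGT hr] with t ht
    obtain ⟨S, hS, hSR⟩ := hreal ⟨t, ht.1.le⟩ ht.1 ht.2
    refine Eq.trans ?_ hSR
    have : HasSum (fun k => (a k : ℝ) * t ^ k) S := by
      have := NNReal.hasSum_coe.2 hS
      push_cast at this
      exact this
    have := Complex.hasSum_ofReal.2 this
    push_cast at this
    exact this.tsum_eq
  rw [← heq hz]
  exact (hsummable z hz).hasSum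

end dirichlet

/-! ### The closed forms as holomorphic functions on the disc of radius p⁻³ -/

section realAndComplex

open scoped NNReal

variable {p : ℕ} [Fact p.Prime]

theorem exists_latticeZeta_four (T : ℝ≥0) (hT : (p : ℝ) ^ 3 * T < 1) :
    ∃ S : ℝ≥0, latticeZeta p (T : ℝ≥0∞) (Fin 4 → ℤ) = S ∧
      (S : ℝ) = (1 - T : ℝ)⁻¹ * (1 - p * T : ℝ)⁻¹ * (1 - (p : ℝ) ^ 2 * T)⁻¹ *
        (1 - (p : ℝ) ^ 3 * T)⁻¹ := by
  have hp : (1 : ℝ) ≤ p := by exact_mod_cast (Fact.out : p.Prime).one_le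
  have h : ∀ i ≤ 3, (p : ℝ≥0) ^ i * T < 1 := fun i hi => by
    have := pow_mul_pow_lt_one (a := i) (b := 1) hp T.2 hT (by omega) one_ne_zero
    rw [pow_one] at this
    exact_mod_cast this
  have hE : ∀ i ≤ 3, (1 - (p : ℝ≥0∞) ^ i * T)⁻¹ = (((1 - (p : ℝ≥0) ^ i * T)⁻¹ : ℝ≥0) : ℝ≥0∞) :=
    fun i hi => by
      rw [ENNReal.coe_inv (tsub_pos_of_lt (h i hi)).ne']
      push_cast
      rfl
  have hR : ∀ i ≤ 3, (((1 - (p : ℝ≥0) ^ i * T)⁻¹ : ℝ≥0) : ℝ) = (1 - (p : ℝ) ^ i * T)⁻¹ :=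
    fun i hi => by
      rw [NNReal.coe_inv, NNReal.coe_sub (h i hi).le]
      push_cast
      rfl
  refine ⟨∏ i ∈ Finset.range 4, (1 - (p : ℝ≥0) ^ i * T)⁻¹, ?_, ?_⟩
  · rw [latticeZeta_four]
    simp only [Finset.prod_range_succ, Finset.prod_range_zero, one_mul, ENNReal.coe_mul]
    rw [← hE 0 (by simp), ← hE 1 (by simp), ← hE 2 (by simp), ← hE 3 le_rfl, pow_zero, pow_one,
      one_mul]
  · simp only [Finset.prod_range_succ, Finset.prod_range_zero, one_mul, NNReal.coe_mul]
    rw [hR 0 (by simp), hR 1 (by simp), hR 2 (by simp), hR 3 le_rfl, pow_zero, pow_one,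
      one_mul]

/-- |p ^ a z ^ b| ≤ (p³ |z|) ^ b < 1 for a ≤ 3 b, so no denominator vanishes on the disc. -/
theorem one_sub_pow_mul_pow_ne_zero {z : ℂ} (hz : z ∈ Metric.ball (0 : ℂ) ((p : ℝ) ^ 3)⁻¹)
    {a b : ℕ} (hab : a ≤ 3 * b) (hb : b ≠ 0) : 1 - (p : ℂ) ^ a * z ^ b ≠ 0 := by
  have hp : (1 : ℝ) ≤ p := by exact_mod_cast (Fact.out : p.Prime).one_le
  have h3 : (0 : ℝ) < (p : ℝ) ^ 3 := by positivity
  have hz : (p : ℝ) ^ 3 * ‖z‖ < 1 := by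
    rw [mul_comm, ← lt_div_iff₀ h3, one_div]
    simpa using hz
  have h := pow_mul_pow_lt_one hp (norm_nonneg z) hz hab hb
  intro h0
  rw [sub_eq_zero] at h0
  have := congrArg norm h0
  rw [norm_one, norm_mul, norm_pow, norm_pow, Complex.norm_natCast] at this
  exact h.ne this.symm

/-- The normal zeta function of `ℤ⁴` at `p`, as a function of `T = p ^ (-s)`. -/
noncomputable def freeZetaFun (p : ℕ) (z : ℂ) : ℂ :=
  (1 - z)⁻¹ * (1 - p * z)⁻¹ * (1 - (p : ℂ) ^ 2 * z)⁻¹ * (1 - (p : ℂ) ^ 3 * z)⁻¹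

/-- The normal zeta function of `G_S` at `p`, as a function of `T = p ^ (-s)`. -/
noncomputable def segreZetaFun (p : ℕ) (z : ℂ) : ℂ :=
  freeZetaFun p z * (1 - (p : ℂ) ^ 16 * z ^ 8)⁻¹ *
    (segreNumerator (p : ℂ) z / ((1 - (p : ℂ) ^ 7 * z ^ 5) * (1 - (p : ℂ) ^ 12 * z ^ 6) *
      (1 - (p : ℂ) ^ 15 * z ^ 7) * (1 - (p : ℂ) ^ 6 * z ^ 3) * (1 - (p : ℂ) ^ 9 * z ^ 5)))

theorem segreFactor_complex_eq {z : ℂ} (hz : z ∈ Metric.ball (0 : ℂ) ((p : ℝ) ^ 3)⁻¹) :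
    segreFactor (p : ℂ) z =
      segreNumerator (p : ℂ) z / ((1 - (p : ℂ) ^ 7 * z ^ 5) * (1 - (p : ℂ) ^ 12 * z ^ 6) *
        (1 - (p : ℂ) ^ 15 * z ^ 7) * (1 - (p : ℂ) ^ 6 * z ^ 3) * (1 - (p : ℂ) ^ 9 * z ^ 5)) :=
  segreFactor_eq _ _ (Nat.cast_ne_zero.2 (Fact.out : p.Prime).ne_zero)
    (one_sub_pow_mul_pow_ne_zero hz (by simp) (by simp))
    (one_sub_pow_mul_pow_ne_zero hz (by simp) (by simp))
    (one_sub_pow_mul_pow_ne_zero hz (by simp) (by simp))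
    (one_sub_pow_mul_pow_ne_zero hz (by simp) (by simp))
    (one_sub_pow_mul_pow_ne_zero hz (by simp) (by simp))

theorem differentiableOn_freeZetaFun :
    DifferentiableOn ℂ (freeZetaFun p) (Metric.ball 0 ((p : ℝ) ^ 3)⁻¹) := by
  intro z hz
  have h : ∀ i ≤ 3, 1 - (p : ℂ) ^ i * z ≠ 0 := fun i hi => by
    simpa using one_sub_pow_mul_pow_ne_zero (p := p) (a := i) (b := 1) hz (by omega) one_ne_zero
  have h0 : 1 - z ≠ 0 := by simpa using h 0 (by simp)
  have h1 : 1 - (p : ℂ) * z ≠ 0 := by simpa using h 1 (by simp)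
  have h2 := h 2 (by simp)
  have h3 := h 3 le_rfl
  unfold freeZetaFun
  fun_prop (disch := assumption)

theorem differentiableOn_segreZetaFun :
    DifferentiableOn ℂ (segreZetaFun p) (Metric.ball 0 ((p : ℝ) ^ 3)⁻¹) := by
  have h : ∀ a b : ℕ, a ≤ 3 * b → b ≠ 0 → DifferentiableOn ℂ
      (fun z : ℂ => (1 - (p : ℂ) ^ a * z ^ b)⁻¹) (Metric.ball 0 ((p : ℝ) ^ 3)⁻¹) :=
    fun a b hab hb => DifferentiableOn.inv (by fun_prop) fun z hz =>
      one_sub_pow_mul_pow_ne_zero hz hab hb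
  have hN : Differentiable ℂ fun z : ℂ => segreNumerator (p : ℂ) z := by
    unfold segreNumerator
    fun_prop
  unfold segreZetaFun
  simp only [div_eq_mul_inv, mul_inv]
  exact (differentiableOn_freeZetaFun.mul (h 16 8 (by simp) (by simp))).mul
    (hN.differentiableOn.mul (((((h 7 5 (by simp) (by simp)).mul (h 12 6 (by simp) (by simp))).mul
      (h 15 7 (by simp) (by simp))).mul (h 6 3 (by simp) (by simp))).mul
        (h 9 5 (by simp) (by simp))))

theorem ofReal_segreFactor (p T : ℝ) : ((segreFactor p T : ℝ) : ℂ) = segreFactor (p : ℂ) T := by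
  simp [segreFactor, igusaFactor_one, igusaFactor_two, igusaFactor_three, exceptionalFactor]

theorem pow_three_mul_lt_one_of_lt {T : ℝ} (hT : T < ((p : ℝ) ^ 3)⁻¹) : (p : ℝ) ^ 3 * T < 1 := by
  have h3 : (0 : ℝ) < (p : ℝ) ^ 3 := by
    have := (Fact.out : p.Prime).pos
    positivity
  rwa [mul_comm, ← lt_div_iff₀ h3, one_div]

theorem normalZeta_free (T : ℝ≥0) (hT : (T : ℝ) < ((p : ℝ) ^ 3)⁻¹) :
    ∃ S : ℝ≥0, normalZeta p T (Multiplicative (Fin 4 → ℤ)) = S ∧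
      (S : ℂ) = freeZetaFun p (T : ℝ) := by
  obtain ⟨S, hS, hSR⟩ := exists_latticeZeta_four T (pow_three_mul_lt_one_of_lt hT)
  refine ⟨S, (normalZeta_multiplicative _).trans hS, ?_⟩
  have := congrArg (fun t : ℝ => (t : ℂ)) hSR
  simpa [freeZetaFun] using this

theorem normalZeta_segreGroup (T : ℝ≥0) (hT : (T : ℝ) < ((p : ℝ) ^ 3)⁻¹) :
    ∃ S : ℝ≥0, normalZeta p T SegreGroup = S ∧ (S : ℂ) = segreZetaFun p (T : ℝ) := by
  have h3 := pow_three_mul_lt_one_of_lt hT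
  have hz : ((T : ℝ) : ℂ) ∈ Metric.ball (0 : ℂ) ((p : ℝ) ^ 3)⁻¹ := by simpa using hT
  obtain ⟨S₁, h1, h1'⟩ := normalZeta_free (p := p) T hT
  obtain ⟨S₂, h2, h2'⟩ := exists_tsum_segreWeight (p := p) T h3
  refine ⟨S₁ * S₂, ?_, ?_⟩
  · rw [normalZeta_congr segreEquiv, normalZeta_tensorHeisenberg, h2, ENNReal.coe_mul, ← h1,
      normalZeta_multiplicative]
  · have h8 := one_sub_pow_mul_pow_ne_zero (p := p) (a := 16) (b := 8) hz (by simp) (by simp)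
    have h4 := congrArg (fun t : ℝ => (t : ℂ)) h2'
    rw [ofReal_segreFactor] at h4
    push_cast at h4
    rw [segreFactor_complex_eq hz] at h4
    rw [segreZetaFun, ← h4, ← h1']
    push_cast
    field_simp

end realAndComplex

/-! ### The substitution T = p ^ (-s) -/

section substitution

theorem localNormalZetaTerm_eq (G : Type*) [Group G] (p : ℕ) (s : ℂ) (k : ℕ) :
    localNormalZetaTerm G p s k =
      (normalSubgroupCount G (p ^ k) : ℂ) * ((p : ℂ) ^ (-s)) ^ k := by
  rw [localNormalZetaTerm, ← mul_neg, Complex.cpow_nat_mul]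

variable {p : ℕ} [Fact p.Prime]

theorem natCast_cpow_sub_mul (s : ℂ) (a b : ℕ) :
    (p : ℂ) ^ ((a : ℂ) - b * s) = (p : ℂ) ^ a * ((p : ℂ) ^ (-s)) ^ b := by
  have hp : (p : ℂ) ≠ 0 := Nat.cast_ne_zero.2 (Fact.out : p.Prime).ne_zero
  rw [sub_eq_add_neg, Complex.cpow_add _ _ hp, Complex.cpow_natCast, ← mul_neg,
    Complex.cpow_nat_mul]

theorem localRiemannZeta_eq (s : ℂ) {w : ℂ} (a b : ℕ) (hw : -w = a - b * s) :
    localRiemannZeta p w = (1 - (p : ℂ) ^ a * ((p : ℂ) ^ (-s)) ^ b)⁻¹ := by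
  rw [localRiemannZeta, hw, natCast_cpow_sub_mul, one_div]

/-- |p ^ (-s)| = p ^ (-Re s), so Re s > 3 is exactly what places T in the disc. -/
theorem natCast_cpow_neg_mem_ball {s : ℂ} (hs : 3 < s.re) :
    (p : ℂ) ^ (-s) ∈ Metric.ball (0 : ℂ) ((p : ℝ) ^ 3)⁻¹ := by
  have hp := (Fact.out : p.Prime).pos
  rw [mem_ball_zero_iff, Complex.norm_natCast_cpow_of_pos hp, Complex.neg_re,
    Real.rpow_neg (Nat.cast_nonneg _), ← Real.rpow_natCast]
  have h1 : (1 : ℝ) < p := by exact_mod_cast (Fact.out : p.Prime).one_lt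
  have h0 : (0 : ℝ) < p := by positivity
  refine inv_strictAnti₀ (Real.rpow_pos_of_pos h0 _) ?_
  exact Real.rpow_lt_rpow_of_exponent_lt h1 (by exact_mod_cast hs)

theorem segreW_eq_segreFactor (s : ℂ) :
    segreW₀ p s + ((p : ℂ) + 1) ^ 2 * segreW₁ p s + 2 * ((p : ℂ) + 1) * segreW₂ p s =
      segreFactor (p : ℂ) ((p : ℂ) ^ (-s)) := by
  have h1 : segreX p s 1 = (p : ℂ) ^ 7 * ((p : ℂ) ^ (-s)) ^ 5 := by
    rw [← natCast_cpow_sub_mul, segreX]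
    congr 1
    push_cast
    ring
  have h2 : segreX p s 2 = (p : ℂ) ^ 12 * ((p : ℂ) ^ (-s)) ^ 6 := by
    rw [← natCast_cpow_sub_mul, segreX]
    congr 1
    push_cast
    ring
  have h3 : segreX p s 3 = (p : ℂ) ^ 15 * ((p : ℂ) ^ (-s)) ^ 7 := by
    rw [← natCast_cpow_sub_mul, segreX]
    congr 1
    push_cast
    ring
  have h4 : segreY₁ p s = (p : ℂ) ^ 6 * ((p : ℂ) ^ (-s)) ^ 3 := by
    rw [← natCast_cpow_sub_mul, segreY₁]
    norm_num
  have h5 : segreY₂ p s = (p : ℂ) ^ 9 * ((p : ℂ) ^ (-s)) ^ 5 := by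
    rw [← natCast_cpow_sub_mul, segreY₂]
    norm_num
  rw [segreW₀, segreW₁, segreW₂, h1, h2, h3, h4, h5, segreFactor]

theorem localNormalZeta_eq {G : Type*} [Group G] {R : ℂ → ℂ}
    (hR : DifferentiableOn ℂ R (Metric.ball 0 ((p : ℝ) ^ 3)⁻¹))
    (h : ∀ T : NNReal, (T : ℝ) < ((p : ℝ) ^ 3)⁻¹ →
      ∃ S : NNReal, normalZeta p T G = S ∧ (S : ℂ) = R (T : ℝ)) {s : ℂ} (hs : 3 < s.re) :
    LocalNormalZetaConverges G p s ∧ localNormalZeta G p s = R ((p : ℂ) ^ (-s)) := by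
  have hp := (Fact.out : p.Prime).pos
  obtain ⟨hfin, hsum⟩ := hasSum_normalSubgroupCount (p := p) G (by positivity) hR
    fun T _ hT => h T hT
  have hs := hsum _ (natCast_cpow_neg_mem_ball hs)
  simp only [← localNormalZetaTerm_eq] at hs
  exact ⟨⟨hfin, hs.summable⟩, hs.tsum_eq⟩

end substitution

theorem mainTheorem7 :
    ∃ B : Finset ℕ, ∀ p : ℕ, p.Prime → p ∉ B → ∀ s : ℂ, 3 < s.re →
      LocalNormalZetaConverges (Multiplicative (Fin 4 → ℤ)) p s ∧
      localNormalZeta (Multiplicative (Fin 4 → ℤ)) p s =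
        localRiemannZeta p s * localRiemannZeta p (s - 1) * localRiemannZeta p (s - 2) *
          localRiemannZeta p (s - 3) ∧
      LocalNormalZetaConverges SegreGroup p s ∧
      localNormalZeta SegreGroup p s =
        localNormalZeta (Multiplicative (Fin 4 → ℤ)) p s * localRiemannZeta p (8 * s - 16) *
          (segreW₀ p s + ((p : ℂ) + 1) ^ 2 * segreW₁ p s + 2 * ((p : ℂ) + 1) * segreW₂ p s) ∧
      localNormalZeta SegreGroup p s =
        localNormalZeta (Multiplicative (Fin 4 → ℤ)) p s * localRiemannZeta p (8 * s - 16) *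
          localRiemannZeta p (5 * s - 7) * localRiemannZeta p (6 * s - 12) *
          localRiemannZeta p (7 * s - 15) * localRiemannZeta p (3 * s - 6) *
          localRiemannZeta p (5 * s - 9) * segreNumerator (p : ℂ) ((p : ℂ) ^ (-s)) := by
  -- Every count above holds for every prime, so the exceptional set is empty.
  refine ⟨∅, fun p hp _ s hs => ?_⟩
  have : Fact p.Prime := ⟨hp⟩
  have hz := natCast_cpow_neg_mem_ball (p := p) hs
  obtain ⟨hc, hF⟩ := localNormalZeta_eq (p := p) differentiableOn_freeZetaFun
    (fun T hT => normalZeta_free T hT) hs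
  obtain ⟨hc', hS⟩ := localNormalZeta_eq (p := p) differentiableOn_segreZetaFun
    (fun T hT => normalZeta_segreGroup T hT) hs
  have h8 := localRiemannZeta_eq (p := p) s (w := 8 * s - 16) 16 8 (by push_cast; ring)
  refine ⟨hc, ?_, hc', ?_, ?_⟩
  · rw [hF, localRiemannZeta_eq (p := p) s 0 1 (by push_cast; ring),
      localRiemannZeta_eq (p := p) s 1 1 (by push_cast; ring),
      localRiemannZeta_eq (p := p) s 2 1 (by push_cast; ring),
      localRiemannZeta_eq (p := p) s 3 1 (by push_cast; ring)]
    simp only [pow_zero, pow_one, one_mul, freeZetaFun]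
  · rw [hS, hF, segreW_eq_segreFactor, segreFactor_complex_eq hz, h8, segreZetaFun]
  · rw [hS, hF, h8, localRiemannZeta_eq (p := p) s (w := 5 * s - 7) 7 5 (by push_cast; ring),
      localRiemannZeta_eq (p := p) s (w := 6 * s - 12) 12 6 (by push_cast; ring),
      localRiemannZeta_eq (p := p) s (w := 7 * s - 15) 15 7 (by push_cast; ring),
      localRiemannZeta_eq (p := p) s (w := 3 * s - 6) 6 3 (by push_cast; ring),
      localRiemannZeta_eq (p := p) s (w := 5 * s - 9) 9 5 (by push_cast; ring), segreZetaFun]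
    simp only [div_eq_mul_inv, mul_inv]
    ring
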